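/- **Theorem (Exponential concentration).** Let $\Omega$ be a Polish space with its Borel $\sigma$-algebra and a probability measure $\mu$. Let $(Z_t)_{t\ge 0}$ be a time-homogeneous Markov process on $\Omega$ with stationary measure $\mu$, and let $(P_t f)(z) = \mathbb{E}[f(Z_t)\mid Z_0=z]$ be its Markov semigroup, given by the transition kernels of the process, acting on real-valued functions and on functions with values in the complex $d\times d$ matrices $\mathbb{M}_d$ ($d\ge 1$). Suppose that the semigroup is reversible, i.e. $\mathbb{E}_\mu[(P_tf)\,g]=\mathbb{E}_\mu[f\,(P_tg)]$ for all $t\ge 0$ and all $f,g\in L_2(\mu)$, and ergodic, i.e. $P_tf\to\mathbb{E}_\mu f$ in $L_2(\mu)$ as $t\to\infty$ for all $f\in L_2(\mu)$. Define the generator $(\mathcal{L}f)(z)=\lim_{t\downarrow 0}t^{-1}\big((P_tf)(z)-f(z)\big)$, the carré du champ $\Gamma(f,g)=\frac12[\mathcal{L}(fg)-f\mathcal{L}(g)-\mathcal{L}(f)g]$, the iterated carré du champ $\Gamma_2(f,g)=\frac12[\mathcal{L}\Gamma(f,g)-\Gamma(f,\mathcal{L}g)-\Gamma(\mathcal{L}f,g)]$,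 and write $\Gamma(f)=\Gamma(f,f)$, $\Gamma_2(f)=\Gamma_2(f,f)$. Fix an algebra $\mathcal{A}$ of suitable real functions on $\Omega$: a real algebra of measurable functions that contains the constants, whose members are integrable with respect to $\mu$ and to the law of $Z_t$ given $Z_0=z$ for all $t\ge0$ and $z\in\Omega$, such that for every $f\in\mathcal{A}$ the limit defining $\mathcal{L}f$ exists at every point of $\Omega$ and also holds in $L_2(\mu)$, and such that $P_tf\in\mathcal{A}$ and $\mathcal{L}f\in\mathcal{A}$ for every $f\in\mathcal{A}$ and $t\ge 0$. A function $f$ from $\Omega$ to the Hermitian matrices $\mathbb{H}_d$ is called suitable if the real and imaginary parts of its entries belong to $\mathcal{A}$. Assume that the Bakry–Émery criterion holds with a constant $c>0$: for every suitable $f:\Omega\to\mathbb{H}_d$, $\Gamma(f)\preccurlyeq c\,\Gamma_2(f)$ in the semidefinite order, $\mu$-almost everywhere. Let $f:\Omega\to\mathbb{H}_d$ be suitable, let $\operatorname{\overline{tr}}=d^{-1}\operatorname{tr}$, and put $$r_f(\beta)=\frac1\beta\log\mathbb{E}_\mu\operatorname{\overline{tr}}e^{\beta\Gamma(f)}\in[0,+\infty]\quad(\beta>0),\qquad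 v_f=\big\|\,\|\Gamma(f)\|\,\big\|_{L_\infty(\mu)}\in[0,+\infty],$$ where $\|\cdot\|$ is the $\ell_2$ operator norm. Then, for all $t\ge 0$, $$\mathbb{P}_\mu\{\lambda_{\max}(f-\mathbb{E}_\mu f)\ge t\}\le d\cdot\inf_{\beta>0}\exp\!\left(\frac{-t^2}{2c\,r_f(\beta)+2t\sqrt{c/\beta}}\right).$$ If in addition $v_f<+\infty$, then for all $t\ge 0$ $$\mathbb{P}_\mu\{\lambda_{\max}(f-\mathbb{E}_\mu f)\ge t\}\le d\cdot\exp\!\left(\frac{-t^2}{2c\,v_f}\right),$$ and $\lambda_{\max}(f-\mathbb{E}_\mu f)$ is $\mu$-integrable with $$\mathbb{E}_\mu\lambda_{\max}(f-\mathbb{E}_\mu f)\le\sqrt{2c\,v_f\log d}.$$ Likewise for the minimum eigenvalue: for all $t\ge0$, $\mathbb{P}_\mu\{\lambda_{\min}(f-\mathbb{E}_\mu f)\le -t\}$ obeys the first tail bound and, if $v_f<+\infty$, the second; and if $v_f<+\infty$, then $\lambda_{\min}(f-\mathbb{E}_\mu f)$ is $\mu$-integrable with $\mathbb{E}_\mu\lambda_{\min}(f-\mathbb{E}_\mu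 f)\ge-\sqrt{2c\,v_f\log d}$. Conventions: the exponential is $1$ when $r_f(\beta)=+\infty$ or $t=0$, and $\exp(-t^2/(2cv_f))$ is $0$ when $v_f=0$ and $t>0$. -/

import Mathlib

open MeasureTheory ProbabilityTheory Filter Topology
open scoped NNReal ENNReal Matrix Matrix.Norms.L2Operator ComplexOrder

noncomputable section

namespace MatrixMarkov

/-- A Markov semigroup on the state space `Ω`, given by the transition kernels of a
time-homogeneous Markov process `(Z_t)_{t ≥ 0}`: `kernel t z` is the law of `Z_t` conditional on
`Z_0 = z`. -/
structure MarkovSemigroup (Ω : Type*) [MeasurableSpace Ω] where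
  kernel : ℝ≥0 → Kernel Ω Ω
  isMarkovKernel : ∀ t, IsMarkovKernel (kernel t)
  kernel_zero : kernel 0 = Kernel.id
  kernel_add : ∀ s t, kernel (s + t) = kernel t ∘ₖ kernel s

namespace MarkovSemigroup

variable {Ω : Type*} [MeasurableSpace Ω]

/-! The semigroup, its generator and its carré du champ operators act on functions with values
in `E`. They are used for `E = ℝ` and for the algebra `E` of complex `d × d` matrices. -/

section Operators

variable {E : Type*} [NormedRing E] [NormedAlgebra ℝ E]

/-- `(P_t f)(z) = 𝔼[f(Z_t) | Z_0 = z]`. -/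
def act (P : MarkovSemigroup Ω) (t : ℝ≥0) (f : Ω → E) : Ω → E :=
  fun z => ∫ y, f y ∂(P.kernel t z)

/-- The difference quotient `((P_t f)(z) - f(z)) / t`. -/
def diffQuot (P : MarkovSemigroup Ω) (f : Ω → E) (t : ℝ≥0) (z : Ω) : E :=
  (t : ℝ)⁻¹ • (P.act t f z - f z)

/-- The infinitesimal generator, `(𝓛 f)(z) = lim_{t ↓ 0} ((P_t f)(z) - f(z)) / t`. -/
def generator (P : MarkovSemigroup Ω) (f : Ω → E) : Ω → E :=
  fun z => limUnder (𝓝[>] (0 : ℝ≥0)) (fun t => P.diffQuot f t z)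

/-- The carré du champ `Γ(f, g) = (1/2) [𝓛(f g) - f 𝓛(g) - 𝓛(f) g]`. -/
def gamma (P : MarkovSemigroup Ω) (f g : Ω → E) : Ω → E :=
  (1 / 2 : ℝ) • (P.generator (f * g) - f * P.generator g - P.generator f * g)

/-- The iterated carré du champ `Γ₂(f, g) = (1/2) [𝓛 Γ(f, g) - Γ(f, 𝓛(g)) - Γ(𝓛(f), g)]`. -/
def gamma₂ (P : MarkovSemigroup Ω) (f g : Ω → E) : Ω → E :=
  (1 / 2 : ℝ) • (P.generator (P.gamma f g) - P.gamma f (P.generator g)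
    - P.gamma (P.generator f) g)

end Operators

/-- `μ` is a stationary measure of the semigroup. -/
def IsStationary (P : MarkovSemigroup Ω) (μ : Measure Ω) : Prop :=
  ∀ t, Kernel.Invariant (P.kernel t) μ

/-- Reversibility: every `P_t` is a symmetric operator on `L_2(μ)`. -/
def IsReversible (P : MarkovSemigroup Ω) (μ : Measure Ω) : Prop :=
  ∀ (t : ℝ≥0) (f g : Ω → ℝ), MemLp f 2 μ → MemLp g 2 μ →
    ∫ z, P.act t f z * g z ∂μ = ∫ z, f z * P.act t g z ∂μ

/-- Ergodicity: `P_t f → 𝔼_μ f` in `L_2(μ)` as `t → ∞`, for all `f` in `L_2(μ)`. -/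
def IsErgodic (P : MarkovSemigroup Ω) (μ : Measure Ω) : Prop :=
  ∀ f : Ω → ℝ, MemLp f 2 μ →
    Tendsto (fun t : ℝ≥0 => eLpNorm (fun z => P.act t f z - ∫ y, f y ∂μ) 2 μ) atTop (𝓝 0)

/-- An algebra of suitable real functions: an algebra of measurable, `μ`-integrable functions
(hence of functions in `L_p(μ)` for every finite `p`) that contains the constants, on which
the semigroup and the generator are defined and which they leave invariant, the limit that
defines the generator being taken pointwise and in `L_2(μ)`. Functions in the algebra may be
unbounded. -/
structure IsSuitableAlgebra (P : MarkovSemigroup Ω) (μ : Measure Ω)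
    (A : Subalgebra ℝ (Ω → ℝ)) : Prop where
  measurable : ∀ f ∈ A, Measurable f
  integrable : ∀ f ∈ A, Integrable f μ
  integrable_kernel : ∀ f ∈ A, ∀ t z, Integrable f (P.kernel t z)
  act_mem : ∀ f ∈ A, ∀ t, P.act t f ∈ A
  tendsto_generator : ∀ f ∈ A, ∀ z,
    Tendsto (fun t : ℝ≥0 => P.diffQuot f t z) (𝓝[>] 0) (𝓝 (P.generator f z))
  tendsto_generator_L2 : ∀ f ∈ A,
    Tendsto (fun t : ℝ≥0 => eLpNorm (P.diffQuot f t - P.generator f) 2 μ) (𝓝[>] 0) (𝓝 0)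
  generator_mem : ∀ f ∈ A, P.generator f ∈ A

end MarkovSemigroup

section Matrices

variable {Ω : Type*} {d : ℕ}

/-- A suitable function with values in the Hermitian `d × d` matrices: the real and
imaginary parts of its entries belong to the algebra `A` of suitable real functions. -/
structure IsSuitable (A : Subalgebra ℝ (Ω → ℝ)) (f : Ω → Matrix (Fin d) (Fin d) ℂ) : Prop where
  isHermitian : ∀ z, (f z).IsHermitian
  re_mem : ∀ i j, (fun z => (f z i j).re) ∈ A
  im_mem : ∀ i j, (fun z => (f z i j).im) ∈ A

/-- The largest eigenvalue of a Hermitian matrix. -/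
def lambdaMax (M : Matrix (Fin d) (Fin d) ℂ) : ℝ := sSup (spectrum ℝ M)

/-- The smallest eigenvalue of a Hermitian matrix. -/
def lambdaMin (M : Matrix (Fin d) (Fin d) ℂ) : ℝ := sInf (spectrum ℝ M)

/-- The normalized trace `d⁻¹ tr M` (its real part, which is all of it for Hermitian `M`). -/
def normTrace (M : Matrix (Fin d) (Fin d) ℂ) : ℝ := (d : ℝ)⁻¹ * M.trace.re

variable [MeasurableSpace Ω]

/-- The centered random matrix `f - 𝔼_μ f`. -/
def centered (μ : Measure Ω) (f : Ω → Matrix (Fin d) (Fin d) ℂ) :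
    Ω → Matrix (Fin d) (Fin d) ℂ :=
  fun z => f z - ∫ y, f y ∂μ

/-- The Bakry–Émery criterion with constant `c`: `Γ(f) ≼ c Γ₂(f)` holds `μ`-almost everywhere,
for all suitable `f` with values in the Hermitian `d × d` matrices. -/
def BakryEmery (P : MarkovSemigroup Ω) (μ : Measure Ω) (A : Subalgebra ℝ (Ω → ℝ)) (d : ℕ)
    (c : ℝ) : Prop :=
  ∀ f : Ω → Matrix (Fin d) (Fin d) ℂ, IsSuitable A f →
    ∀ᵐ z ∂μ, (c • P.gamma₂ f f z - P.gamma f f z).PosSemidef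

/-- The exponential mean `r_f(β) = β⁻¹ log 𝔼_μ tr̄ exp(β Γ(f))`, which may be `+∞`. -/
def expMean (P : MarkovSemigroup Ω) (μ : Measure Ω) (f : Ω → Matrix (Fin d) (Fin d) ℂ)
    (β : ℝ) : EReal :=
  ((β⁻¹ : ℝ) : EReal) *
    ENNReal.log (∫⁻ z, ENNReal.ofReal (normTrace (NormedSpace.exp (β • P.gamma f f z))) ∂μ)

/-- The variance proxy `v_f`, the `L_∞(μ)` norm of the `ℓ_2` operator norm of `Γ(f)`. -/
def varProxy (P : MarkovSemigroup Ω) (μ : Measure Ω) (f : Ω → Matrix (Fin d) (Fin d) ℂ) :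
    ℝ≥0∞ :=
  eLpNorm (P.gamma f f) ∞ μ

/-- The bound `d · inf_{β > 0} exp(-t² / (2 c r_f(β) + 2 t √(c / β)))`. The quotient is `0` when
`r_f(β) = +∞`. -/
def expTail (P : MarkovSemigroup Ω) (μ : Measure Ω) (f : Ω → Matrix (Fin d) (Fin d) ℂ)
    (c t : ℝ) : ℝ≥0∞ :=
  (d : ℝ≥0∞) * ⨅ (β : ℝ) (_ : 0 < β),
    EReal.exp (((-t ^ 2 : ℝ) : EReal) /
      (((2 * c : ℝ) : EReal) * expMean P μ f β + ((2 * t * √(c / β) : ℝ) : EReal)))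

/-- The bound `d · exp(-t² / (2 c v_f))`. The quotient is formed in `[0, ∞]`, so that the bound is
`0` when `v_f = 0` and `t > 0`. -/
def gaussTail (P : MarkovSemigroup Ω) (μ : Measure Ω) (f : Ω → Matrix (Fin d) (Fin d) ℂ)
    (c t : ℝ) : ℝ≥0∞ :=
  (d : ℝ≥0∞) * EReal.exp
    (-((ENNReal.ofReal (t ^ 2) / (ENNReal.ofReal (2 * c) * varProxy P μ f) : ℝ≥0∞) : EReal))

end Matrices

end MatrixMarkov

end

open MatrixMarkov

set_option linter.unusedSectionVars false

/-! Write `m(θ)` for the normalized trace moment generating function of centered `f`, with the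
exponential replaced by `φ(x) = exp(θ min(x, k))`. The truncation keeps all quantities finite when
`f` has no exponential moments. It costs nothing in the tail bound at level `t`, where `k = t`,
because `min(λ, t) = t` as soon as `λ ≥ t`.

The engine is a bound for `m'(θ) ≤ 𝔼 tr̄[f φ(f)]`. Put `K = φ(f)`. Since `P_t f → 0` by ergodicity,
`𝔼 tr[f K]` is recovered by integrating `-𝔼 tr[𝓛(P_t f) K]` over `t ≥ 0`. Reversibility makes `(Z_0,
Z_τ)` exchangeable, so this Dirichlet form is a limit of `(2τ)⁻¹ 𝔼 tr[(h(Z_τ) - h(Z_0)) (K(Z_τ) -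
K(Z_0))]` with `h = P_t f`. The mean value trace inequality `reTr_mul_cfc_sub_cfc_le` separates the
two increments, and `neg_integral_reTr_generator_le` bounds the form by `(θ/2)(s 𝔼 tr[Γ(f) K] + s⁻¹
𝔼 tr[Γ(P_t f) K])` for every `s > 0`. The Bakry–Émery criterion gives, in weak form, `Γ(P_t f) ≼
e^{-2t/c} P_t Γ(f)` (`integral_reTr_gamma_act_le`). With `s = e^{-t/c}` the integrand decays like
`e^{-t/c}`, and integration yields `m'(θ) ≤ c θ R` whenever `R` bounds `𝔼 tr̄[Γ(f)(Z_0) φ(f)(Z_t)]`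
for all `t` (`integral_reTr_mul_truncExp_le`, `truncMGF'_le_of_forall`).

There are two ways to choose `R`. If `‖Γ(f)‖ ≤ v`, then `R = v m(θ)` and `m(θ) ≤ exp(c v θ²/2)`.
Otherwise the Gibbs variational inequality `reTr_mul_cfc_exp_le` decouples `Γ(f)` from `φ(f)`; this
gives a differential inequality for `log m` that integrates to a Bernstein-type bound governed by
`r_f(β)`. Markov's inequality and Jensen's inequality finish the argument, and the smallest
eigenvalue is handled through `-f`. -/

namespace MatrixMarkov

/-! ### Trace inequalities for pairs of Hermitian matrices. -/

section MatrixInequalities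

variable {d : ℕ}

/-- The real part of the trace, as a continuous linear functional. -/
noncomputable def reTr (d : ℕ) : Matrix (Fin d) (Fin d) ℂ →L[ℝ] ℝ :=
  LinearMap.toContinuousLinearMap
    (Complex.reLm.comp (Matrix.traceLinearMap (Fin d) ℝ ℂ))

theorem reTr_apply (X : Matrix (Fin d) (Fin d) ℂ) : reTr d X = X.trace.re := rfl

theorem reTr_mul_comm (X Y : Matrix (Fin d) (Fin d) ℂ) : reTr d (X * Y) = reTr d (Y * X) := by
  rw [reTr_apply, reTr_apply, Matrix.trace_mul_comm]

/-- The diagonal matrix with real diagonal `a`. -/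
noncomputable def realDiag (a : Fin d → ℝ) : Matrix (Fin d) (Fin d) ℂ :=
  Matrix.diagonal fun i => (a i : ℂ)

theorem reTr_diag_mul_diag (a b : Fin d → ℝ) (W : Matrix (Fin d) (Fin d) ℂ) :
    reTr d (realDiag a * W * realDiag b * Wᴴ) = ∑ i, ∑ j, a i * b j * ‖W i j‖ ^ 2 := by
  rw [reTr_apply, Matrix.trace, Complex.re_sum]
  refine Finset.sum_congr rfl fun i _ => ?_
  rw [Matrix.diag_apply, Matrix.mul_apply, Complex.re_sum]
  refine Finset.sum_congr rfl fun j _ => ?_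
  rw [realDiag, realDiag, Matrix.mul_diagonal, Matrix.diagonal_mul, Matrix.conjTranspose_apply]
  rw [← Complex.normSq_eq_norm_sq]
  have : (a i : ℂ) * W i j * (b j : ℂ) * star (W i j)
      = ((a i * b j * Complex.normSq (W i j) : ℝ) : ℂ) := by
    push_cast
    rw [← Complex.mul_conj]
    simp only [Complex.star_def]
    ring
  rw [this, Complex.ofReal_re]

theorem realDiag_one : (realDiag (fun _ => 1) : Matrix (Fin d) (Fin d) ℂ) = 1 := by
  simp [realDiag]

/-- The unitary matrix of eigenvectors. -/
noncomputable def eigU {A : Matrix (Fin d) (Fin d) ℂ} (hA : A.IsHermitian) :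
    Matrix (Fin d) (Fin d) ℂ := hA.eigenvectorUnitary

variable {A B : Matrix (Fin d) (Fin d) ℂ}

theorem eigU_mul_conjTranspose (hA : A.IsHermitian) : eigU hA * (eigU hA)ᴴ = 1 :=
  Unitary.mul_star_self_of_mem hA.eigenvectorUnitary.2

theorem conjTranspose_mul_eigU (hA : A.IsHermitian) : (eigU hA)ᴴ * eigU hA = 1 :=
  Unitary.star_mul_self_of_mem hA.eigenvectorUnitary.2

theorem cfc_eq_eigU (hA : A.IsHermitian) (φ : ℝ → ℝ) :
    cfc φ A = eigU hA * realDiag (fun i => φ (hA.eigenvalues i)) * (eigU hA)ᴴ := by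
  rw [hA.cfc_eq, Matrix.IsHermitian.cfc, Unitary.conjStarAlgAut_apply]
  rfl

theorem eq_eigU (hA : A.IsHermitian) :
    A = eigU hA * realDiag hA.eigenvalues * (eigU hA)ᴴ := by
  conv_lhs => rw [← cfc_id ℝ A hA.isSelfAdjoint]
  rw [cfc_eq_eigU hA]
  rfl

/-- The squared moduli of the entries of the overlap matrix of two eigenbases. -/
noncomputable def overlap (hA : A.IsHermitian) (hB : B.IsHermitian) (i j : Fin d) : ℝ :=
  ‖((eigU hA)ᴴ * eigU hB) i j‖ ^ 2

theorem overlap_nonneg (hA : A.IsHermitian) (hB : B.IsHermitian) (i j : Fin d) :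
    0 ≤ overlap hA hB i j := sq_nonneg _

/-- The weights are nonnegative and do not depend on `φ` and `ψ`. A trace inequality between
functions of two noncommuting matrices thus reduces to a scalar inequality for each pair of
eigenvalues. -/
theorem reTr_cfc_mul_cfc (hA : A.IsHermitian) (hB : B.IsHermitian) (φ ψ : ℝ → ℝ) :
    reTr d (cfc φ A * cfc ψ B) = ∑ i, ∑ j,
      φ (hA.eigenvalues i) * ψ (hB.eigenvalues j) * overlap hA hB i j := by
  rw [cfc_eq_eigU hA, cfc_eq_eigU hB]
  simp only [overlap]
  rw [← reTr_diag_mul_diag (fun i => φ (hA.eigenvalues i)) (fun i => ψ (hB.eigenvalues i)),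
    Matrix.conjTranspose_mul, Matrix.conjTranspose_conjTranspose]
  simp only [Matrix.mul_assoc]
  rw [reTr_mul_comm]
  simp only [Matrix.mul_assoc]

theorem cfc_const_one_eq (A : Matrix (Fin d) (Fin d) ℂ) (hA : A.IsHermitian) :
    cfc (fun _ : ℝ => (1 : ℝ)) A = 1 :=
  cfc_const_one ℝ A hA.isSelfAdjoint

theorem reTr_cfc_eq_overlap_right (hA : A.IsHermitian) (hB : B.IsHermitian) (ψ : ℝ → ℝ) :
    reTr d (cfc ψ B) = ∑ i, ∑ j, ψ (hB.eigenvalues j) * overlap hA hB i j := by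
  have := reTr_cfc_mul_cfc hA hB (fun _ => 1) ψ
  rw [cfc_const_one_eq A hA, one_mul] at this
  simpa using this

theorem reTr_cfc_eq_overlap_left (hA : A.IsHermitian) (hB : B.IsHermitian) (φ : ℝ → ℝ) :
    reTr d (cfc φ A) = ∑ i, ∑ j, φ (hA.eigenvalues i) * overlap hA hB i j := by
  have := reTr_cfc_mul_cfc hA hB φ (fun _ => 1)
  rw [cfc_const_one_eq B hB, mul_one] at this
  simpa using this

theorem reTr_cfc (hA : A.IsHermitian) (φ : ℝ → ℝ) :
    reTr d (cfc φ A) = ∑ i, φ (hA.eigenvalues i) := by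
  rw [cfc_eq_eigU hA, reTr_mul_comm, ← Matrix.mul_assoc, conjTranspose_mul_eigU, Matrix.one_mul,
    reTr_apply, realDiag, Matrix.trace_diagonal]
  simp

/-- **Klein's inequality** for the exponential, in Gibbs variational form. -/
theorem reTr_mul_cfc_exp_le (hA : A.IsHermitian) (hB : B.IsHermitian) (ψ : ℝ → ℝ) :
    reTr d (A * cfc (fun x => Real.exp (ψ x)) B) ≤
      reTr d (cfc (fun x => ψ x * Real.exp (ψ x) - Real.exp (ψ x)) B)
        + reTr d (cfc Real.exp A) := by
  conv_lhs => rw [← cfc_id ℝ A hA.isSelfAdjoint]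
  rw [reTr_cfc_mul_cfc hA hB, reTr_cfc_eq_overlap_right hA hB, reTr_cfc_eq_overlap_left hA hB,
    ← Finset.sum_add_distrib]
  refine Finset.sum_le_sum fun i _ => ?_
  rw [← Finset.sum_add_distrib]
  refine Finset.sum_le_sum fun j _ => ?_
  rw [← add_mul]
  refine mul_le_mul_of_nonneg_right ?_ (overlap_nonneg _ _ _ _)
  set a := hA.eigenvalues i
  set h := ψ (hB.eigenvalues j)
  -- The scalar inequality is convexity: the graph of `exp` at `a` lies above its tangent line at
  -- `h`.
  have h1 := Real.add_one_le_exp (a - h)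
  have h2 : Real.exp a = Real.exp h * Real.exp (a - h) := by rw [← Real.exp_add]; ring_nf
  simp only [id]
  rw [h2]
  nlinarith [Real.exp_pos h]

theorem abs_eigenvalues_le (hA : A.IsHermitian) (i : Fin d) : |hA.eigenvalues i| ≤ ‖A‖ := by
  have h := spectrum.norm_le_norm_mul_of_mem (hA.eigenvalues_mem_spectrum_real i)
  have : Nonempty (Fin d) := ⟨i⟩
  rwa [CStarRing.norm_one, mul_one, Real.norm_eq_abs] at h

theorem reTr_mul_cfc_le (hA : A.IsHermitian) (hB : B.IsHermitian) {φ : ℝ → ℝ}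
    (hφ : ∀ x, 0 ≤ φ x) : reTr d (A * cfc φ B) ≤ ‖A‖ * reTr d (cfc φ B) := by
  conv_lhs => rw [← cfc_id ℝ A hA.isSelfAdjoint]
  rw [reTr_cfc_mul_cfc hA hB, reTr_cfc_eq_overlap_right hA hB, Finset.mul_sum]
  refine Finset.sum_le_sum fun i _ => ?_
  rw [Finset.mul_sum]
  refine Finset.sum_le_sum fun j _ => ?_
  rw [← mul_assoc]
  refine mul_le_mul_of_nonneg_right ?_ (overlap_nonneg _ _ _ _)
  exact mul_le_mul_of_nonneg_right ((le_abs_self _).trans (abs_eigenvalues_le hA i)) (hφ _)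

/-- The left side does not involve `B`. Its eigenbasis is inserted through `V Vᴴ = 1` so that
functions of `A` and of `B` are summed against the same squared entries of `Y`, taken between the
two eigenbases. -/
theorem reTr_mul_self_mul_cfc_left (hA : A.IsHermitian) (hB : B.IsHermitian)
    {Y : Matrix (Fin d) (Fin d) ℂ} (hY : Y.IsHermitian) (χ : ℝ → ℝ) :
    reTr d (Y * Y * cfc χ A)
      = ∑ i, ∑ j, χ (hA.eigenvalues i) * ‖((eigU hA)ᴴ * Y * eigU hB) i j‖ ^ 2 := by
  have := reTr_diag_mul_diag (fun i => χ (hA.eigenvalues i)) (fun _ => 1)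
    ((eigU hA)ᴴ * Y * eigU hB)
  simp only [mul_one] at this
  rw [← this, realDiag_one, cfc_eq_eigU hA, Matrix.conjTranspose_mul, Matrix.conjTranspose_mul,
    Matrix.conjTranspose_conjTranspose, hY.eq]
  have e : realDiag (fun i => χ (hA.eigenvalues i)) * ((eigU hA)ᴴ * Y * eigU hB) * 1
      * ((eigU hB)ᴴ * (Y * eigU hA))
      = (realDiag (fun i => χ (hA.eigenvalues i)) * (eigU hA)ᴴ) * (Y * Y * eigU hA) := by
    rw [mul_one]
    calc _ = realDiag (fun i => χ (hA.eigenvalues i)) * (eigU hA)ᴴ * Y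
          * (eigU hB * (eigU hB)ᴴ) * (Y * eigU hA) := by simp only [Matrix.mul_assoc]
      _ = _ := by rw [eigU_mul_conjTranspose]; simp only [Matrix.mul_assoc, Matrix.one_mul]
  rw [e, reTr_mul_comm (realDiag _ * _)]
  congr 1
  simp only [Matrix.mul_assoc]

theorem reTr_mul_self_mul_cfc_right (hA : A.IsHermitian) (hB : B.IsHermitian)
    {Y : Matrix (Fin d) (Fin d) ℂ} (hY : Y.IsHermitian) (χ : ℝ → ℝ) :
    reTr d (Y * Y * cfc χ B)
      = ∑ i, ∑ j, χ (hB.eigenvalues j) * ‖((eigU hA)ᴴ * Y * eigU hB) i j‖ ^ 2 := by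
  rw [reTr_mul_self_mul_cfc_left hB hA hY, Finset.sum_comm]
  refine Finset.sum_congr rfl fun i _ => Finset.sum_congr rfl fun j _ => ?_
  have : (eigU hB)ᴴ * Y * eigU hA = ((eigU hA)ᴴ * Y * eigU hB)ᴴ := by
    simp [Matrix.conjTranspose_mul, hY.eq, Matrix.mul_assoc]
  rw [this, Matrix.conjTranspose_apply, norm_star]

/-- **Mean value trace inequality.** -/
theorem reTr_mul_cfc_sub_cfc_le (hA : A.IsHermitian) (hB : B.IsHermitian)
    {C : Matrix (Fin d) (Fin d) ℂ} (hC : C.IsHermitian) {φ χ : ℝ → ℝ} (hχ : ∀ x, 0 ≤ χ x)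
    (hφ : ∀ x y, |φ x - φ y| ≤ |x - y| * ((χ x + χ y) / 2)) {s : ℝ} (hs : 0 < s) :
    reTr d (C * (cfc φ A - cfc φ B)) ≤
      1 / 4 * reTr d ((s • ((A - B) * (A - B)) + s⁻¹ • (C * C)) * (cfc χ A + cfc χ B)) := by
  set U := eigU hA with hU
  set V := eigU hB with hV
  set W := Uᴴ * V with hW
  have hUU : U * Uᴴ = 1 := eigU_mul_conjTranspose hA
  have hVV : V * Vᴴ = 1 := eigU_mul_conjTranspose hB
  have hUU' : Uᴴ * U = 1 := conjTranspose_mul_eigU hA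
  have hVV' : Vᴴ * V = 1 := conjTranspose_mul_eigU hB
  set a := hA.eigenvalues
  set b := hB.eigenvalues
  -- Between the two eigenbases, `A - B` is the overlap matrix multiplied entrywise by the
  -- eigenvalue differences. This turns the scalar bound on `φ x - φ y` into one involving the
  -- entries of `A - B`.
  have hD : ∀ i j, (Uᴴ * (A - B) * V) i j = ((a i - b j : ℝ) : ℂ) * W i j := by
    intro i j
    have e : Uᴴ * (A - B) * V = realDiag a * W - W * realDiag b := by
      rw [mul_sub, sub_mul]
      congr 1
      · conv_lhs => rw [eq_eigU hA]
        rw [← hU, ← Matrix.mul_assoc, ← Matrix.mul_assoc, hUU', Matrix.one_mul, Matrix.mul_assoc]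
      · conv_lhs => rw [eq_eigU hB]
        rw [← hV, Matrix.mul_assoc, Matrix.mul_assoc, hVV', Matrix.mul_one, ← Matrix.mul_assoc]
    rw [e, Matrix.sub_apply, realDiag, realDiag, Matrix.diagonal_mul, Matrix.mul_diagonal]
    push_cast
    ring
  have hL1 : reTr d (C * cfc φ A) = ∑ i, ∑ j, φ (a i) * ((Vᴴ * C * U) j i * W i j).re := by
    have e : (C * cfc φ A).trace = (W * (Vᴴ * C * U) * realDiag (fun i => φ (a i))).trace := by
      rw [cfc_eq_eigU hA, Matrix.trace_mul_comm, hW]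
      calc _ = (Uᴴ * C * (U * realDiag fun i => φ (a i))).trace := by
            rw [Matrix.mul_assoc, Matrix.mul_assoc, Matrix.trace_mul_comm]
            simp only [Matrix.mul_assoc, hU, a]
            rw [← Matrix.trace_mul_comm]
            simp only [Matrix.mul_assoc]
        _ = (Uᴴ * (V * Vᴴ) * C * (U * realDiag fun i => φ (a i))).trace := by
            rw [hVV, Matrix.mul_one]
        _ = _ := by simp only [Matrix.mul_assoc]
    rw [reTr_apply, e, Matrix.trace, Complex.re_sum]
    refine Finset.sum_congr rfl fun i _ => ?_
    rw [Matrix.diag_apply, realDiag, Matrix.mul_diagonal, Matrix.mul_apply, Finset.sum_mul,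
      Complex.re_sum]
    refine Finset.sum_congr rfl fun j _ => ?_
    rw [Complex.re_mul_ofReal, mul_comm (W i j)]
    ring
  have hL2 : reTr d (C * cfc φ B) = ∑ i, ∑ j, φ (b j) * ((Vᴴ * C * U) j i * W i j).re := by
    have e : (C * cfc φ B).trace = (Vᴴ * C * U * W * realDiag (fun i => φ (b i))).trace := by
      rw [cfc_eq_eigU hB, hW]
      calc _ = (Vᴴ * C * (V * realDiag fun i => φ (b i))).trace := by
            rw [← Matrix.mul_assoc, Matrix.trace_mul_comm]
            simp only [Matrix.mul_assoc, hV, b]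
        _ = (Vᴴ * C * (U * Uᴴ) * (V * realDiag fun i => φ (b i))).trace := by
            rw [hUU, Matrix.mul_one]
        _ = _ := by simp only [Matrix.mul_assoc]
    rw [reTr_apply, e, Matrix.trace, Complex.re_sum, Finset.sum_comm]
    refine Finset.sum_congr rfl fun i _ => ?_
    rw [Matrix.diag_apply, realDiag, Matrix.mul_diagonal, Matrix.mul_apply, Finset.sum_mul,
      Complex.re_sum]
    refine Finset.sum_congr rfl fun j _ => ?_
    rw [Complex.re_mul_ofReal]
    ring
  have hAB : (A - B).IsHermitian := hA.sub hB
  have hR : 1 / 4 * reTr d ((s • ((A - B) * (A - B)) + s⁻¹ • (C * C)) * (cfc χ A + cfc χ B))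
      = ∑ i, ∑ j, 1 / 4 * ((χ (a i) + χ (b j)) * (s * ‖(Uᴴ * (A - B) * V) i j‖ ^ 2
          + s⁻¹ * ‖(Uᴴ * C * V) i j‖ ^ 2)) := by
    rw [add_mul, smul_mul_assoc, smul_mul_assoc, mul_add, mul_add, map_add, map_smul, map_smul,
      map_add, map_add, reTr_mul_self_mul_cfc_left hA hB hAB, reTr_mul_self_mul_cfc_right hA hB hAB,
      reTr_mul_self_mul_cfc_left hA hB hC, reTr_mul_self_mul_cfc_right hA hB hC]
    simp only [smul_eq_mul, Finset.mul_sum, ← Finset.sum_add_distrib]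
    refine Finset.sum_congr rfl fun i _ => Finset.sum_congr rfl fun j _ => ?_
    simp only [a, b, U, V]
    ring
  rw [hR, mul_sub, map_sub, hL1, hL2, ← Finset.sum_sub_distrib]
  refine Finset.sum_le_sum fun i _ => ?_
  rw [← Finset.sum_sub_distrib]
  refine Finset.sum_le_sum fun j _ => ?_
  have hCn : ‖(Vᴴ * C * U) j i‖ = ‖(Uᴴ * C * V) i j‖ := by
    have : Vᴴ * C * U = (Uᴴ * C * V)ᴴ := by
      simp [Matrix.conjTranspose_mul, hC.eq, Matrix.mul_assoc]
    rw [this, Matrix.conjTranspose_apply, norm_star]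
  rw [← sub_mul, hD, norm_mul, Complex.norm_real, Real.norm_eq_abs]
  set c := ‖(Uᴴ * C * V) i j‖
  set w := ‖W i j‖
  set D := |a i - b j|
  set X := (χ (a i) + χ (b j)) / 2 with hX
  have hX0 : 0 ≤ X := by have := hχ (a i); have := hχ (b j); positivity
  have h1 : (φ (a i) - φ (b j)) * ((Vᴴ * C * U) j i * W i j).re ≤ D * X * (c * w) := by
    refine (le_abs_self _).trans ?_
    rw [abs_mul]
    refine mul_le_mul (hφ _ _) ?_ (abs_nonneg _) (by positivity)
    refine (Complex.abs_re_le_norm _).trans ?_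
    rw [norm_mul, hCn]
  refine h1.trans ?_
  -- Weighted arithmetic-geometric mean inequality; this is where the free parameter `s` enters.
  have h2 : 2 * ((D * w) * c) ≤ s * (D * w) ^ 2 + s⁻¹ * c ^ 2 := by
    have : 0 ≤ s * (D * w - s⁻¹ * c) ^ 2 := by positivity
    have e : s * (D * w - s⁻¹ * c) ^ 2 = s * (D * w) ^ 2 + s⁻¹ * c ^ 2 - 2 * ((D * w) * c) := by
      field_simp
      ring
    linarith
  have h3 : χ (a i) + χ (b j) = 2 * X := by rw [hX]; ring
  rw [h3]
  nlinarith

end MatrixInequalities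

/-! ### Extreme eigenvalues and measurability of spectral functions. -/

section Eigenvalues

variable {d : ℕ} {A B : Matrix (Fin d) (Fin d) ℂ}

theorem reTr_mul_cfc_nonneg (hA : A.PosSemidef) (hB : B.IsHermitian) {φ : ℝ → ℝ}
    (hφ : ∀ x, 0 ≤ φ x) : 0 ≤ reTr d (A * cfc φ B) := by
  rw [← cfc_id ℝ A hA.isHermitian.isSelfAdjoint, reTr_cfc_mul_cfc hA.isHermitian hB]
  exact Finset.sum_nonneg fun i _ => Finset.sum_nonneg fun j _ =>
    mul_nonneg (mul_nonneg (hA.eigenvalues_nonneg i) (hφ _)) (overlap_nonneg _ _ _ _)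

theorem reTr_cfc_mono (hA : A.IsHermitian) {φ ψ : ℝ → ℝ} (h : ∀ x, φ x ≤ ψ x) :
    reTr d (cfc φ A) ≤ reTr d (cfc ψ A) := by
  rw [reTr_cfc hA, reTr_cfc hA]
  exact Finset.sum_le_sum fun i _ => h _

theorem exists_lambdaMax_eq (hd : 0 < d) (hA : A.IsHermitian) :
    ∃ i, lambdaMax A = hA.eigenvalues i := by
  have hne : (spectrum ℝ A).Nonempty := by
    rw [hA.spectrum_real_eq_range_eigenvalues]
    exact ⟨_, ⟨⟨0, hd⟩, rfl⟩⟩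
  have := hne.csSup_mem (Matrix.finite_real_spectrum (A := A))
  rw [hA.spectrum_real_eq_range_eigenvalues] at this
  obtain ⟨i, hi⟩ := this
  exact ⟨i, by rw [lambdaMax, hA.spectrum_real_eq_range_eigenvalues, hi]⟩

theorem eigenvalues_le_lambdaMax (hA : A.IsHermitian) (i : Fin d) :
    hA.eigenvalues i ≤ lambdaMax A :=
  le_csSup (Matrix.finite_real_spectrum (A := A)).bddAbove (hA.eigenvalues_mem_spectrum_real i)

theorem abs_lambdaMax_le (hd : 0 < d) (hA : A.IsHermitian) : |lambdaMax A| ≤ ‖A‖ := by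
  obtain ⟨i, hi⟩ := exists_lambdaMax_eq hd hA
  rw [hi]
  exact abs_eigenvalues_le hA i

theorem apply_lambdaMax_le_reTr_cfc (hd : 0 < d) (hA : A.IsHermitian) {φ : ℝ → ℝ}
    (hφ : ∀ x, 0 ≤ φ x) : φ (lambdaMax A) ≤ reTr d (cfc φ A) := by
  obtain ⟨i, hi⟩ := exists_lambdaMax_eq hd hA
  rw [hi, reTr_cfc hA]
  exact Finset.single_le_sum (f := fun i => φ (hA.eigenvalues i)) (fun j _ => hφ _)
    (Finset.mem_univ i)

theorem lambdaMin_eq_neg_lambdaMax_neg (A : Matrix (Fin d) (Fin d) ℂ) :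
    lambdaMin A = -lambdaMax (-A) := by
  rw [lambdaMin, lambdaMax, ← spectrum.neg_eq, Real.sInf_def]

/-- The trace of the positive part is a continuous function of the Hermitian matrix, so sublevel
sets of the largest eigenvalue become measurable. -/
theorem lambdaMax_le_iff (hd : 0 < d) (hA : A.IsHermitian) (r : ℝ) :
    lambdaMax A ≤ r ↔ reTr d (cfc (fun x => max (x - r) 0) A) ≤ 0 := by
  refine ⟨fun h => ?_, fun h => ?_⟩
  · rw [reTr_cfc hA]
    refine Finset.sum_nonpos fun i _ => ?_
    rw [max_eq_right]
    linarith [eigenvalues_le_lambdaMax hA i]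
  · have := (apply_lambdaMax_le_reTr_cfc hd hA (φ := fun x => max (x - r) 0)
      fun x => le_max_right _ _).trans h
    linarith [le_max_left (lambdaMax A - r) 0]

/-- Symmetrizing gives a map continuous on the whole matrix space; it agrees with the functional
calculus on Hermitian matrices, so composing it with a measurable Hermitian field settles
measurability. -/
theorem continuous_cfc_symm_part {φ : ℝ → ℝ} (hφ : Continuous φ) :
    Continuous fun X : Matrix (Fin d) (Fin d) ℂ => cfc φ ((1 / 2 : ℝ) • (X + star X)) := by
  refine Continuous.cfc_of_mem_nhdsSet (𝕜 := ℝ) (p := IsSelfAdjoint) (s := Set.univ) φ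
    Filter.univ_mem ?_ (fun X => ?_) hφ.continuousOn
  · fun_prop
  · exact IsSelfAdjoint.smul (IsSelfAdjoint.all (1 / 2 : ℝ)) (IsSelfAdjoint.add_star_self X)

theorem stronglyMeasurable_cfc {Ω : Type*} [MeasurableSpace Ω]
    {F : Ω → Matrix (Fin d) (Fin d) ℂ} (hF : StronglyMeasurable F)
    (hH : ∀ z, (F z).IsHermitian) {φ : ℝ → ℝ} (hφ : Continuous φ) :
    StronglyMeasurable fun z => cfc φ (F z) := by
  convert (continuous_cfc_symm_part hφ).comp_stronglyMeasurable hF using 3 with z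
  have : star (F z) = F z := hH z
  rw [this, ← two_smul ℝ, smul_smul]
  norm_num

theorem measurable_lambdaMax {Ω : Type*} [MeasurableSpace Ω] (hd : 0 < d)
    {F : Ω → Matrix (Fin d) (Fin d) ℂ} (hF : StronglyMeasurable F)
    (hH : ∀ z, (F z).IsHermitian) : Measurable fun z => lambdaMax (F z) := by
  refine measurable_of_Iic fun r => ?_
  have : (fun z => lambdaMax (F z)) ⁻¹' Set.Iic r
      = {z | reTr d (cfc (fun x => max (x - r) 0) (F z)) ≤ 0} := by
    ext z
    exact lambdaMax_le_iff hd (hH z) r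
  rw [this]
  refine measurableSet_le ?_ measurable_const
  exact ((reTr d).continuous.comp_stronglyMeasurable
    (stronglyMeasurable_cfc hF hH (by fun_prop))).measurable

end Eigenvalues

/-! ### The stationary pair `(Z_0, Z_t)` and the symmetry of the semigroup. -/

section JointLaw

variable {Ω : Type*} [MeasurableSpace Ω] {μ : Measure Ω} [IsProbabilityMeasure μ]
  {P : MarkovSemigroup Ω}

instance (P : MarkovSemigroup Ω) (t : ℝ≥0) : IsMarkovKernel (P.kernel t) := P.isMarkovKernel t

/-- The law of `(Z_0, Z_t)` for the process started from `μ`. -/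
noncomputable def jointLaw (P : MarkovSemigroup Ω) (μ : Measure Ω) (t : ℝ≥0) :
    Measure (Ω × Ω) := μ ⊗ₘ P.kernel t

instance (t : ℝ≥0) : IsProbabilityMeasure (jointLaw P μ t) := by
  unfold jointLaw; infer_instance

theorem measurePreserving_fst_jointLaw (t : ℝ≥0) :
    MeasurePreserving Prod.fst (jointLaw P μ t) μ :=
  ⟨measurable_fst, Measure.fst_compProd μ (P.kernel t)⟩

theorem measurePreserving_snd_jointLaw (hstat : P.IsStationary μ) (t : ℝ≥0) :
    MeasurePreserving Prod.snd (jointLaw P μ t) μ :=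
  ⟨measurable_snd, (Measure.snd_compProd μ (P.kernel t)).trans (hstat t)⟩

theorem jointLaw_prod (t : ℝ≥0) {s u : Set Ω} (hs : MeasurableSet s) (hu : MeasurableSet u) :
    jointLaw P μ t (s ×ˢ u)
      = ENNReal.ofReal (∫ z, P.act t (u.indicator fun _ => (1 : ℝ)) z
          * s.indicator (fun _ => (1 : ℝ)) z ∂μ) := by
  have h1 : ∀ z, P.act t (u.indicator fun _ => (1 : ℝ)) z = (P.kernel t z).real u := by
    intro z
    rw [MarkovSemigroup.act, integral_indicator_const _ hu, smul_eq_mul, mul_one]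
  have hm : Measurable fun z => (P.kernel t z).real u :=
    ((P.kernel t).measurable_coe hu).ennreal_toReal
  simp_rw [h1]
  rw [jointLaw, Measure.compProd_apply_prod hs hu, ofReal_integral_eq_lintegral_ofReal]
  · rw [← lintegral_indicator hs]
    refine lintegral_congr fun z => ?_
    by_cases hz : z ∈ s
    · simp [hz, Measure.real]
    · simp [hz]
  · refine Integrable.of_bound (C := 1)
      (hm.mul (measurable_const.indicator hs)).aestronglyMeasurable (Eventually.of_forall fun z => ?_)
    rw [norm_mul, Real.norm_eq_abs, abs_of_nonneg measureReal_nonneg]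
    refine mul_le_one₀ measureReal_le_one (norm_nonneg _) ?_
    by_cases hz : z ∈ s <;> simp [hz]
  · exact Eventually.of_forall fun z => mul_nonneg measureReal_nonneg
      (Set.indicator_nonneg (fun _ _ => zero_le_one) _)

/-- Reversibility for indicators gives the symmetry on rectangles, and rectangles determine a finite
measure. Exchangeability is the form of reversibility that extends beyond real `L_2` functions, to
matrix functions that are merely integrable. -/
theorem measurePreserving_swap_jointLaw (hrev : P.IsReversible μ) (t : ℝ≥0) :
    MeasurePreserving Prod.swap (jointLaw P μ t) (jointLaw P μ t) := by
  refine ⟨measurable_swap, ?_⟩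
  have : IsFiniteMeasure ((jointLaw P μ t).map Prod.swap) :=
    Measure.isFiniteMeasure_map _ _
  refine Measure.ext_prod fun {s u} hs hu => ?_
  rw [Measure.map_apply measurable_swap (hs.prod hu), Set.preimage_swap_prod,
    jointLaw_prod t hu hs, jointLaw_prod t hs hu, hrev t]
  · simp_rw [mul_comm]
  · exact (memLp_const (1 : ℝ)).indicator hs
  · exact (memLp_const (1 : ℝ)).indicator hu

variable {d : ℕ}

/-- Bounded strongly measurable matrix functions. -/
structure IsBoundedMeas (K : Ω → Matrix (Fin d) (Fin d) ℂ) : Prop where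
  stronglyMeasurable : StronglyMeasurable K
  bounded : ∃ C, ∀ z, ‖K z‖ ≤ C

/-- The bilinear form `(X, Y) ↦ Re tr (X Y)`. -/
noncomputable def trForm (d : ℕ) : Matrix (Fin d) (Fin d) ℂ →L[ℝ]
    Matrix (Fin d) (Fin d) ℂ →L[ℝ] ℝ :=
  (ContinuousLinearMap.compL ℝ (Matrix (Fin d) (Fin d) ℂ) (Matrix (Fin d) (Fin d) ℂ) ℝ
    (reTr d)).comp (ContinuousLinearMap.mul ℝ (Matrix (Fin d) (Fin d) ℂ))

theorem trForm_apply (X Y : Matrix (Fin d) (Fin d) ℂ) : trForm d X Y = reTr d (X * Y) := rfl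

theorem IsBoundedMeas.integrable_reTr_mul {X : Type*} [MeasurableSpace X] {ν : Measure X}
    {K : X → Matrix (Fin d) (Fin d) ℂ} (hK : IsBoundedMeas K)
    {F : X → Matrix (Fin d) (Fin d) ℂ} (hF : Integrable F ν) :
    Integrable (fun z => reTr d (F z * K z)) ν := by
  obtain ⟨C, hC⟩ := hK.bounded
  exact (trForm d).integrable_of_bilin_of_bdd_right C hF
    hK.stronglyMeasurable.aestronglyMeasurable (Eventually.of_forall hC)

theorem IsBoundedMeas.comp {X : Type*} [MeasurableSpace X]
    {K : Ω → Matrix (Fin d) (Fin d) ℂ} (hK : IsBoundedMeas K) {g : X → Ω} (hg : Measurable g) :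
    IsBoundedMeas fun x => K (g x) :=
  ⟨hK.stronglyMeasurable.comp_measurable hg, hK.bounded.imp fun _ h _ => h _⟩

theorem IsBoundedMeas.integrable {ν : Measure Ω} [IsFiniteMeasure ν]
    {K : Ω → Matrix (Fin d) (Fin d) ℂ} (hK : IsBoundedMeas K) : Integrable K ν := by
  obtain ⟨C, hC⟩ := hK.bounded
  exact Integrable.of_bound hK.stronglyMeasurable.aestronglyMeasurable C (Eventually.of_forall hC)

theorem IsBoundedMeas.act {K : Ω → Matrix (Fin d) (Fin d) ℂ} (hK : IsBoundedMeas K)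
    (P : MarkovSemigroup Ω) (t : ℝ≥0) : IsBoundedMeas (P.act t K) := by
  obtain ⟨C, hC⟩ := hK.bounded
  refine ⟨?_, C, fun z => ?_⟩
  · exact hK.stronglyMeasurable.integral_kernel
  · refine (norm_integral_le_of_norm_le_const (Eventually.of_forall hC)).trans_eq ?_
    simp

theorem integral_jointLaw {E : Type*} [NormedAddCommGroup E] [NormedSpace ℝ E] (t : ℝ≥0)
    {Φ : Ω × Ω → E} (hΦ : Integrable Φ (jointLaw P μ t)) :
    ∫ p, Φ p ∂(jointLaw P μ t) = ∫ z, ∫ y, Φ (z, y) ∂(P.kernel t z) ∂μ :=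
  Measure.integral_compProd hΦ

theorem integral_jointLaw_swap {E : Type*} [NormedAddCommGroup E] [NormedSpace ℝ E]
    (hrev : P.IsReversible μ) (t : ℝ≥0) (Φ : Ω × Ω → E) :
    ∫ p, Φ p.swap ∂(jointLaw P μ t) = ∫ p, Φ p ∂(jointLaw P μ t) :=
  (measurePreserving_swap_jointLaw hrev t).integral_comp
    MeasurableEquiv.prodComm.measurableEmbedding Φ

theorem ae_integrable_kernel {E : Type*} [NormedAddCommGroup E] (hstat : P.IsStationary μ)
    (t : ℝ≥0) {F : Ω → E} (hF : Integrable F μ) : ∀ᵐ z ∂μ, Integrable F (P.kernel t z) := by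
  have h := (measurePreserving_snd_jointLaw hstat t).integrable_comp_of_integrable hF
  exact ((Measure.integrable_compProd_iff h.aestronglyMeasurable).1 h).1

theorem integral_reTr_act_mul (hstat : P.IsStationary μ) (t : ℝ≥0)
    {F K : Ω → Matrix (Fin d) (Fin d) ℂ} (hF : Integrable F μ) (hK : IsBoundedMeas K) :
    ∫ z, reTr d (P.act t F z * K z) ∂μ = ∫ p, reTr d (F p.2 * K p.1) ∂(jointLaw P μ t) := by
  have hF2 : Integrable (fun p : Ω × Ω => F p.2) (jointLaw P μ t) :=
    (measurePreserving_snd_jointLaw hstat t).integrable_comp_of_integrable hF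
  rw [integral_jointLaw t ((hK.comp measurable_fst).integrable_reTr_mul hF2)]
  refine integral_congr_ae ?_
  filter_upwards [ae_integrable_kernel hstat t hF] with z hz
  have := ((trForm d).flip (K z)).integral_comp_comm hz
  simp only [ContinuousLinearMap.flip_apply, trForm_apply] at this
  exact this.symm

theorem integral_reTr_mul_act (t : ℝ≥0)
    {F K : Ω → Matrix (Fin d) (Fin d) ℂ} (hF : Integrable F μ) (hK : IsBoundedMeas K) :
    ∫ z, reTr d (F z * P.act t K z) ∂μ = ∫ p, reTr d (F p.1 * K p.2) ∂(jointLaw P μ t) := by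
  have hF2 : Integrable (fun p : Ω × Ω => F p.1) (jointLaw P μ t) :=
    (measurePreserving_fst_jointLaw t).integrable_comp_of_integrable hF
  rw [integral_jointLaw t ((hK.comp measurable_snd).integrable_reTr_mul hF2)]
  refine integral_congr_ae (Eventually.of_forall fun z => ?_)
  have := ((trForm d) (F z)).integral_comp_comm (hK.integrable (ν := P.kernel t z))
  simp only [trForm_apply] at this
  exact this.symm

theorem integral_reTr_act_symm (hstat : P.IsStationary μ) (hrev : P.IsReversible μ) (t : ℝ≥0)
    {F K : Ω → Matrix (Fin d) (Fin d) ℂ} (hF : Integrable F μ) (hK : IsBoundedMeas K) :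
    ∫ z, reTr d (P.act t F z * K z) ∂μ = ∫ z, reTr d (F z * P.act t K z) ∂μ := by
  rw [integral_reTr_act_mul hstat t hF hK, integral_reTr_mul_act t hF hK,
    ← integral_jointLaw_swap hrev]
  rfl

/-- Jensen's inequality for each kernel, followed by stationarity. -/
theorem eLpNorm_act_le {E : Type*} [NormedRing E] [NormedAlgebra ℝ E] (hstat : P.IsStationary μ)
    (t : ℝ≥0) {F : Ω → E} (hF : MemLp F 2 μ) :
    eLpNorm (P.act t F) 2 μ ≤ eLpNorm F 2 μ := by
  have h1 : ∀ᵐ z ∂μ, ‖P.act t F z‖ₑ ^ (2 : ℝ) ≤ ∫⁻ y, ‖F y‖ₑ ^ (2 : ℝ) ∂(P.kernel t z) := by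
    filter_upwards [ae_integrable_kernel hstat t (hF.integrable one_le_two)] with z hz
    have h2 : ‖P.act t F z‖ₑ ≤ eLpNorm F 2 (P.kernel t z) := by
      refine (enorm_integral_le_lintegral_enorm _).trans ?_
      rw [← eLpNorm_one_eq_lintegral_enorm]
      exact eLpNorm_le_eLpNorm_of_exponent_le one_le_two hz.aestronglyMeasurable
    refine (ENNReal.rpow_le_rpow h2 zero_le_two).trans_eq ?_
    rw [eLpNorm_eq_lintegral_rpow_enorm_toReal two_ne_zero ENNReal.ofNat_ne_top,
      ← ENNReal.rpow_mul]
    simp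
  rw [eLpNorm_eq_lintegral_rpow_enorm_toReal two_ne_zero ENNReal.ofNat_ne_top,
    eLpNorm_eq_lintegral_rpow_enorm_toReal two_ne_zero ENNReal.ofNat_ne_top]
  refine ENNReal.rpow_le_rpow ?_ (by positivity)
  simp only [ENNReal.toReal_ofNat]
  refine (lintegral_mono_ae h1).trans_eq ?_
  have hb : μ.bind (P.kernel t) = μ := hstat t
  conv_rhs => rw [← hb]
  rw [Measure.lintegral_bind (P.kernel t).aemeasurable]
  rw [hb]
  exact (hF.aestronglyMeasurable.enorm.pow_const _)

end JointLaw

/-! ### Passage from real suitable functions to functions with values in a finite-dimensional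
algebra. -/

section VectorValued

variable {Ω : Type*} [MeasurableSpace Ω] {μ : Measure Ω} {P : MarkovSemigroup Ω}
  {A : Subalgebra ℝ (Ω → ℝ)}
  {E : Type*} [NormedRing E] [NormedAlgebra ℝ E] [FiniteDimensional ℝ E]

/-- A function with values in a finite-dimensional algebra all of whose coordinates belong to the
algebra `A` of suitable real functions. -/
def IsCoordwise (A : Subalgebra ℝ (Ω → ℝ)) (F : Ω → E) : Prop :=
  ∀ ℓ : E →L[ℝ] ℝ, (fun z => ℓ (F z)) ∈ A

/-- Continuous coordinates with respect to a fixed basis. -/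
noncomputable def coordL (E : Type*) [NormedRing E] [NormedAlgebra ℝ E] [FiniteDimensional ℝ E]
    (k : Fin (Module.finrank ℝ E)) : E →L[ℝ] ℝ :=
  LinearMap.toContinuousLinearMap ((Module.finBasis ℝ E).coord k)

theorem sum_coordL (X : E) : ∑ k, coordL E k X • Module.finBasis ℝ E k = X :=
  (Module.finBasis ℝ E).sum_repr X

namespace IsCoordwise

variable {F G : Ω → E}

theorem add (hF : IsCoordwise A F) (hG : IsCoordwise A G) : IsCoordwise A (F + G) := fun ℓ => by
  have := A.add_mem (hF ℓ) (hG ℓ)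
  convert this using 1
  ext z
  simp

theorem smul (c : ℝ) (hF : IsCoordwise A F) : IsCoordwise A (c • F) := fun ℓ => by
  have := A.smul_mem (hF ℓ) c
  convert this using 1
  ext z
  simp

theorem neg (hF : IsCoordwise A F) : IsCoordwise A (-F) := by
  have := hF.smul (-1)
  rwa [neg_one_smul] at this

theorem sub (hF : IsCoordwise A F) (hG : IsCoordwise A G) : IsCoordwise A (F - G) := by
  rw [sub_eq_add_neg]
  exact hF.add hG.neg

theorem const (A : Subalgebra ℝ (Ω → ℝ)) (X : E) : IsCoordwise A (fun _ : Ω => X) := fun ℓ =>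
  A.algebraMap_mem (ℓ X)

theorem mul (hF : IsCoordwise A F) (hG : IsCoordwise A G) : IsCoordwise A (F * G) := fun ℓ => by
  have : (fun z => ℓ ((F * G) z)) = ∑ k, ∑ l, ℓ (Module.finBasis ℝ E k * Module.finBasis ℝ E l) •
      ((fun z => coordL E k (F z)) * (fun z => coordL E l (G z))) := by
    ext z
    rw [Pi.mul_apply]
    conv_lhs => rw [← sum_coordL (F z), ← sum_coordL (G z)]
    rw [Finset.sum_mul_sum]
    simp only [map_sum, Finset.sum_apply, Pi.smul_apply, Pi.mul_apply, smul_mul_smul_comm,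
      map_smul, smul_eq_mul]
    refine Finset.sum_congr rfl fun k _ => Finset.sum_congr rfl fun l _ => ?_
    ring
  rw [this]
  exact A.sum_mem fun k _ => A.sum_mem fun l _ => A.smul_mem (A.mul_mem (hF _) (hG _)) _

theorem eq_sum (F : Ω → E) :
    F = ∑ k, fun z => coordL E k (F z) • Module.finBasis ℝ E k := by
  ext z
  rw [Finset.sum_apply, sum_coordL]

section

variable (hA : P.IsSuitableAlgebra μ A)
include hA

theorem stronglyMeasurable (hF : IsCoordwise A F) : StronglyMeasurable F := by
  rw [eq_sum F]
  exact Finset.stronglyMeasurable_sum _ fun k _ =>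
    (hA.measurable _ (hF (coordL E k))).stronglyMeasurable.smul_const _

theorem memLp_two (hF : IsCoordwise A F) : MemLp F 2 μ := by
  rw [eq_sum F]
  refine memLp_finsetSum' _ fun k _ => ?_
  have hm := hF (coordL E k)
  have h2 : MemLp (fun z => coordL E k (F z)) 2 μ := by
    rw [memLp_two_iff_integrable_sq (hA.measurable _ hm).aestronglyMeasurable]
    -- Square integrability is automatic: the square lies in the algebra, whose members are
    -- integrable.
    exact hA.integrable _ (A.pow_mem hm 2)
  exact (ContinuousLinearMap.toSpanSingleton ℝ (Module.finBasis ℝ E k)).comp_memLp' h2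

theorem integrable (hF : IsCoordwise A F) : Integrable F μ := by
  rw [eq_sum F]
  exact integrable_finsetSum' _ fun k _ => (hA.integrable _ (hF _)).smul_const _

theorem integrable_kernel (hF : IsCoordwise A F) (t : ℝ≥0) (z : Ω) :
    Integrable F (P.kernel t z) := by
  rw [eq_sum F]
  exact integrable_finsetSum' _ fun k _ => (hA.integrable_kernel _ (hF _) t z).smul_const _

variable [CompleteSpace E]

theorem map_act (hF : IsCoordwise A F) (ℓ : E →L[ℝ] ℝ) (t : ℝ≥0) (z : Ω) :
    ℓ (P.act t F z) = P.act t (fun z => ℓ (F z)) z :=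
  (ℓ.integral_comp_comm (hF.integrable_kernel hA t z)).symm

theorem map_diffQuot (hF : IsCoordwise A F) (ℓ : E →L[ℝ] ℝ) (t : ℝ≥0) (z : Ω) :
    ℓ (P.diffQuot F t z) = P.diffQuot (fun z => ℓ (F z)) t z := by
  simp only [MarkovSemigroup.diffQuot, map_smul, map_sub, hF.map_act hA]

theorem act (hF : IsCoordwise A F) (t : ℝ≥0) : IsCoordwise A (P.act t F) := fun ℓ => by
  simp only [hF.map_act hA]
  exact hA.act_mem _ (hF ℓ) t

theorem tendsto_generator (hF : IsCoordwise A F) (z : Ω) :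
    Tendsto (fun t : ℝ≥0 => P.diffQuot F t z) (𝓝[>] 0) (𝓝 (P.generator F z)) := by
  have h : Tendsto (fun t : ℝ≥0 => P.diffQuot F t z) (𝓝[>] 0)
      (𝓝 (∑ k, P.generator (fun z => coordL E k (F z)) z • Module.finBasis ℝ E k)) := by
    have e : ∀ t, P.diffQuot F t z
        = ∑ k, P.diffQuot (fun z => coordL E k (F z)) t z • Module.finBasis ℝ E k := fun t => by
      simp only [← hF.map_diffQuot hA, sum_coordL]
    simp only [e]
    exact tendsto_finsetSum _ fun k _ => (hA.tendsto_generator _ (hF _) z).smul_const _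
  rwa [← h.limUnder_eq] at h

theorem map_generator (hF : IsCoordwise A F) (ℓ : E →L[ℝ] ℝ) (z : Ω) :
    ℓ (P.generator F z) = P.generator (fun z => ℓ (F z)) z := by
  have h1 := (ℓ.continuous.tendsto _).comp (hF.tendsto_generator hA z)
  refine tendsto_nhds_unique h1 ?_
  have h2 := hA.tendsto_generator _ (hF ℓ) z
  refine h2.congr fun t => ?_
  rw [Function.comp_apply, hF.map_diffQuot hA]

theorem generator (hF : IsCoordwise A F) : IsCoordwise A (P.generator F) := fun ℓ => by
  simp only [hF.map_generator hA]
  exact hA.generator_mem _ (hF ℓ)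

theorem diffQuot (hF : IsCoordwise A F) (t : ℝ≥0) : IsCoordwise A (P.diffQuot F t) :=
  ((hF.act hA t).sub hF).smul _

theorem tendsto_generator_L2 (hF : IsCoordwise A F) :
    Tendsto (fun t : ℝ≥0 => eLpNorm (P.diffQuot F t - P.generator F) 2 μ) (𝓝[>] 0) (𝓝 0) := by
  have h0 : Tendsto (fun t : ℝ≥0 => ∑ k, eLpNorm (P.diffQuot (fun z => coordL E k (F z)) t
      - P.generator (fun z => coordL E k (F z))) 2 μ * ‖Module.finBasis ℝ E k‖ₑ) (𝓝[>] 0)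
      (𝓝 0) := by
    have : (0 : ℝ≥0∞) = ∑ k : Fin (Module.finrank ℝ E), 0 * ‖Module.finBasis ℝ E k‖ₑ := by simp
    rw [this]
    exact tendsto_finsetSum _ fun k _ => ENNReal.Tendsto.mul_const
      (hA.tendsto_generator_L2 _ (hF _)) (Or.inr enorm_ne_top)
  refine tendsto_of_tendsto_of_tendsto_of_le_of_le tendsto_const_nhds h0 (fun _ => zero_le) ?_
  intro t
  have e : P.diffQuot F t - P.generator F
      = ∑ k, fun z => coordL E k ((P.diffQuot F t - P.generator F) z) • Module.finBasis ℝ E k :=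
    eq_sum _
  simp only
  rw [e]
  have hD := (hF.diffQuot hA t).sub (hF.generator hA)
  refine (eLpNorm_sum_le (fun k _ => ?_) one_le_two).trans (Finset.sum_le_sum fun k _ => ?_)
  · exact ((hA.measurable _ (hD (coordL E k))).stronglyMeasurable.smul_const _).aestronglyMeasurable
  · have e2 : (fun z => coordL E k ((P.diffQuot F t - P.generator F) z))
        = P.diffQuot (fun z => coordL E k (F z)) t - P.generator (fun z => coordL E k (F z)) := by
      ext z
      simp [hF.map_diffQuot hA, hF.map_generator hA]
    rw [← e2]
    rw [mul_comm, ← enorm_norm, ← ofReal_norm, norm_norm]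
    refine eLpNorm_le_mul_eLpNorm_of_ae_le_mul (Eventually.of_forall fun z => ?_) 2
    rw [norm_smul, mul_comm]

theorem act_add (hF : IsCoordwise A F) (hG : IsCoordwise A G) (t : ℝ≥0) :
    P.act t (F + G) = P.act t F + P.act t G := by
  ext z
  exact integral_add (hF.integrable_kernel hA t z) (hG.integrable_kernel hA t z)

theorem act_sub (hF : IsCoordwise A F) (hG : IsCoordwise A G) (t : ℝ≥0) :
    P.act t (F - G) = P.act t F - P.act t G := by
  ext z
  exact integral_sub (hF.integrable_kernel hA t z) (hG.integrable_kernel hA t z)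

theorem act_smul (c : ℝ) (t : ℝ≥0) : P.act t (c • F) = c • P.act t F := by
  ext z
  exact integral_smul c F

theorem act_zero (hF : IsCoordwise A F) : P.act 0 F = F := by
  ext z
  rw [MarkovSemigroup.act, P.kernel_zero, Kernel.id_apply,
    integral_dirac' _ _ (hF.stronglyMeasurable hA)]

theorem act_add_time (hF : IsCoordwise A F) (s t : ℝ≥0) :
    P.act (s + t) F = P.act s (P.act t F) := by
  ext z
  have h := hF.integrable_kernel hA (s + t) z
  simp only [MarkovSemigroup.act]
  rw [P.kernel_add] at h ⊢
  exact Kernel.integral_comp h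

theorem act_diffQuot (hF : IsCoordwise A F) (s t : ℝ≥0) :
    P.act s (P.diffQuot F t) = (t : ℝ)⁻¹ • (P.act (s + t) F - P.act s F) := by
  have : P.diffQuot F t = (t : ℝ)⁻¹ • (P.act t F - F) := rfl
  rw [this, act_smul hA, (hF.act hA t).act_sub hA hF, hF.act_add_time hA]

theorem diffQuot_act (hF : IsCoordwise A F) (s t : ℝ≥0) :
    P.diffQuot (P.act s F) t = P.act s (P.diffQuot F t) := by
  rw [hF.act_diffQuot hA, add_comm, hF.act_add_time hA]
  rfl

theorem diffQuot_add (hF : IsCoordwise A F) (hG : IsCoordwise A G) (t : ℝ≥0) :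
    P.diffQuot (F + G) t = P.diffQuot F t + P.diffQuot G t := by
  ext z
  simp only [MarkovSemigroup.diffQuot, hF.act_add hA hG, Pi.add_apply]
  rw [← smul_add]
  abel_nf

theorem diffQuot_smul (c : ℝ) (t : ℝ≥0) : P.diffQuot (c • F) t = c • P.diffQuot F t := by
  ext z
  simp only [MarkovSemigroup.diffQuot, act_smul hA, Pi.smul_apply]
  rw [← smul_sub, smul_comm]

theorem generator_add (hF : IsCoordwise A F) (hG : IsCoordwise A G) :
    P.generator (F + G) = P.generator F + P.generator G := by
  ext z
  refine tendsto_nhds_unique ((hF.add hG).tendsto_generator hA z) ?_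
  simp only [hF.diffQuot_add hA hG]
  exact (hF.tendsto_generator hA z).add (hG.tendsto_generator hA z)

theorem generator_smul (c : ℝ) (hF : IsCoordwise A F) :
    P.generator (c • F) = c • P.generator F := by
  ext z
  refine tendsto_nhds_unique ((hF.smul c).tendsto_generator hA z) ?_
  simp only [diffQuot_smul hA c]
  exact (hF.tendsto_generator hA z).const_smul c

theorem generator_sub (hF : IsCoordwise A F) (hG : IsCoordwise A G) :
    P.generator (F - G) = P.generator F - P.generator G := by
  rw [sub_eq_add_neg, ← neg_one_smul ℝ G, hF.generator_add hA (hG.smul _),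
    hG.generator_smul hA, neg_one_smul, ← sub_eq_add_neg]

theorem gamma (hF : IsCoordwise A F) (hG : IsCoordwise A G) : IsCoordwise A (P.gamma F G) :=
  ((((hF.mul hG).generator hA).sub (hF.mul (hG.generator hA))).sub
    ((hF.generator hA).mul hG)).smul _

/-- The difference quotient that converges to twice the carré du champ. -/
theorem inv_smul_integral_sq_sub (hF : IsCoordwise A F) (t : ℝ≥0) (z : Ω) :
    (t : ℝ)⁻¹ • ∫ y, (F y - F z) * (F y - F z) ∂(P.kernel t z)
      = P.diffQuot (F * F) t z - F z * P.diffQuot F t z - P.diffQuot F t z * F z := by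
  have i1 := hF.integrable_kernel hA t z
  have i2 := (hF.mul hF).integrable_kernel hA t z
  have e : ∀ y, (F y - F z) * (F y - F z)
      = (F * F) y - F y * F z - (F z * F y - F z * F z) := fun y => by
    simp only [Pi.mul_apply]
    noncomm_ring
  have j1 : Integrable (fun y => (F * F) y - F y * F z) (P.kernel t z) :=
    i2.sub (i1.mul_const _)
  have j2 : Integrable (fun y => F z * F y - F z * F z) (P.kernel t z) :=
    (i1.const_mul _).sub (integrable_const _)
  simp only [e]
  rw [integral_sub j1 j2, integral_sub i2 (i1.mul_const _), integral_sub (i1.const_mul _) (integrable_const _),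
    integral_mul_const_of_integrable i1, integral_const_mul_of_integrable i1]
  simp only [MarkovSemigroup.diffQuot, MarkovSemigroup.act, integral_const, probReal_univ, one_smul,
    mul_smul_comm, smul_mul_assoc, ← smul_sub]
  congr 1
  simp only [Pi.mul_apply]
  noncomm_ring

/-- This exhibits the carré du champ as an infinitesimal conditional second moment of increments.
Its invariance under shifts and sign change, its Hermitian symmetry and the sign of its trace are
read off from this formula. -/
theorem tendsto_gamma (hF : IsCoordwise A F) (z : Ω) :
    Tendsto (fun t : ℝ≥0 => (1 / 2 : ℝ) •
        ((t : ℝ)⁻¹ • ∫ y, (F y - F z) * (F y - F z) ∂(P.kernel t z))) (𝓝[>] 0)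
      (𝓝 (P.gamma F F z)) := by
  simp only [hF.inv_smul_integral_sq_sub hA]
  have h1 := hF.tendsto_generator hA z
  exact ((((hF.mul hF).tendsto_generator hA z).sub (h1.const_mul (F z))).sub
    (h1.mul_const (F z))).const_smul _

theorem gamma_sub_const (hF : IsCoordwise A F) (X : E) :
    P.gamma (F - fun _ => X) (F - fun _ => X) = P.gamma F F := by
  ext z
  refine tendsto_nhds_unique ((hF.sub (const A X)).tendsto_gamma hA z) ?_
  refine (hF.tendsto_gamma hA z).congr fun t => ?_
  simp

theorem gamma_neg (hF : IsCoordwise A F) : P.gamma (-F) (-F) = P.gamma F F := by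
  ext z
  refine tendsto_nhds_unique (hF.neg.tendsto_gamma hA z) ?_
  refine (hF.tendsto_gamma hA z).congr fun t => ?_
  congr 2
  refine integral_congr_ae (Eventually.of_forall fun y => ?_)
  simp only [Pi.neg_apply]
  noncomm_ring

end

end IsCoordwise

end VectorValued

/-! ### The semigroup orbit as a differentiable curve in `L_2(μ)`. -/

section Flow

variable {Ω : Type*} [MeasurableSpace Ω] {μ : Measure Ω} [IsProbabilityMeasure μ]
  {P : MarkovSemigroup Ω} {A : Subalgebra ℝ (Ω → ℝ)}
  {E : Type*} [NormedRing E] [NormedAlgebra ℝ E] [FiniteDimensional ℝ E] [CompleteSpace E]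

namespace IsCoordwise

variable {F G : Ω → E}

/-- The class in `L_2(μ)` of a coordinatewise suitable function. -/
noncomputable def toL2 (hA : P.IsSuitableAlgebra μ A) (hF : IsCoordwise A F) : Lp E 2 μ :=
  (hF.memLp_two hA).toLp F

variable (hA : P.IsSuitableAlgebra μ A)
include hA

theorem toL2_congr (hF : IsCoordwise A F) (hG : IsCoordwise A G) (h : F =ᵐ[μ] G) :
    hF.toL2 hA = hG.toL2 hA :=
  (MemLp.toLp_eq_toLp_iff _ _).2 h

theorem ae_eq_of_toL2_eq (hF : IsCoordwise A F) (hG : IsCoordwise A G)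
    (h : hF.toL2 hA = hG.toL2 hA) : F =ᵐ[μ] G :=
  (MemLp.toLp_eq_toLp_iff _ _).1 h

theorem toL2_sub (hF : IsCoordwise A F) (hG : IsCoordwise A G) :
    (hF.sub hG).toL2 hA = hF.toL2 hA - hG.toL2 hA :=
  MemLp.toLp_sub _ _

theorem toL2_smul (c : ℝ) (hF : IsCoordwise A F) :
    (hF.smul c).toL2 hA = c • hF.toL2 hA :=
  MemLp.toLp_const_smul _ _

theorem norm_toL2_act_le (hstat : P.IsStationary μ) (hF : IsCoordwise A F) (t : ℝ≥0) :
    ‖(hF.act hA t).toL2 hA‖ ≤ ‖hF.toL2 hA‖ := by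
  rw [toL2, toL2, Lp.norm_toLp, Lp.norm_toLp]
  exact ENNReal.toReal_mono (hF.memLp_two hA).eLpNorm_ne_top
    (eLpNorm_act_le hstat t (hF.memLp_two hA))

theorem norm_toL2_act_sub_le (hstat : P.IsStationary μ) (hF : IsCoordwise A F)
    (hG : IsCoordwise A G) (t : ℝ≥0) :
    ‖(hF.act hA t).toL2 hA - (hG.act hA t).toL2 hA‖ ≤ ‖hF.toL2 hA - hG.toL2 hA‖ := by
  rw [← toL2_sub, ← toL2_sub]
  refine le_trans (le_of_eq ?_) ((hF.sub hG).norm_toL2_act_le hA hstat t)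
  congr 1
  exact toL2_congr hA _ _ (by rw [hF.act_sub hA hG])

theorem tendsto_toL2_diffQuot (hF : IsCoordwise A F) :
    Tendsto (fun t : ℝ≥0 => (hF.diffQuot hA t).toL2 hA) (𝓝[>] 0)
      (𝓝 ((hF.generator hA).toL2 hA)) :=
  (Lp.tendsto_Lp_iff_tendsto_eLpNorm'' (fun t => P.diffQuot F t)
    (fun t => (hF.diffQuot hA t).memLp_two hA) (P.generator F)
    ((hF.generator hA).memLp_two hA)).2 (hF.tendsto_generator_L2 hA)

/-- The generator is a pointwise limit, so a change on a null set could matter a priori. The `L_2`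
form of the limit, with contractivity of `P_t`, shows that its class depends only on the class of
the function. -/
theorem generator_congr_ae (hstat : P.IsStationary μ) (hF : IsCoordwise A F)
    (hG : IsCoordwise A G) (h : F =ᵐ[μ] G) : P.generator F =ᵐ[μ] P.generator G := by
  refine ae_eq_of_toL2_eq hA (hF.generator hA) (hG.generator hA) ?_
  refine tendsto_nhds_unique (hF.tendsto_toL2_diffQuot hA)
    ((hG.tendsto_toL2_diffQuot hA).congr fun t => toL2_congr hA _ _ ?_)
  have h1 : P.act t F =ᵐ[μ] P.act t G := by
    refine ae_eq_of_toL2_eq hA (hF.act hA t) (hG.act hA t) (sub_eq_zero.1 (norm_le_zero_iff.1 ?_))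
    refine (hF.norm_toL2_act_sub_le hA hstat hG t).trans_eq ?_
    rw [toL2_congr hA hF hG h, sub_self, norm_zero]
  filter_upwards [h, h1] with z hz hz1
  simp only [MarkovSemigroup.diffQuot, hz, hz1]

/-- `P_s` commutes with the difference quotients and is an `L_2` contraction, so it passes to their
`L_2` limit. Identifying `L_2` limits gives the equality only almost everywhere. -/
theorem generator_act (hstat : P.IsStationary μ) (hF : IsCoordwise A F) (s : ℝ≥0) :
    P.generator (P.act s F) =ᵐ[μ] P.act s (P.generator F) := by
  refine ae_eq_of_toL2_eq hA ((hF.act hA s).generator hA) ((hF.generator hA).act hA s) ?_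
  refine tendsto_nhds_unique ((hF.act hA s).tendsto_toL2_diffQuot hA) ?_
  rw [tendsto_iff_norm_sub_tendsto_zero]
  refine squeeze_zero (fun _ => norm_nonneg _) (fun t => ?_)
    (tendsto_iff_norm_sub_tendsto_zero.1 (hF.tendsto_toL2_diffQuot hA))
  refine le_trans (le_of_eq ?_) ((hF.diffQuot hA t).norm_toL2_act_sub_le hA hstat
    (hF.generator hA) s)
  congr 2
  exact toL2_congr hA _ _ (by rw [hF.diffQuot_act hA])

/-- The orbit `s ↦ P_s F` in `L_2(μ)`, extended by a constant to negative times. -/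
noncomputable def flow (hF : IsCoordwise A F) (s : ℝ) : Lp E 2 μ :=
  (hF.act hA s.toNNReal).toL2 hA

theorem flow_eq_toL2_act (hF : IsCoordwise A F) (t : ℝ≥0) :
    hF.flow hA t = (hF.act hA t).toL2 hA :=
  toL2_congr hA _ _ (by rw [Real.toNNReal_coe])

theorem flow_zero (hF : IsCoordwise A F) : hF.flow hA 0 = hF.toL2 hA :=
  toL2_congr hA _ _ (by rw [Real.toNNReal_zero, hF.act_zero hA])

theorem toL2_act_sub_toL2 (hF : IsCoordwise A F) {t : ℝ≥0} (ht : 0 < t) :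
    (hF.act hA t).toL2 hA - hF.toL2 hA = (t : ℝ) • (hF.diffQuot hA t).toL2 hA := by
  rw [← toL2_smul, ← toL2_sub]
  refine toL2_congr hA _ _ (Eventually.of_forall fun z => ?_)
  have : (t : ℝ) ≠ 0 := by exact_mod_cast ht.ne'
  simp [MarkovSemigroup.diffQuot, smul_smul, this]

theorem tendsto_toL2_act (hF : IsCoordwise A F) :
    Tendsto (fun t : ℝ≥0 => (hF.act hA t).toL2 hA - hF.toL2 hA) (𝓝 0) (𝓝 0) := by
  have h1 : Tendsto (fun t : ℝ≥0 => (hF.act hA t).toL2 hA - hF.toL2 hA) (𝓝[>] 0) (𝓝 0) := by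
    have h2 : Tendsto (fun t : ℝ≥0 => (t : ℝ) • (hF.diffQuot hA t).toL2 hA) (𝓝[>] 0)
        (𝓝 ((0 : ℝ) • (hF.generator hA).toL2 hA)) := by
      refine Tendsto.smul ?_ (hF.tendsto_toL2_diffQuot hA)
      exact (NNReal.continuous_coe.tendsto 0).mono_left nhdsWithin_le_nhds
    rw [zero_smul] at h2
    refine h2.congr' ?_
    filter_upwards [self_mem_nhdsWithin] with t ht
    rw [hF.toL2_act_sub_toL2 hA ht]
  -- Difference quotients control only positive times; in `ℝ≥0` the point `0` itself is all that
  -- remains.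
  have e : 𝓝 (0 : ℝ≥0) = 𝓝[>] 0 ⊔ pure 0 := by
    rw [sup_comm, ← nhdsWithin_insert, ← nhdsWithin_univ]
    congr 1
    ext t
    simp
  rw [e, tendsto_sup]
  refine ⟨h1, tendsto_pure_left.2 fun s hs => ?_⟩
  have : (hF.act hA 0).toL2 hA = hF.toL2 hA := toL2_congr hA _ _ (by rw [hF.act_zero hA])
  rw [this, sub_self]
  exact mem_of_mem_nhds hs

theorem norm_toL2_act_sub_toL2_act_le (hstat : P.IsStationary μ) (hF : IsCoordwise A F)
    {s t : ℝ≥0} (h : s ≤ t) :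
    ‖(hF.act hA t).toL2 hA - (hF.act hA s).toL2 hA‖
      ≤ ‖(hF.act hA (t - s)).toL2 hA - hF.toL2 hA‖ := by
  refine le_trans (le_of_eq ?_) ((hF.act hA (t - s)).norm_toL2_act_sub_le hA hstat hF s)
  congr 2
  refine toL2_congr hA _ _ ?_
  rw [← hF.act_add_time hA, add_tsub_cancel_of_le h]

theorem continuous_flow (hstat : P.IsStationary μ) (hF : IsCoordwise A F) :
    Continuous (hF.flow hA) := by
  have h0 : Continuous fun t : ℝ≥0 => (hF.act hA t).toL2 hA := by
    rw [continuous_iff_continuousAt]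
    intro t
    rw [ContinuousAt, tendsto_iff_norm_sub_tendsto_zero]
    have h1 : Tendsto (fun s : ℝ≥0 => ‖(hF.act hA (max s t - min s t)).toL2 hA - hF.toL2 hA‖)
        (𝓝 t) (𝓝 0) := by
      have h2 : Tendsto (fun s : ℝ≥0 => max s t - min s t) (𝓝 t) (𝓝 0) := by
        have : Continuous fun s : ℝ≥0 => max s t - min s t := by fun_prop
        have := this.tendsto t
        simpa using this
      have := ((hF.tendsto_toL2_act hA).comp h2).norm
      simpa using this
    refine squeeze_zero (fun _ => norm_nonneg _) (fun s => ?_) h1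
    rcases le_total s t with h | h
    · rw [norm_sub_rev, max_eq_right h, min_eq_left h]
      exact hF.norm_toL2_act_sub_toL2_act_le hA hstat h
    · rw [max_eq_left h, min_eq_right h]
      exact hF.norm_toL2_act_sub_toL2_act_le hA hstat h
  exact h0.comp continuous_real_toNNReal

theorem hasDerivWithinAt_flow (hstat : P.IsStationary μ) (hF : IsCoordwise A F) {s : ℝ}
    (hs : 0 ≤ s) : HasDerivWithinAt (hF.flow hA) ((hF.generator hA).flow hA s) (Set.Ioi s) s := by
  rw [hasDerivWithinAt_iff_tendsto_slope' (by simp)]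
  have h1 : Tendsto (fun r : ℝ => (r - s).toNNReal) (𝓝[>] s) (𝓝[>] 0) := by
    refine tendsto_nhdsWithin_iff.2 ⟨?_, ?_⟩
    · have : Continuous fun r : ℝ => (r - s).toNNReal := by fun_prop
      have := this.tendsto s
      rw [sub_self, Real.toNNReal_zero] at this
      exact this.mono_left nhdsWithin_le_nhds
    · filter_upwards [self_mem_nhdsWithin] with r hr
      simpa using hr
  have h2 := (tendsto_iff_norm_sub_tendsto_zero.1 (hF.tendsto_toL2_diffQuot hA)).comp h1
  rw [tendsto_iff_norm_sub_tendsto_zero]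
  refine squeeze_zero' (Eventually.of_forall fun _ => norm_nonneg _) ?_ h2
  filter_upwards [self_mem_nhdsWithin] with r hr
  have hr : s < r := hr
  refine le_trans (le_of_eq ?_) ((hF.diffQuot hA (r - s).toNNReal).norm_toL2_act_sub_le hA hstat
    (hF.generator hA) s.toNNReal)
  congr 1
  rw [flow]
  congr 1
  rw [slope, vsub_eq_sub, flow, flow, ← toL2_sub, ← toL2_smul]
  refine toL2_congr hA _ _ ?_
  rw [hF.act_diffQuot hA, Real.coe_toNNReal _ (sub_nonneg.2 hr.le), ← Real.toNNReal_add hs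
    (sub_nonneg.2 hr.le), add_sub_cancel]

/-- The semigroup property only yields a right derivative. Since that derivative is continuous, the
orbit equals its integral, which is differentiable from both sides. -/
theorem hasDerivAt_flow (hstat : P.IsStationary μ) (hF : IsCoordwise A F) {s : ℝ}
    (hs : 0 < s) : HasDerivAt (hF.flow hA) ((hF.generator hA).flow hA s) s := by
  have hc := (hF.generator hA).continuous_flow hA hstat
  have h1 : HasDerivAt (fun r => hF.flow hA 0 + ∫ u in (0 : ℝ)..r, (hF.generator hA).flow hA u)
      ((hF.generator hA).flow hA s) s :=
    (intervalIntegral.integral_hasDerivAt_right (hc.intervalIntegrable _ _)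
      (hc.stronglyMeasurableAtFilter _ _) hc.continuousAt).const_add _
  refine h1.congr_of_eventuallyEq ?_
  filter_upwards [lt_mem_nhds hs] with r hr
  rw [intervalIntegral.integral_eq_sub_of_hasDeriv_right (f := hF.flow hA)
    (hF.continuous_flow hA hstat).continuousOn _ (hc.intervalIntegrable _ _)]
  · abel
  · intro x hx
    rw [min_eq_left hr.le] at hx
    exact hF.hasDerivWithinAt_flow hA hstat hx.1.le

end IsCoordwise

end Flow

/-! ### Calculus for functionals and vectors that vary together. -/

section MovingFunctionals

variable {D E : Type*} [AddCommGroup D] [Module ℝ D] [NormedAddCommGroup E] [NormedSpace ℝ E]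

/-- Product rule for a moving linear functional evaluated along a moving vector. -/
theorem hasDerivAt_movingFunctional {ι : D →ₗ[ℝ] E} {Λ : ℝ → D →ₗ[ℝ] ℝ} {C : ℝ}
    (hΛ : ∀ r y, |Λ r y| ≤ C * ‖ι y‖) {x : ℝ → D} {x' : D} {s ℓ : ℝ}
    (hx : HasDerivAt (fun r => ι (x r)) (ι x') s)
    (hc : Tendsto (fun r => Λ r x') (𝓝 s) (𝓝 (Λ s x')))
    (hd : HasDerivAt (fun r => Λ r (x s)) ℓ s) :
    HasDerivAt (fun r => Λ r (x r)) (Λ s x' + ℓ) s := by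
  rw [hasDerivAt_iff_isLittleO] at hx hd ⊢
  -- The bound on `Λ r` is uniform in `r`, so it absorbs the Taylor remainder of `x`.
  -- Differentiability of `Λ` is then needed only at the fixed vector `x s`, and continuity only at
  -- `x'`.
  have h1 : (fun r => Λ r (x r - x s - (r - s) • x')) =o[𝓝 s] fun r => r - s := by
    refine Asymptotics.IsBigO.trans_isLittleO (g := fun r => ι (x r) - ι (x s) - (r - s) • ι x')
      (Asymptotics.IsBigO.of_bound C (Eventually.of_forall fun r => ?_)) hx
    refine (hΛ r _).trans_eq ?_
    simp only [map_sub, map_smul]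
  have h2 : (fun r => (r - s) * (Λ r x' - Λ s x')) =o[𝓝 s] fun r => r - s := by
    have h3 : (fun r => Λ r x' - Λ s x') =o[𝓝 s] fun _ => (1 : ℝ) := by
      rw [Asymptotics.isLittleO_one_iff]
      simpa using hc.sub_const (Λ s x')
    simpa using (Asymptotics.isBigO_refl (fun r => r - s) (𝓝 s)).mul_isLittleO h3
  refine ((h1.add h2).add hd).congr_left fun r => ?_
  simp only [map_sub, map_smul, smul_eq_mul]
  ring

theorem continuous_movingFunctional {ι : D →ₗ[ℝ] E} {Λ : ℝ → D →ₗ[ℝ] ℝ} {C : ℝ}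
    (hΛ : ∀ r y, |Λ r y| ≤ C * ‖ι y‖) {x : ℝ → D} (hx : Continuous fun r => ι (x r))
    (hc : ∀ y, Continuous fun r => Λ r y) : Continuous fun r => Λ r (x r) := by
  rw [continuous_iff_continuousAt]
  intro s
  have h1 : Tendsto (fun r => Λ r (x r - x s)) (𝓝 s) (𝓝 0) := by
    refine squeeze_zero_norm (a := fun r => C * ‖ι (x r) - ι (x s)‖) (fun r => ?_) ?_
    · rw [← map_sub]
      exact hΛ r _
    · have := ((hx.tendsto s).sub_const (ι (x s))).norm.const_mul C
      simpa using this
  have h2 := h1.add ((hc (x s)).tendsto s)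
  rw [zero_add] at h2
  refine h2.congr fun r => ?_
  rw [map_sub, sub_add_cancel]

/-- Divide by `ε` and let `ε ↓ 0`. This removes the time average used in the gradient bound. -/
theorem le_of_forall_integral_le {g h : ℝ → ℝ} (hg : Continuous g) (hh : Continuous h)
    (H : ∀ ε > 0, ∫ u in (0 : ℝ)..ε, g u ≤ ∫ u in (0 : ℝ)..ε, h u) : g 0 ≤ h 0 := by
  have key : ∀ k : ℝ → ℝ, Continuous k →
      Tendsto (fun ε : ℝ => ε⁻¹ * ∫ u in (0 : ℝ)..ε, k u) (𝓝[>] 0) (𝓝 (k 0)) := fun k hk => by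
    have h1 : HasDerivAt (fun r => ∫ u in (0 : ℝ)..r, k u) (k 0) 0 :=
      intervalIntegral.integral_hasDerivAt_right (hk.intervalIntegrable _ _)
        (hk.stronglyMeasurableAtFilter _ _) hk.continuousAt
    have h2 := (hasDerivAt_iff_tendsto_slope.1 h1).mono_left
      (nhdsWithin_mono 0 fun x (hx : 0 < x) => hx.ne')
    refine h2.congr fun r => ?_
    simp [slope]
  refine le_of_tendsto_of_tendsto (key g hg) (key h hh) ?_
  filter_upwards [self_mem_nhdsWithin] with ε hε
  have hε : 0 < ε := hε
  exact mul_le_mul_of_nonneg_left (H ε hε) (by positivity)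

end MovingFunctionals

/-! ### Pairings with `P_s K` for a merely bounded test function `K`, and their time averages. -/

section Pairing

variable {Ω : Type*} [MeasurableSpace Ω] {μ : Measure Ω} [IsProbabilityMeasure μ]
  {P : MarkovSemigroup Ω} {A : Subalgebra ℝ (Ω → ℝ)} {d : ℕ}

/-- The space of matrix functions with coordinates in `A`. -/
def coordSub (A : Subalgebra ℝ (Ω → ℝ)) (d : ℕ) :
    Submodule ℝ (Ω → Matrix (Fin d) (Fin d) ℂ) where
  carrier := {F | IsCoordwise A F}
  add_mem' h1 h2 := h1.add h2
  zero_mem' := IsCoordwise.const A 0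
  smul_mem' c _ h := h.smul c

variable (hA : P.IsSuitableAlgebra μ A)

include hA in
theorem memLp_one_coordSub (F : coordSub A d) : MemLp F.1 1 μ :=
  memLp_one_iff_integrable.2 (IsCoordwise.integrable hA F.2)

/-- The inclusion of `coordSub A d` into `L_1(μ)`. -/
noncomputable def inclL1 : coordSub A d →ₗ[ℝ] Lp (Matrix (Fin d) (Fin d) ℂ) 1 μ where
  toFun F := (memLp_one_coordSub hA F).toLp F.1
  map_add' _ _ := MemLp.toLp_add _ _
  map_smul' _ _ := MemLp.toLp_const_smul _ _

theorem norm_inclL1 (F : coordSub A d) : ‖inclL1 hA F‖ = ∫ z, ‖F.1 z‖ ∂μ := by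
  change ‖(memLp_one_coordSub hA F).toLp F.1‖ = _
  rw [Lp.norm_toLp, toReal_eLpNorm (IsCoordwise.stronglyMeasurable hA F.2).aestronglyMeasurable]
  simp [lpNorm_one_eq_integral_norm (IsCoordwise.stronglyMeasurable hA F.2).aestronglyMeasurable]

/-- Multiplication `L_2 × L_2 → L_1`. -/
noncomputable def mulL1 (μ : Measure Ω) (d : ℕ) : Lp (Matrix (Fin d) (Fin d) ℂ) 2 μ →L[ℝ]
    Lp (Matrix (Fin d) (Fin d) ℂ) 2 μ →L[ℝ] Lp (Matrix (Fin d) (Fin d) ℂ) 1 μ :=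
  (ContinuousLinearMap.mul ℝ (Matrix (Fin d) (Fin d) ℂ)).holderL μ 2 2 1

theorem mulL1_toL2 {F G : Ω → Matrix (Fin d) (Fin d) ℂ} (hF : IsCoordwise A F)
    (hG : IsCoordwise A G) :
    mulL1 μ d (hF.toL2 hA) (hG.toL2 hA) = inclL1 hA ⟨F * G, hF.mul hG⟩ := by
  refine (MemLp.toLp_eq_toLp_iff
    ((ContinuousLinearMap.mul ℝ (Matrix (Fin d) (Fin d) ℂ)).memLp_of_bilin 1 (Lp.memLp _)
      (Lp.memLp _)) (memLp_one_coordSub hA ⟨F * G, hF.mul hG⟩)).2 ?_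
  filter_upwards [(hF.memLp_two hA).coeFn_toLp, (hG.memLp_two hA).coeFn_toLp] with z h1 h2
  simp only [IsCoordwise.toL2, h1, h2]
  rfl

variable {K : Ω → Matrix (Fin d) (Fin d) ℂ}

/-- The functional `F ↦ ∫ Re tr (F · P_s K) dμ`. -/
noncomputable def pairFun (hK : IsBoundedMeas K) (s : ℝ) : coordSub A d →ₗ[ℝ] ℝ where
  toFun F := ∫ z, reTr d (F.1 z * P.act s.toNNReal K z) ∂μ
  map_add' F G := by
    have hK' := hK.act P s.toNNReal
    rw [← integral_add (hK'.integrable_reTr_mul (IsCoordwise.integrable hA F.2))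
      (hK'.integrable_reTr_mul (IsCoordwise.integrable hA G.2))]
    refine integral_congr_ae (Eventually.of_forall fun z => ?_)
    simp [add_mul]
  map_smul' c F := by
    simp only [RingHom.id_apply, smul_eq_mul]
    rw [← integral_const_mul]
    refine integral_congr_ae (Eventually.of_forall fun z => ?_)
    simp

theorem pairFun_apply (hK : IsBoundedMeas K) (s : ℝ) (F : coordSub A d) :
    pairFun hA hK s F = ∫ z, reTr d (F.1 z * P.act s.toNNReal K z) ∂μ := rfl

/-- Uniformity in `s` holds because `P_s` preserves sup-norm bounds. The norm on the right is that
of `L_1`, where products of two `L_2` orbits live. -/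
theorem exists_abs_pairFun_le (hK : IsBoundedMeas K) :
    ∃ C, ∀ s F, |pairFun hA hK s F| ≤ C * ‖inclL1 hA F‖ := by
  obtain ⟨C, hC⟩ := hK.bounded
  refine ⟨‖trForm d‖ * C, fun s F => ?_⟩
  rw [norm_inclL1, ← integral_const_mul, pairFun_apply, ← Real.norm_eq_abs]
  refine norm_integral_le_of_norm_le ((IsCoordwise.integrable hA F.2).norm.const_mul _)
    (Eventually.of_forall fun z => ?_)
  have h1 : ‖P.act s.toNNReal K z‖ ≤ C := by
    refine (norm_integral_le_of_norm_le_const (Eventually.of_forall hC)).trans_eq ?_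
    simp
  rw [← trForm_apply]
  refine ((trForm d).le_opNorm₂ _ _).trans ?_
  rw [mul_assoc, mul_assoc, mul_comm C]
  gcongr

theorem pairFun_congr_ae (hK : IsBoundedMeas K) (s : ℝ) {F G : coordSub A d}
    (h : F.1 =ᵐ[μ] G.1) : pairFun hA hK s F = pairFun hA hK s G := by
  rw [pairFun_apply, pairFun_apply]
  refine integral_congr_ae ?_
  filter_upwards [h] with z hz
  rw [hz]

/-- The functional `X ↦ ∫ Re tr (X K) dμ` on `L_2(μ)`. -/
noncomputable def pairL2 (μ : Measure Ω) [IsProbabilityMeasure μ] (hK : IsBoundedMeas K) :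
    Lp (Matrix (Fin d) (Fin d) ℂ) 2 μ →L[ℝ] ℝ :=
  ((trForm d).lpPairing μ 2 2).flip ((MemLp.of_bound
    hK.stronglyMeasurable.aestronglyMeasurable hK.bounded.choose
      (Eventually.of_forall hK.bounded.choose_spec)).toLp K)

theorem pairL2_toL2 (hK : IsBoundedMeas K) {F : Ω → Matrix (Fin d) (Fin d) ℂ}
    (hF : IsCoordwise A F) : pairL2 μ hK (hF.toL2 hA) = ∫ z, reTr d (F z * K z) ∂μ := by
  rw [pairL2, ContinuousLinearMap.flip_apply, ContinuousLinearMap.lpPairing_eq_integral]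
  have h : MemLp K 2 μ := MemLp.of_bound
    hK.stronglyMeasurable.aestronglyMeasurable hK.bounded.choose
      (Eventually.of_forall hK.bounded.choose_spec)
  refine integral_congr_ae ?_
  filter_upwards [(hF.memLp_two hA).coeFn_toLp, h.coeFn_toLp] with z h1 h2
  rw [IsCoordwise.toL2, h1, h2, trForm_apply]

variable (hstat : P.IsStationary μ) (hrev : P.IsReversible μ)

include hstat hrev in
-- `K` has no regularity along the semigroup. Reversibility moves `P_s` onto `F`, whose orbit is
-- continuous and differentiable.
theorem pairFun_eq_pairL2_flow (hK : IsBoundedMeas K) (s : ℝ) (F : coordSub A d) :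
    pairFun hA hK s F = pairL2 μ hK (IsCoordwise.flow hA F.2 s) := by
  change _ = pairL2 μ hK (IsCoordwise.toL2 hA (IsCoordwise.act hA F.2 s.toNNReal))
  rw [pairL2_toL2, pairFun_apply,
    integral_reTr_act_symm hstat hrev _ (IsCoordwise.integrable hA F.2) hK]

include hstat hrev in
theorem continuous_pairFun (hK : IsBoundedMeas K) (F : coordSub A d) :
    Continuous fun s => pairFun hA hK s F := by
  simp only [pairFun_eq_pairL2_flow hA hstat hrev]
  exact (pairL2 μ hK).continuous.comp (IsCoordwise.continuous_flow hA hstat F.2)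

/-- The generator on `coordSub A d`. -/
noncomputable def gen (F : coordSub A d) : coordSub A d :=
  ⟨P.generator F.1, IsCoordwise.generator hA F.2⟩

include hstat hrev in
theorem hasDerivAt_pairFun (hK : IsBoundedMeas K) (F : coordSub A d) {s : ℝ} (hs : 0 < s) :
    HasDerivAt (fun r => pairFun hA hK r F) (pairFun hA hK s (gen hA F)) s := by
  simp only [pairFun_eq_pairL2_flow hA hstat hrev]
  exact (pairL2 μ hK).hasFDerivAt.comp_hasDerivAt s (IsCoordwise.hasDerivAt_flow hA hstat F.2 hs)

/-- The time average `F ↦ ∫_s^{s + ε} ∫ Re tr (F · P_ρ K) dμ dρ`. -/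
noncomputable def avgFun (hK : IsBoundedMeas K) (ε s : ℝ) : coordSub A d →ₗ[ℝ] ℝ where
  toFun F := ∫ ρ in s..(s + ε), pairFun hA hK ρ F
  map_add' F G := by
    simp only [map_add]
    exact intervalIntegral.integral_add
      ((continuous_pairFun hA hstat hrev hK F).intervalIntegrable _ _)
      ((continuous_pairFun hA hstat hrev hK G).intervalIntegrable _ _)
  map_smul' c F := by
    simp only [map_smul, smul_eq_mul, RingHom.id_apply]
    exact intervalIntegral.integral_const_mul _ _

theorem avgFun_apply (hK : IsBoundedMeas K) (ε s : ℝ) (F : coordSub A d) :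
    avgFun hA hstat hrev hK ε s F = ∫ ρ in s..(s + ε), pairFun hA hK ρ F := rfl

theorem avgFun_congr_ae (hK : IsBoundedMeas K) (ε s : ℝ) {F G : coordSub A d}
    (h : F.1 =ᵐ[μ] G.1) : avgFun hA hstat hrev hK ε s F = avgFun hA hstat hrev hK ε s G := by
  simp only [avgFun_apply, pairFun_congr_ae hA hK _ h]

theorem exists_abs_avgFun_le (hK : IsBoundedMeas K) (ε : ℝ) :
    ∃ C, ∀ s (F : coordSub A d), |avgFun hA hstat hrev hK ε s F| ≤ C * ‖inclL1 hA F‖ := by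
  obtain ⟨C, hC⟩ := exists_abs_pairFun_le hA hK
  refine ⟨C * |ε|, fun s F => ?_⟩
  rw [avgFun_apply, ← Real.norm_eq_abs]
  refine (intervalIntegral.norm_integral_le_of_norm_le_const fun r _ => hC r F).trans_eq ?_
  rw [add_sub_cancel_left]
  ring

theorem hasDerivAt_avgFun (hK : IsBoundedMeas K) (ε s : ℝ) (F : coordSub A d) :
    HasDerivAt (fun r => avgFun hA hstat hrev hK ε r F)
      (pairFun hA hK (s + ε) F - pairFun hA hK s F) s := by
  have hc := continuous_pairFun hA hstat hrev hK F
  have h0 : ∀ u, HasDerivAt (fun r => ∫ ρ in (0 : ℝ)..r, pairFun hA hK ρ F)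
      (pairFun hA hK u F) u := fun u =>
    intervalIntegral.integral_hasDerivAt_right (hc.intervalIntegrable _ _)
      (hc.stronglyMeasurableAtFilter _ _) hc.continuousAt
  have h1 := (HasDerivAt.comp_add_const s ε (h0 (s + ε))).sub (h0 s)
  refine h1.congr_of_eventuallyEq (Eventually.of_forall fun r => ?_)
  exact (intervalIntegral.integral_interval_sub_left (hc.intervalIntegrable _ _)
    (hc.intervalIntegrable _ _)).symm

theorem continuous_avgFun (hK : IsBoundedMeas K) (ε : ℝ) (F : coordSub A d) :
    Continuous fun s => avgFun hA hstat hrev hK ε s F :=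
  continuous_iff_continuousAt.2 fun s => (hasDerivAt_avgFun hA hstat hrev hK ε s F).continuousAt

/-- Under the time average a generator becomes a difference of two pairings. Expressions containing
`𝓛` of a moving product are thereby rewritten as functionals continuous for the `L_1` norm. -/
theorem pairFun_sub_pairFun (hK : IsBoundedMeas K) {ε s : ℝ} (hε : 0 ≤ ε) (hs : 0 ≤ s)
    (F : coordSub A d) :
    pairFun hA hK (s + ε) F - pairFun hA hK s F = avgFun hA hstat hrev hK ε s (gen hA F) := by
  rw [avgFun_apply, intervalIntegral.integral_eq_sub_of_hasDerivAt_of_le (by linarith)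
    (continuous_pairFun hA hstat hrev hK F).continuousOn
    (fun x hx => hasDerivAt_pairFun hA hstat hrev hK F (hs.trans_lt hx.1))
    ((continuous_pairFun hA hstat hrev hK _).intervalIntegrable _ _)]

/-- A bounded measurable test function that pairs nonnegatively with positive semidefinite
matrices. -/
structure IsPosTest (K : Ω → Matrix (Fin d) (Fin d) ℂ) : Prop extends IsBoundedMeas K where
  nonneg : ∀ z X, X.PosSemidef → 0 ≤ reTr d (X * K z)

theorem pairFun_nonneg (hK : IsPosTest K) (s : ℝ) (F : coordSub A d)
    (hF : ∀ᵐ z ∂μ, (F.1 z).PosSemidef) : 0 ≤ pairFun hA hK.toIsBoundedMeas s F := by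
  rw [pairFun_apply]
  refine integral_nonneg_of_ae ?_
  filter_upwards [hF] with z hz
  have := ((trForm d) (F.1 z)).integral_comp_comm
    (hK.toIsBoundedMeas.integrable (ν := P.kernel s.toNNReal z))
  simp only [trForm_apply] at this
  change 0 ≤ reTr d (F.1 z * ∫ y, K y ∂(P.kernel s.toNNReal z))
  rw [← this]
  exact integral_nonneg fun y => hK.nonneg y _ hz

theorem avgFun_nonneg (hK : IsPosTest K) {ε : ℝ} (hε : 0 ≤ ε) (s : ℝ) (F : coordSub A d)
    (hF : ∀ᵐ z ∂μ, (F.1 z).PosSemidef) :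
    0 ≤ avgFun hA hstat hrev hK.toIsBoundedMeas ε s F := by
  rw [avgFun_apply]
  exact intervalIntegral.integral_nonneg (by linarith) fun r _ => pairFun_nonneg hA hK r F hF

end Pairing

/-! ### From the Bakry–Émery criterion to exponential decay of `Γ(P_t f)`. -/

section GradientBound

variable {Ω : Type*} [MeasurableSpace Ω] {μ : Measure Ω} [IsProbabilityMeasure μ]
  {P : MarkovSemigroup Ω} {A : Subalgebra ℝ (Ω → ℝ)} {d : ℕ}

/-- The real and imaginary parts of a matrix entry as continuous linear functionals. -/
noncomputable def entryRe (i j : Fin d) : Matrix (Fin d) (Fin d) ℂ →L[ℝ] ℝ :=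
  LinearMap.toContinuousLinearMap (Complex.reLm.comp (Matrix.entryLinearMap ℝ ℂ i j))

/-- The imaginary part of a matrix entry as a continuous linear functional. -/
noncomputable def entryIm (i j : Fin d) : Matrix (Fin d) (Fin d) ℂ →L[ℝ] ℝ :=
  LinearMap.toContinuousLinearMap (Complex.imLm.comp (Matrix.entryLinearMap ℝ ℂ i j))

theorem eq_sum_single_re_im (X : Matrix (Fin d) (Fin d) ℂ) :
    X = ∑ i, ∑ j, ((X i j).re • Matrix.single i j (1 : ℂ)
      + (X i j).im • Matrix.single i j Complex.I) := by
  conv_lhs => rw [Matrix.matrix_eq_sum_single X]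
  refine Finset.sum_congr rfl fun i _ => Finset.sum_congr rfl fun j _ => ?_
  rw [Matrix.smul_single, Matrix.smul_single, ← Matrix.single_add]
  congr 1
  rw [Complex.real_smul, Complex.real_smul, mul_one, Complex.re_add_im]

theorem isSuitable_iff {f : Ω → Matrix (Fin d) (Fin d) ℂ} :
    IsSuitable A f ↔ (∀ z, (f z).IsHermitian) ∧ IsCoordwise A f := by
  refine ⟨fun h => ⟨h.isHermitian, fun ℓ => ?_⟩, fun h => ⟨h.1, fun i j => h.2 (entryRe i j),
    fun i j => h.2 (entryIm i j)⟩⟩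
  have : (fun z => ℓ (f z)) = ∑ i, ∑ j, (ℓ (Matrix.single i j (1 : ℂ)) • (fun z => (f z i j).re)
      + ℓ (Matrix.single i j Complex.I) • (fun z => (f z i j).im)) := by
    ext z
    conv_lhs => rw [eq_sum_single_re_im (f z)]
    simp only [map_sum, map_add, map_smul, Finset.sum_apply, Pi.add_apply, Pi.smul_apply,
      smul_eq_mul, mul_comm]
  rw [this]
  exact A.sum_mem fun i _ => A.sum_mem fun j _ =>
    A.add_mem (A.smul_mem (h.re_mem i j) _) (A.smul_mem (h.im_mem i j) _)

variable (hA : P.IsSuitableAlgebra μ A)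

include hA in
theorem IsSuitable.act {f : Ω → Matrix (Fin d) (Fin d) ℂ} (hf : IsSuitable A f) (t : ℝ≥0) :
    IsSuitable A (P.act t f) := by
  have h := isSuitable_iff.1 hf
  refine isSuitable_iff.2 ⟨fun z => ?_, h.2.act hA t⟩
  have h1 := (starL' ℝ : Matrix (Fin d) (Fin d) ℂ ≃L[ℝ] _).integral_comp_comm (μ := P.kernel t z) f
  refine Eq.trans h1.symm (integral_congr_ae (Eventually.of_forall fun y => h.1 y))

/-- Multiplication on `coordSub A d`. -/
def mulD (F G : coordSub A d) : coordSub A d := ⟨F.1 * G.1, IsCoordwise.mul F.2 G.2⟩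

/-- The semigroup on `coordSub A d`, extended by a constant to negative times. -/
noncomputable def flowD (F : coordSub A d) (s : ℝ) : coordSub A d :=
  ⟨P.act s.toNNReal F.1, IsCoordwise.act hA F.2 s.toNNReal⟩

theorem inclL1_mulD_flowD (F G : coordSub A d) (s : ℝ) :
    inclL1 hA (mulD (flowD hA F s) (flowD hA G s))
      = mulL1 μ d (IsCoordwise.flow hA F.2 s) (IsCoordwise.flow hA G.2 s) :=
  (mulL1_toL2 hA (flowD hA F s).2 (flowD hA G s).2).symm

theorem gen_add (F G : coordSub A d) : gen hA (F + G) = gen hA F + gen hA G :=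
  Subtype.ext (IsCoordwise.generator_add hA F.2 G.2)

theorem gen_sub (F G : coordSub A d) : gen hA (F - G) = gen hA F - gen hA G :=
  Subtype.ext (IsCoordwise.generator_sub hA F.2 G.2)

theorem gen_smul (c : ℝ) (F : coordSub A d) : gen hA (c • F) = c • gen hA F :=
  Subtype.ext (IsCoordwise.generator_smul hA c F.2)

variable (hstat : P.IsStationary μ) (hrev : P.IsReversible μ)

include hstat in
theorem continuous_inclL1_mulD_flowD (F G : coordSub A d) (t : ℝ) :
    Continuous fun r => inclL1 hA (mulD (flowD hA F (t - r)) (flowD hA G (t - r))) := by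
  simp only [inclL1_mulD_flowD]
  have h1 := (IsCoordwise.continuous_flow hA hstat F.2).comp (continuous_sub_left t)
  have h2 := (IsCoordwise.continuous_flow hA hstat G.2).comp (continuous_sub_left t)
  exact ((mulL1 μ d).continuous.comp h1).clm_apply h2

include hstat in
-- The product rule for the bilinear map `L_2 × L_2 → L_1`; the sign comes from running the orbits
-- backwards in time.
theorem hasDerivAt_inclL1_mulD_flowD (F G : coordSub A d) {t s : ℝ} (hs : s < t) :
    HasDerivAt (fun r => inclL1 hA (mulD (flowD hA F (t - r)) (flowD hA G (t - r))))
      (inclL1 hA (-(mulD (flowD hA (gen hA F) (t - s)) (flowD hA G (t - s))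
        + mulD (flowD hA F (t - s)) (flowD hA (gen hA G) (t - s))))) s := by
  simp only [inclL1_mulD_flowD, map_neg, map_add]
  have h1 := HasDerivAt.comp_const_sub t s
    (IsCoordwise.hasDerivAt_flow hA hstat F.2 (sub_pos.2 hs))
  have h2 := HasDerivAt.comp_const_sub t s
    (IsCoordwise.hasDerivAt_flow hA hstat G.2 (sub_pos.2 hs))
  have h3 := (mulL1 μ d).hasDerivAt_of_bilinear (u := fun r => IsCoordwise.flow hA F.2 (t - r))
    (v := fun r => IsCoordwise.flow hA G.2 (t - r)) (fun _ => h1) (fun _ => h2)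
  refine h3.congr_deriv ?_
  rw [map_neg, map_neg, neg_apply, neg_add, add_comm]
  rfl

/-- The carré du champ `Γ(F)` on `coordSub A d`. -/
noncomputable def gammaD (F : coordSub A d) : coordSub A d :=
  ⟨P.gamma F.1 F.1, IsCoordwise.gamma hA F.2 F.2⟩

section Identities

variable {a b e : coordSub A d} (hb : (gen hA a).1 =ᵐ[μ] b.1) (he : (gen hA b).1 =ᵐ[μ] e.1)

include hb in
theorem gammaD_ae_eq : (gammaD hA a).1
    =ᵐ[μ] ((1 / 2 : ℝ) • (gen hA (mulD a a) - (mulD a b + mulD b a))).1 := by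
  filter_upwards [hb] with z hz
  have hz : P.generator a.1 z = b.1 z := hz
  change (1 / 2 : ℝ) • (P.generator (a.1 * a.1) z - a.1 z * P.generator a.1 z
    - P.generator a.1 z * a.1 z) = (1 / 2 : ℝ) • (P.generator (a.1 * a.1) z
      - (a.1 z * b.1 z + b.1 z * a.1 z))
  rw [hz, sub_sub]

include hstat hb he in
-- In the application `a`, `b`, `e` are `P_u` applied to `f`, `𝓛 f`, `𝓛 𝓛 f`. Since `𝓛` and `P_u`
-- are known to commute only almost everywhere, `𝓛 a` and `𝓛 b` are replaced by representatives
-- whose orbits are differentiable.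
theorem gamma₂_ae_eq : P.gamma₂ a.1 a.1
    =ᵐ[μ] ((1 / 2 : ℝ) • ((1 / 2 : ℝ) • (gen hA (gen hA (mulD a a)) - gen hA (mulD a b + mulD b a))
      - (1 / 2 : ℝ) • (gen hA (mulD a b) - mulD a e - mulD b b)
      - (1 / 2 : ℝ) • (gen hA (mulD b a) - mulD b b - mulD e a))).1 := by
  have h1 : (gen hA (gammaD hA a)).1 =ᵐ[μ] ((1 / 2 : ℝ) • (gen hA (gen hA (mulD a a))
      - gen hA (mulD a b + mulD b a))).1 := by
    rw [← gen_sub, ← gen_smul]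
    exact IsCoordwise.generator_congr_ae hA hstat (gammaD hA a).2 (Subtype.prop _)
      (gammaD_ae_eq hA hb)
  have h2 : (gen hA (mulD a (gen hA a))).1 =ᵐ[μ] (gen hA (mulD a b)).1 := by
    refine IsCoordwise.generator_congr_ae hA hstat (Subtype.prop _) (Subtype.prop _) ?_
    filter_upwards [hb] with z hz
    change a.1 z * (gen hA a).1 z = a.1 z * b.1 z
    rw [hz]
  have h3 : (gen hA (mulD (gen hA a) a)).1 =ᵐ[μ] (gen hA (mulD b a)).1 := by
    refine IsCoordwise.generator_congr_ae hA hstat (Subtype.prop _) (Subtype.prop _) ?_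
    filter_upwards [hb] with z hz
    change (gen hA a).1 z * a.1 z = b.1 z * a.1 z
    rw [hz]
  have h4 : (gen hA (gen hA a)).1 =ᵐ[μ] e.1 :=
    (IsCoordwise.generator_congr_ae hA hstat (gen hA a).2 b.2 hb).trans he
  filter_upwards [hb, h1, h2, h3, h4] with z z0 z1 z2 z3 z4
  change (1 / 2 : ℝ) • ((gen hA (gammaD hA a)).1 z
    - (1 / 2 : ℝ) • ((gen hA (mulD a (gen hA a))).1 z - a.1 z * (gen hA (gen hA a)).1 z
      - (gen hA a).1 z * (gen hA a).1 z)
    - (1 / 2 : ℝ) • ((gen hA (mulD (gen hA a) a)).1 z - (gen hA a).1 z * (gen hA a).1 z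
      - (gen hA (gen hA a)).1 z * a.1 z)) = _
  rw [z0, z1, z2, z3, z4]
  rfl

end Identities

include hstat in
theorem gen_flowD_ae_eq (F : coordSub A d) (s : ℝ) :
    (gen hA (flowD hA F s)).1 =ᵐ[μ] (flowD hA (gen hA F) s).1 :=
  IsCoordwise.generator_act hA hstat F.2 _

variable {K : Ω → Matrix (Fin d) (Fin d) ℂ}

include hstat hrev in
-- Formally, `V(r) = ∫ tr[Γ(P_{t-r} f) P_r K]` satisfies `V' = 2 ∫ tr[Γ₂(P_{t-r} f) P_r K] ≥ (2/c)
-- V`, and `r` runs from `0` to `t`. This differentiation would need regularity of `r ↦ 𝓛((P_{t-r}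
-- f)²)`, which the hypotheses do not supply directly. Averaging over a window of length `ε`
-- replaces that generator by a difference of pairings.
theorem avgFun_gammaD_le {c : ℝ} (hc : 0 < c) (hBE : BakryEmery P μ A d c)
    {f : coordSub A d} (hf : ∀ z, (f.1 z).IsHermitian) (hK : IsPosTest K) {ε t : ℝ} (hε : 0 ≤ ε)
    (ht : 0 ≤ t) :
    avgFun hA hstat hrev hK.toIsBoundedMeas ε 0 (gammaD hA (flowD hA f t))
      ≤ Real.exp (-(2 / c * t))
        * avgFun hA hstat hrev hK.toIsBoundedMeas ε t (gammaD hA f) := by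
  set Λ := pairFun (P := P) hA hK.toIsBoundedMeas with hΛ
  set J := avgFun hA hstat hrev hK.toIsBoundedMeas ε with hJ
  obtain ⟨C, hC⟩ := exists_abs_pairFun_le (P := P) hA hK.toIsBoundedMeas
  obtain ⟨C', hC'⟩ := exists_abs_avgFun_le hA hstat hrev hK.toIsBoundedMeas ε
  let a := fun r => flowD hA f (t - r)
  let b := fun r => flowD hA (gen hA f) (t - r)
  let e := fun r => flowD hA (gen hA (gen hA f)) (t - r)
  let x := fun r => mulD (a r) (a r)
  let y := fun r => mulD (a r) (b r) + mulD (b r) (a r)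
  have hb : ∀ r, (gen hA (a r)).1 =ᵐ[μ] (b r).1 := fun r => gen_flowD_ae_eq hA hstat _ _
  have he : ∀ r, (gen hA (b r)).1 =ᵐ[μ] (e r).1 := fun r => gen_flowD_ae_eq hA hstat _ _
  -- The averaged pairing of `Γ(a r) = (1/2)(𝓛 x - y)`, with `𝓛 x` already traded for the boundary
  -- terms. Only products of orbits remain.
  let V := fun r => 1 / 2 * (Λ (r + ε) (x r) - Λ r (x r)) - 1 / 2 * J r (y r)
  have hV : ∀ r, 0 ≤ r → V r = J r (gammaD hA (a r)) := fun r hr => by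
    rw [hJ, avgFun_congr_ae hA hstat hrev _ ε r (gammaD_ae_eq hA (hb r)), map_smul, map_sub,
      ← pairFun_sub_pairFun hA hstat hrev _ hε hr, smul_eq_mul]
    simp only [V, x, y, hΛ, hJ]
    ring
  have hy : ∀ r, inclL1 hA (y r) = inclL1 hA (mulD (a r) (b r)) + inclL1 hA (mulD (b r) (a r)) :=
    fun r => map_add _ _ _
  have hVc : Continuous V := by
    have h1 := continuous_movingFunctional (Λ := fun r => Λ (r + ε)) (fun r => hC (r + ε))
      (continuous_inclL1_mulD_flowD hA hstat f f t)
      fun w => (continuous_pairFun hA hstat hrev _ w).comp (continuous_add_const ε)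
    have h2 := continuous_movingFunctional hC (continuous_inclL1_mulD_flowD hA hstat f f t)
      (continuous_pairFun hA hstat hrev _)
    have h3 : Continuous fun r => J r (y r) := by
      refine continuous_movingFunctional hC' ?_ (continuous_avgFun hA hstat hrev _ ε)
      simp only [hy]
      exact (continuous_inclL1_mulD_flowD hA hstat f (gen hA f) t).add
        (continuous_inclL1_mulD_flowD hA hstat (gen hA f) f t)
    exact ((h1.sub h2).const_mul _).sub (h3.const_mul _)
  have hVd : ∀ r ∈ Set.Ioo 0 t, ∃ v, HasDerivAt V v r ∧ 2 / c * V r ≤ v := by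
    intro r hr
    have hx : HasDerivAt (fun r => inclL1 hA (x r)) (inclL1 hA (-(y r))) r := by
      have := hasDerivAt_inclL1_mulD_flowD hA hstat f f hr.2
      rwa [add_comm (mulD (flowD hA (gen hA f) (t - r)) _)] at this
    have hyd : HasDerivAt (fun r => inclL1 hA (y r))
        (inclL1 hA (-(mulD (b r) (b r) + mulD (a r) (e r))
          + -(mulD (e r) (a r) + mulD (b r) (b r)))) r := by
      rw [map_add]
      simp only [hy]
      exact (hasDerivAt_inclL1_mulD_flowD hA hstat f (gen hA f) hr.2).add
        (hasDerivAt_inclL1_mulD_flowD hA hstat (gen hA f) f hr.2)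
    have d1 := hasDerivAt_movingFunctional (Λ := fun r => Λ (r + ε)) (fun r => hC (r + ε)) hx
      (((continuous_pairFun hA hstat hrev _ _).comp (continuous_add_const ε)).tendsto r)
      ((hasDerivAt_pairFun hA hstat hrev hK.toIsBoundedMeas (x r)
        (add_pos_of_pos_of_nonneg hr.1 hε)).comp_add_const r ε)
    have d2 := hasDerivAt_movingFunctional hC hx
      ((continuous_pairFun hA hstat hrev _ _).tendsto r)
      (hasDerivAt_pairFun hA hstat hrev hK.toIsBoundedMeas (x r) hr.1)
    have d3 := hasDerivAt_movingFunctional hC' hyd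
      ((continuous_avgFun hA hstat hrev _ ε _).tendsto r)
      (hasDerivAt_avgFun hA hstat hrev hK.toIsBoundedMeas ε r (y r))
    refine ⟨_, ((d1.sub d2).const_mul (1 / 2)).sub (d3.const_mul (1 / 2)), ?_⟩
    have hG := gamma₂_ae_eq hA hstat (hb r) (he r)
    set G₂ : coordSub A d := (1 / 2 : ℝ) • ((1 / 2 : ℝ) • (gen hA (gen hA (mulD (a r) (a r)))
        - gen hA (mulD (a r) (b r) + mulD (b r) (a r)))
      - (1 / 2 : ℝ) • (gen hA (mulD (a r) (b r)) - mulD (a r) (e r) - mulD (b r) (b r))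
      - (1 / 2 : ℝ) • (gen hA (mulD (b r) (a r)) - mulD (b r) (b r) - mulD (e r) (a r))) with hG₂
    have hpos : 0 ≤ J r (c • G₂ - gammaD hA (a r)) := by
      refine avgFun_nonneg hA hstat hrev hK hε r _ ?_
      have hs : IsSuitable A (a r).1 :=
        (isSuitable_iff.2 ⟨hf, f.2⟩ : IsSuitable A f.1).act hA (t - r).toNNReal
      filter_upwards [hBE _ hs, hG] with z hz hz2
      rw [hz2] at hz
      exact hz
    rw [map_sub, map_smul, ← hV r hr.1.le, smul_eq_mul] at hpos
    have e1 : Λ (r + ε) (-(y r)) - Λ r (-(y r)) = - J r (gen hA (y r)) := by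
      rw [← pairFun_sub_pairFun hA hstat hrev _ hε hr.1.le, map_neg, map_neg]
      ring
    have e2 := pairFun_sub_pairFun hA hstat hrev hK.toIsBoundedMeas hε hr.1.le (gen hA (x r))
    have e3 := pairFun_sub_pairFun hA hstat hrev hK.toIsBoundedMeas hε hr.1.le (y r)
    -- Expanded, `4 Γ₂ = 𝓛𝓛x - 2 𝓛y + (ae + ea + 2bb)`. The boundary terms of the three derivatives
    -- reassemble into exactly twice `J r G₂`.
    have e4 : J r G₂ = 1 / 4 * (J r (gen hA (gen hA (x r))) - 2 * J r (gen hA (y r))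
        - J r (-(mulD (b r) (b r) + mulD (a r) (e r))
          + -(mulD (e r) (a r) + mulD (b r) (b r)))) := by
      simp only [hG₂, x, y, gen_add, map_add, map_sub, map_smul, map_neg, smul_eq_mul]
      ring
    have e5 : 2 / c * V r ≤ 2 * J r G₂ := by
      rw [div_mul_eq_mul_div, div_le_iff₀ hc]
      linarith
    refine e5.trans (le_of_eq ?_)
    rw [e4]
    simp only [hΛ, hJ] at e1 e2 e3 ⊢
    linarith
  have hW : MonotoneOn (fun r => Real.exp (-(2 / c * r)) * V r) (Set.Icc 0 t) := by
    have hWd : ∀ r ∈ Set.Ioo 0 t, ∃ w, HasDerivAt (fun r => Real.exp (-(2 / c * r)) * V r) w r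
        ∧ 0 ≤ w := by
      intro r hr
      obtain ⟨v, hv, hle⟩ := hVd r hr
      have h1 : HasDerivAt (fun r => Real.exp (-(2 / c * r)))
          (Real.exp (-(2 / c * r)) * -(2 / c)) r := by
        have := ((hasDerivAt_id r).const_mul (2 / c)).neg.exp
        simpa using this
      refine ⟨_, h1.mul hv, ?_⟩
      have := mul_nonneg (Real.exp_pos (-(2 / c * r))).le (sub_nonneg.2 hle)
      linarith
    refine monotoneOn_of_deriv_nonneg (convex_Icc 0 t) ?_ ?_ ?_
    · exact (Continuous.mul (by fun_prop) hVc).continuousOn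
    · rw [interior_Icc]
      intro r hr
      obtain ⟨w, hw, -⟩ := hWd r hr
      exact hw.differentiableAt.differentiableWithinAt
    · rw [interior_Icc]
      intro r hr
      obtain ⟨w, hw, h0⟩ := hWd r hr
      rwa [hw.deriv]
  have h := hW (Set.left_mem_Icc.2 ht) (Set.right_mem_Icc.2 ht) ht
  simp only [mul_zero, neg_zero, Real.exp_zero, one_mul] at h
  rw [hV 0 le_rfl, hV t ht] at h
  have ha0 : a 0 = flowD hA f t := by simp only [a, sub_zero]
  have hat : a t = f := by
    refine Subtype.ext ?_
    change P.act (t - t).toNNReal f.1 = f.1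
    rw [sub_self, Real.toNNReal_zero, IsCoordwise.act_zero hA f.2]
  rwa [ha0, hat] at h

include hA hstat hrev in
/-- The Bakry–Émery gradient bound `Γ(P_t f) ≼ e^{-2t/c} P_t Γ(f)`, in weak form. -/
theorem integral_reTr_gamma_act_le {c : ℝ} (hc : 0 < c) (hBE : BakryEmery P μ A d c)
    {f : Ω → Matrix (Fin d) (Fin d) ℂ} (hf : IsSuitable A f) (hK : IsPosTest K) (t : ℝ≥0) :
    ∫ z, reTr d (P.gamma (P.act t f) (P.act t f) z * K z) ∂μ
      ≤ Real.exp (-(2 / c * t)) * ∫ z, reTr d (P.gamma f f z * P.act t K z) ∂μ := by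
  have hf' := isSuitable_iff.1 hf
  let F : coordSub A d := ⟨f, hf'.2⟩
  have hF : flowD hA F t = ⟨P.act t f, hf'.2.act hA t⟩ := Subtype.ext (by
    change P.act (t : ℝ).toNNReal f = _
    rw [Real.toNNReal_coe])
  -- Both sides are averages over a window of length `ε`; shrinking it leaves the pairings at times
  -- `0` and `t`.
  have h := le_of_forall_integral_le
    (continuous_pairFun hA hstat hrev hK.toIsBoundedMeas (gammaD hA (flowD hA F t)))
    (((continuous_pairFun hA hstat hrev hK.toIsBoundedMeas (gammaD hA F)).comp
      (continuous_add_const (t : ℝ))).const_mul (Real.exp (-(2 / c * t)))) (fun ε hε => by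
    have h1 := avgFun_gammaD_le hA hstat hrev hc hBE (f := F) hf'.1 hK hε.le t.2
    rw [avgFun_apply, avgFun_apply, zero_add] at h1
    refine h1.trans_eq ?_
    rw [intervalIntegral.integral_const_mul]
    simp only [Function.comp_apply]
    rw [intervalIntegral.integral_comp_add_right
      (fun u => pairFun hA hK.toIsBoundedMeas u (gammaD hA F)), zero_add, add_comm ε]
    rfl)
  simp only [Function.comp_apply, zero_add, pairFun_apply, hF, Real.toNNReal_zero,
    Real.toNNReal_coe] at h
  have h0 : ∀ z, P.act 0 K z = K z := fun z => by
    rw [MarkovSemigroup.act, P.kernel_zero, Kernel.id_apply,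
      integral_dirac' _ _ hK.stronglyMeasurable]
  simp only [h0] at h
  exact h

end GradientBound

/-! ### Scalar estimates for the truncated exponential. -/

section TruncatedExponential

/-- The truncated exponential `x ↦ exp (θ min(x, k))`. -/
noncomputable def truncExp (k θ x : ℝ) : ℝ := Real.exp (θ * min x k)

theorem truncExp_pos (k θ x : ℝ) : 0 < truncExp k θ x := Real.exp_pos _

theorem continuous_truncExp (k θ : ℝ) : Continuous (truncExp k θ) := by
  unfold truncExp; fun_prop

/-- The trapezoidal rule overestimates the integral of a convex function, here `exp` on `[0, w]`. -/
theorem exp_sub_one_le {w : ℝ} (hw : 0 ≤ w) : Real.exp w - 1 ≤ w * (Real.exp w + 1) / 2 := by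
  have hd : ∀ x : ℝ, HasDerivAt (fun w => w * (Real.exp w + 1) / 2 - (Real.exp w - 1))
      ((1 * (Real.exp x + 1) + x * Real.exp x) / 2 - Real.exp x) x := fun x =>
    ((((hasDerivAt_id x).mul ((Real.hasDerivAt_exp x).add_const 1)).div_const 2).sub
      ((Real.hasDerivAt_exp x).sub_const 1))
  have hm : Monotone fun w : ℝ => w * (Real.exp w + 1) / 2 - (Real.exp w - 1) := by
    refine monotone_of_deriv_nonneg (fun x => (hd x).differentiableAt) fun x => ?_
    rw [(hd x).deriv]
    have h1 := Real.add_one_le_exp (-x)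
    have h2 : Real.exp x * Real.exp (-x) = 1 := by rw [← Real.exp_add]; simp
    nlinarith [Real.exp_pos x]
  have := hm hw
  simp only [zero_mul, Real.exp_zero, zero_div, sub_self] at this
  linarith

theorem abs_exp_sub_exp_le (u v : ℝ) :
    |Real.exp u - Real.exp v| ≤ |u - v| * ((Real.exp u + Real.exp v) / 2) := by
  wlog h : v ≤ u generalizing u v
  · have := this v u (le_of_not_ge h)
    rwa [abs_sub_comm, abs_sub_comm u v, add_comm (Real.exp u)]
  rw [abs_of_nonneg (sub_nonneg.2 (Real.exp_le_exp.2 h)), abs_of_nonneg (sub_nonneg.2 h)]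
  have h1 := exp_sub_one_le (sub_nonneg.2 h)
  have h2 : Real.exp u = Real.exp v * Real.exp (u - v) := by rw [← Real.exp_add]; simp
  rw [h2]
  nlinarith [Real.exp_pos v]

/-- This is the hypothesis of the mean value trace inequality with `χ = θ φ`: truncation is
1-Lipschitz, so the exponential estimate survives it. -/
theorem abs_truncExp_sub_le (k : ℝ) {θ : ℝ} (hθ : 0 ≤ θ) (x y : ℝ) :
    |truncExp k θ x - truncExp k θ y|
      ≤ |x - y| * ((θ * truncExp k θ x + θ * truncExp k θ y) / 2) := by
  refine (abs_exp_sub_exp_le _ _).trans ?_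
  rw [← mul_sub, abs_mul, abs_of_nonneg hθ, ← mul_add]
  have h1 : |min x k - min y k| ≤ |x - y| := by
    simpa using abs_min_sub_min_le_max x k y k
  have h2 : 0 ≤ Real.exp (θ * min x k) + Real.exp (θ * min y k) := by positivity
  have h3 := mul_le_mul_of_nonneg_right h1 (mul_nonneg hθ h2)
  unfold truncExp
  linarith

end TruncatedExponential

/-! ### The Dirichlet form as a limit of increments over short times. -/

section Covariance

variable {Ω : Type*} [MeasurableSpace Ω] {μ : Measure Ω} [IsProbabilityMeasure μ]
  {P : MarkovSemigroup Ω} {A : Subalgebra ℝ (Ω → ℝ)} {d : ℕ}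
  (hA : P.IsSuitableAlgebra μ A)

include hA in
theorem isPosTest_cfc {f : Ω → Matrix (Fin d) (Fin d) ℂ} (hf : IsSuitable A f) {φ : ℝ → ℝ}
    (hφ : Continuous φ) (h0 : ∀ x, 0 ≤ φ x) {C : ℝ} (hC : ∀ x, φ x ≤ C) :
    IsPosTest fun z => cfc φ (f z) := by
  have hf' := isSuitable_iff.1 hf
  refine ⟨⟨stronglyMeasurable_cfc (hf'.2.stronglyMeasurable hA) hf'.1 hφ, C, fun z => ?_⟩,
    fun z X hX => reTr_mul_cfc_nonneg hX (hf'.1 z) h0⟩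
  refine norm_cfc_le ((h0 0).trans (hC 0)) fun x _ => ?_
  rw [Real.norm_eq_abs, abs_of_nonneg (h0 x)]
  exact hC x

theorem truncExp_le (k : ℝ) {θ : ℝ} (hθ : 0 ≤ θ) (x : ℝ) : truncExp k θ x ≤ Real.exp (θ * k) :=
  Real.exp_le_exp.2 (mul_le_mul_of_nonneg_left (min_le_right _ _) hθ)

include hA in
theorem isPosTest_truncExp {f : Ω → Matrix (Fin d) (Fin d) ℂ} (hf : IsSuitable A f) (k : ℝ)
    {θ : ℝ} (hθ : 0 ≤ θ) : IsPosTest fun z => cfc (truncExp k θ) (f z) :=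
  isPosTest_cfc hA hf (continuous_truncExp k θ) (fun x => (truncExp_pos k θ x).le)
    (truncExp_le k hθ)

/-- The squared increment. -/
def sqIncr (F : Ω → Matrix (Fin d) (Fin d) ℂ) (p : Ω × Ω) : Matrix (Fin d) (Fin d) ℂ :=
  (F p.2 - F p.1) * (F p.2 - F p.1)

variable (hstat : P.IsStationary μ) (hrev : P.IsReversible μ)

include hA hstat in
theorem integrable_sqIncr {F : Ω → Matrix (Fin d) (Fin d) ℂ} (hF : IsCoordwise A F) (t : ℝ≥0) :
    Integrable (sqIncr F) (jointLaw P μ t) := by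
  have h1 : MemLp (fun p : Ω × Ω => F p.2 - F p.1) 2 (jointLaw P μ t) :=
    ((hF.memLp_two hA).comp_measurePreserving (measurePreserving_snd_jointLaw hstat t)).sub
      ((hF.memLp_two hA).comp_measurePreserving (measurePreserving_fst_jointLaw t))
  exact h1.integrable_mul h1

include hA hstat in
theorem integral_reTr_sqIncr_mul_fst {F K : Ω → Matrix (Fin d) (Fin d) ℂ} (hF : IsCoordwise A F)
    (hK : IsBoundedMeas K) (t : ℝ≥0) :
    ∫ p, reTr d (sqIncr F p * K p.1) ∂(jointLaw P μ t)
      = ∫ z, reTr d ((∫ y, (F y - F z) * (F y - F z) ∂(P.kernel t z)) * K z) ∂μ := by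
  have hi := integrable_sqIncr hA hstat hF t
  rw [integral_jointLaw t ((hK.comp measurable_fst).integrable_reTr_mul hi)]
  refine integral_congr_ae ?_
  filter_upwards [((Measure.integrable_compProd_iff hi.aestronglyMeasurable).1 hi).1] with z hz
  have := ((trForm d).flip (K z)).integral_comp_comm hz
  simp only [ContinuousLinearMap.flip_apply, trForm_apply] at this
  exact this

include hrev in
theorem integral_reTr_sqIncr_mul_snd {F K : Ω → Matrix (Fin d) (Fin d) ℂ} (t : ℝ≥0) :
    ∫ p, reTr d (sqIncr F p * K p.2) ∂(jointLaw P μ t)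
      = ∫ p, reTr d (sqIncr F p * K p.1) ∂(jointLaw P μ t) := by
  rw [← integral_jointLaw_swap hrev]
  refine integral_congr_ae (Eventually.of_forall fun p => ?_)
  have : sqIncr F p.swap = sqIncr F p := by
    simp only [sqIncr, Prod.fst_swap, Prod.snd_swap]
    noncomm_ring
  simp only [this, Prod.snd_swap]

include hA hstat hrev in
-- Expand the product of increments into four terms; exchangeability makes the two diagonal terms
-- equal, and likewise the two mixed ones.
theorem two_mul_neg_integral_reTr_diffQuot {h K : Ω → Matrix (Fin d) (Fin d) ℂ}
    (hh : IsCoordwise A h) (hK : IsBoundedMeas K) (t : ℝ≥0) :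
    2 * (∫ z, reTr d (h z * K z) ∂μ - ∫ z, reTr d (P.act t h z * K z) ∂μ)
      = ∫ p, reTr d ((h p.2 - h p.1) * (K p.2 - K p.1)) ∂(jointLaw P μ t) := by
  have hi := hh.integrable hA
  have i2 : Integrable (fun p : Ω × Ω => h p.2) (jointLaw P μ t) :=
    (measurePreserving_snd_jointLaw hstat t).integrable_comp_of_integrable hi
  have i1 : Integrable (fun p : Ω × Ω => h p.1) (jointLaw P μ t) :=
    (measurePreserving_fst_jointLaw t).integrable_comp_of_integrable hi
  have K1 : IsBoundedMeas fun p : Ω × Ω => K p.1 := hK.comp measurable_fst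
  have K2 : IsBoundedMeas fun p : Ω × Ω => K p.2 := hK.comp measurable_snd
  have hsm : AEStronglyMeasurable (fun z => reTr d (h z * K z)) μ :=
    (hK.integrable_reTr_mul hi).aestronglyMeasurable
  have e11 : ∫ p, reTr d (h p.1 * K p.1) ∂(jointLaw P μ t) = ∫ z, reTr d (h z * K z) ∂μ := by
    have := measurePreserving_fst_jointLaw (P := P) (μ := μ) t
    conv_rhs => rw [← this.map_eq]
    rw [integral_map this.measurable.aemeasurable (by rwa [this.map_eq])]
  have e22 : ∫ p, reTr d (h p.2 * K p.2) ∂(jointLaw P μ t) = ∫ z, reTr d (h z * K z) ∂μ := by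
    rw [← e11, ← integral_jointLaw_swap hrev]
    rfl
  have e21 := integral_reTr_act_mul hstat t hi hK
  have e12 : ∫ p, reTr d (h p.1 * K p.2) ∂(jointLaw P μ t)
      = ∫ p, reTr d (h p.2 * K p.1) ∂(jointLaw P μ t) := by
    rw [← integral_jointLaw_swap hrev]
    rfl
  have e : ∀ p : Ω × Ω, reTr d ((h p.2 - h p.1) * (K p.2 - K p.1))
      = (reTr d (h p.2 * K p.2) - reTr d (h p.2 * K p.1))
        - (reTr d (h p.1 * K p.2) - reTr d (h p.1 * K p.1)) := fun p => by
    rw [sub_mul, mul_sub, mul_sub, map_sub, map_sub, map_sub]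
  simp only [e]
  rw [integral_sub, integral_sub, integral_sub, e22, e11, e12, e21]
  · ring
  · exact K2.integrable_reTr_mul i1
  · exact K1.integrable_reTr_mul i1
  · exact K2.integrable_reTr_mul i2
  · exact K1.integrable_reTr_mul i2
  · exact (K2.integrable_reTr_mul i2).sub (K1.integrable_reTr_mul i2)
  · exact (K2.integrable_reTr_mul i1).sub (K1.integrable_reTr_mul i1)

include hA in
theorem tendsto_integral_reTr_diffQuot {F K : Ω → Matrix (Fin d) (Fin d) ℂ}
    (hF : IsCoordwise A F) (hK : IsBoundedMeas K) :
    Tendsto (fun t : ℝ≥0 => ∫ z, reTr d (P.diffQuot F t z * K z) ∂μ) (𝓝[>] 0)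
      (𝓝 (∫ z, reTr d (P.generator F z * K z) ∂μ)) := by
  rw [← pairL2_toL2 hA hK (hF.generator hA)]
  refine (((pairL2 μ hK).continuous.tendsto _).comp (hF.tendsto_toL2_diffQuot hA)).congr fun t => ?_
  exact pairL2_toL2 hA hK (hF.diffQuot hA t)

include hA hstat in
-- Pointwise convergence to the carré du champ does not by itself pass to the integral. The
-- quotients converge in `L_2`, hence their products with `F` converge in `L_1`, and `K` is bounded.
theorem tendsto_integral_reTr_sq {F K : Ω → Matrix (Fin d) (Fin d) ℂ}
    (hF : IsCoordwise A F) (hK : IsBoundedMeas K) :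
    Tendsto (fun t : ℝ≥0 => (t : ℝ)⁻¹ * ∫ p, reTr d (sqIncr F p * K p.1) ∂(jointLaw P μ t))
      (𝓝[>] 0) (𝓝 (2 * ∫ z, reTr d (P.gamma F F z * K z) ∂μ)) := by
  obtain ⟨C, hC⟩ := exists_abs_pairFun_le (P := P) hA hK
  set Λ := pairFun (P := P) hA hK 0
  have hΛc : ∀ (x : ℝ≥0 → coordSub A d) (x' : coordSub A d),
      Tendsto (fun t => inclL1 hA (x t)) (𝓝[>] 0) (𝓝 (inclL1 hA x')) →
      Tendsto (fun t => Λ (x t)) (𝓝[>] 0) (𝓝 (Λ x')) := fun x x' h => by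
    rw [tendsto_iff_norm_sub_tendsto_zero] at h ⊢
    refine squeeze_zero (fun _ => norm_nonneg _) (fun t => ?_) (by simpa using h.const_mul C)
    rw [← map_sub, ← map_sub]
    exact hC 0 _
  have hΛ0 : ∀ x : coordSub A d, Λ x = ∫ z, reTr d (x.1 z * K z) ∂μ := fun x => by
    simp only [Λ, pairFun_apply, Real.toNNReal_zero]
    refine integral_congr_ae (Eventually.of_forall fun z => ?_)
    simp only
    rw [MarkovSemigroup.act, P.kernel_zero, Kernel.id_apply,
      integral_dirac' _ _ hK.stronglyMeasurable]
  have hdq := hF.tendsto_toL2_diffQuot hA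
  have h1 : Tendsto (fun t : ℝ≥0 => Λ ⟨F * P.diffQuot F t, hF.mul (hF.diffQuot hA t)⟩) (𝓝[>] 0)
      (𝓝 (Λ ⟨F * P.generator F, hF.mul (hF.generator hA)⟩)) := by
    refine hΛc _ _ ?_
    have := ((mulL1 μ d (hF.toL2 hA)).continuous.tendsto _).comp hdq
    rw [mulL1_toL2 hA hF (hF.generator hA)] at this
    exact this.congr fun t => mulL1_toL2 hA hF (hF.diffQuot hA t)
  have h2 : Tendsto (fun t : ℝ≥0 => Λ ⟨P.diffQuot F t * F, (hF.diffQuot hA t).mul hF⟩) (𝓝[>] 0)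
      (𝓝 (Λ ⟨P.generator F * F, (hF.generator hA).mul hF⟩)) := by
    refine hΛc _ _ ?_
    have := (((mulL1 μ d).flip (hF.toL2 hA)).continuous.tendsto _).comp hdq
    rw [ContinuousLinearMap.flip_apply, mulL1_toL2 hA (hF.generator hA) hF] at this
    exact this.congr fun t => mulL1_toL2 hA (hF.diffQuot hA t) hF
  have h3 : Tendsto (fun t : ℝ≥0 => Λ ⟨P.diffQuot (F * F) t, (hF.mul hF).diffQuot hA t⟩) (𝓝[>] 0)
      (𝓝 (Λ ⟨P.generator (F * F), (hF.mul hF).generator hA⟩)) := by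
    simp only [hΛ0]
    exact tendsto_integral_reTr_diffQuot hA (hF.mul hF) hK
  have hlim := (h3.sub h1).sub h2
  simp only [← map_sub] at hlim
  have e0 : 2 * ∫ z, reTr d (P.gamma F F z * K z) ∂μ = Λ ((⟨P.generator (F * F),
      (hF.mul hF).generator hA⟩ : coordSub A d) - ⟨F * P.generator F, hF.mul (hF.generator hA)⟩
      - ⟨P.generator F * F, (hF.generator hA).mul hF⟩) := by
    rw [hΛ0, ← integral_const_mul]
    refine integral_congr_ae (Eventually.of_forall fun z => ?_)
    have e : P.generator (F * F) z - F z * P.generator F z - P.generator F z * F z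
        = (2 : ℝ) • P.gamma F F z := by
      change _ = (2 : ℝ) • ((1 / 2 : ℝ) • (P.generator (F * F) z - F z * P.generator F z
        - P.generator F z * F z))
      rw [smul_smul, mul_one_div_cancel two_ne_zero, one_smul]
    change 2 * reTr d (P.gamma F F z * K z) = reTr d ((P.generator (F * F) z
      - F z * P.generator F z - P.generator F z * F z) * K z)
    rw [e, smul_mul_assoc, map_smul, smul_eq_mul]
  rw [e0]
  refine hlim.congr fun t => ?_
  rw [hΛ0, integral_reTr_sqIncr_mul_fst hA hstat hF hK, ← integral_const_mul]
  refine integral_congr_ae (Eventually.of_forall fun z => ?_)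
  change reTr d ((P.diffQuot (F * F) t z - F z * P.diffQuot F t z - P.diffQuot F t z * F z) * K z)
    = _
  rw [← hF.inv_smul_integral_sq_sub hA, smul_mul_assoc, map_smul, smul_eq_mul]

include hA hstat hrev in
/-- Bound for the Dirichlet form against a truncated exponential. -/
theorem neg_integral_reTr_generator_le {f h : Ω → Matrix (Fin d) (Fin d) ℂ}
    (hf : IsSuitable A f) (hh : IsSuitable A h) (k : ℝ) {θ : ℝ} (hθ : 0 ≤ θ) {s : ℝ}
    (hs : 0 < s) :
    -∫ z, reTr d (P.generator h z * cfc (truncExp k θ) (f z)) ∂μ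
      ≤ θ / 2 * (s * ∫ z, reTr d (P.gamma f f z * cfc (truncExp k θ) (f z)) ∂μ
        + s⁻¹ * ∫ z, reTr d (P.gamma h h z * cfc (truncExp k θ) (f z)) ∂μ) := by
  have hf' := isSuitable_iff.1 hf
  have hh' := isSuitable_iff.1 hh
  set K := fun z => cfc (truncExp k θ) (f z) with hKdef
  have hK : IsBoundedMeas K := (isPosTest_truncExp hA hf k hθ).toIsBoundedMeas
  have K1 : IsBoundedMeas fun p : Ω × Ω => K p.1 := hK.comp measurable_fst
  have K2 : IsBoundedMeas fun p : Ω × Ω => K p.2 := hK.comp measurable_snd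
  have hL := (tendsto_integral_reTr_diffQuot hA hh'.2 hK).neg
  have hR := (((tendsto_integral_reTr_sq hA hstat hf'.2 hK).const_mul s).add
    ((tendsto_integral_reTr_sq hA hstat hh'.2 hK).const_mul s⁻¹)).const_mul (θ / 4)
  refine (le_of_tendsto_of_tendsto hL hR ?_).trans_eq (by ring)
  filter_upwards [self_mem_nhdsWithin] with t ht
  have ht0 : (0 : ℝ) < t := by exact_mod_cast ht
  have iF := integrable_sqIncr hA hstat hf'.2 t
  have iH := integrable_sqIncr hA hstat hh'.2 t
  -- The mean value trace inequality for `f(Z_t)` and `f(Z_0)`, with the increment of `h` as the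
  -- third matrix.
  have hpt : ∀ p : Ω × Ω, reTr d ((h p.2 - h p.1) * (K p.2 - K p.1))
      ≤ θ / 4 * ((s * reTr d (sqIncr f p * K p.2) + s⁻¹ * reTr d (sqIncr h p * K p.2))
        + (s * reTr d (sqIncr f p * K p.1) + s⁻¹ * reTr d (sqIncr h p * K p.1))) := fun p => by
    have h1 := reTr_mul_cfc_sub_cfc_le (hf'.1 p.2) (hf'.1 p.1) ((hh'.1 p.2).sub (hh'.1 p.1))
      (fun x => mul_nonneg hθ (truncExp_pos k θ x).le) (abs_truncExp_sub_le k hθ) hs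
    refine h1.trans_eq ?_
    rw [cfc_const_mul θ _ _ (continuous_truncExp k θ).continuousOn,
      cfc_const_mul θ _ _ (continuous_truncExp k θ).continuousOn]
    simp only [sqIncr, hKdef, add_mul, mul_add, smul_mul_assoc, mul_smul_comm, map_add, map_smul,
      smul_eq_mul]
    ring
  have hint := integral_mono (μ := jointLaw P μ t) ?_ ?_ hpt
  · rw [← two_mul_neg_integral_reTr_diffQuot hA hstat hrev hh'.2 hK t, integral_const_mul,
      integral_add, integral_add, integral_add, integral_const_mul, integral_const_mul,
      integral_const_mul, integral_const_mul, integral_reTr_sqIncr_mul_snd hrev,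
      integral_reTr_sqIncr_mul_snd hrev] at hint
    · have e : -∫ z, reTr d (P.diffQuot h t z * K z) ∂μ = (t : ℝ)⁻¹
          * (∫ z, reTr d (h z * K z) ∂μ - ∫ z, reTr d (P.act t h z * K z) ∂μ) := by
        rw [← integral_sub (hK.integrable_reTr_mul (hh'.2.integrable hA))
          (hK.integrable_reTr_mul ((hh'.2.act hA t).integrable hA)), ← integral_neg,
          ← integral_const_mul]
        refine integral_congr_ae (Eventually.of_forall fun z => ?_)
        simp only [MarkovSemigroup.diffQuot, smul_mul_assoc, sub_mul, map_smul, map_sub,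
          smul_eq_mul]
        ring
      rw [e]
      have h2 := mul_le_mul_of_nonneg_left hint (inv_nonneg.2 ht0.le)
      linarith
    · exact (K1.integrable_reTr_mul iF).const_mul _
    · exact (K1.integrable_reTr_mul iH).const_mul _
    · exact (K2.integrable_reTr_mul iF).const_mul _
    · exact (K2.integrable_reTr_mul iH).const_mul _
    · exact ((K2.integrable_reTr_mul iF).const_mul _).add ((K2.integrable_reTr_mul iH).const_mul _)
    · exact ((K1.integrable_reTr_mul iF).const_mul _).add ((K1.integrable_reTr_mul iH).const_mul _)
  · have i2 : Integrable (fun p : Ω × Ω => h p.2) (jointLaw P μ t) :=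
      (measurePreserving_snd_jointLaw hstat t).integrable_comp_of_integrable (hh'.2.integrable hA)
    have i1 : Integrable (fun p : Ω × Ω => h p.1) (jointLaw P μ t) :=
      (measurePreserving_fst_jointLaw t).integrable_comp_of_integrable (hh'.2.integrable hA)
    have K21 : IsBoundedMeas fun p : Ω × Ω => K p.2 - K p.1 := by
      obtain ⟨C, hC⟩ := hK.bounded
      exact ⟨K2.stronglyMeasurable.sub K1.stronglyMeasurable, C + C, fun p =>
        (norm_sub_le _ _).trans (add_le_add (hC _) (hC _))⟩
    exact K21.integrable_reTr_mul (i2.sub i1)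
  · exact ((((K2.integrable_reTr_mul iF).const_mul _).add
      ((K2.integrable_reTr_mul iH).const_mul _)).add (((K1.integrable_reTr_mul iF).const_mul _).add
      ((K1.integrable_reTr_mul iH).const_mul _))).const_mul _

end Covariance

/-! ### Integration of the Dirichlet form over all times. -/

section CovarianceBound

variable {Ω : Type*} [MeasurableSpace Ω] {μ : Measure Ω} [IsProbabilityMeasure μ]
  {P : MarkovSemigroup Ω} {A : Subalgebra ℝ (Ω → ℝ)} {d : ℕ}
  (hA : P.IsSuitableAlgebra μ A)

theorem IsCoordwise.tendsto_flow_atTop (herg : P.IsErgodic μ)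
    {F : Ω → Matrix (Fin d) (Fin d) ℂ} (hF : IsCoordwise A F) (h0 : ∫ z, F z ∂μ = 0) :
    Tendsto (fun t : ℝ≥0 => (hF.act hA t).toL2 hA) atTop (𝓝 0) := by
  have hz : Tendsto (fun t : ℝ≥0 => eLpNorm (P.act t F - 0) 2 μ) atTop (𝓝 0) := by
    have h1 : Tendsto (fun t : ℝ≥0 => ∑ k, ‖Module.finBasis ℝ (Matrix (Fin d) (Fin d) ℂ) k‖ₑ *
        eLpNorm (P.act t fun z => coordL (Matrix (Fin d) (Fin d) ℂ) k (F z)) 2 μ) atTop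
        (𝓝 (∑ k, ‖Module.finBasis ℝ (Matrix (Fin d) (Fin d) ℂ) k‖ₑ * 0)) := by
      refine tendsto_finsetSum _ fun k _ => ENNReal.Tendsto.const_mul ?_ (Or.inr enorm_ne_top)
      have hk := hF (coordL _ k)
      have h2 : MemLp (fun z => coordL (Matrix (Fin d) (Fin d) ℂ) k (F z)) 2 μ :=
        (coordL _ k).comp_memLp' (hF.memLp_two hA)
      have h3 := herg _ h2
      have h4 : ∫ z, coordL (Matrix (Fin d) (Fin d) ℂ) k (F z) ∂μ = 0 := by
        rw [(coordL _ k).integral_comp_comm (hF.integrable hA), h0, map_zero]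
      simpa only [h4, sub_zero] using h3
    simp only [mul_zero, Finset.sum_const_zero] at h1
    refine tendsto_of_tendsto_of_tendsto_of_le_of_le tendsto_const_nhds h1
      (fun _ => zero_le) fun t => ?_
    simp only [sub_zero]
    have hD := hF.act hA t
    rw [IsCoordwise.eq_sum (P.act t F)]
    refine (eLpNorm_sum_le (fun k _ => ?_) one_le_two).trans (Finset.sum_le_sum fun k _ => ?_)
    · exact ((hA.measurable _
        (hD (coordL _ k))).stronglyMeasurable.smul_const _).aestronglyMeasurable
    · simp only [hF.map_act hA]
      rw [← enorm_norm, ← ofReal_norm, norm_norm]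
      refine eLpNorm_le_mul_eLpNorm_of_ae_le_mul (Eventually.of_forall fun z => ?_) 2
      rw [norm_smul, mul_comm]
  have := (Lp.tendsto_Lp_iff_tendsto_eLpNorm'' (fun t => P.act t F)
    (fun t => (hF.act hA t).memLp_two hA) 0 MemLp.zero').2 hz
  exact this

variable (hstat : P.IsStationary μ) (hrev : P.IsReversible μ) (herg : P.IsErgodic μ)

include hA hstat hrev herg in
/-- Covariance of a centered function with a truncated exponential. -/
theorem integral_reTr_mul_truncExp_le {c : ℝ} (hc : 0 < c) (hBE : BakryEmery P μ A d c)
    {f : Ω → Matrix (Fin d) (Fin d) ℂ} (hf : IsSuitable A f) (h0 : ∫ z, f z ∂μ = 0) (k : ℝ)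
    {θ : ℝ} (hθ : 0 ≤ θ) {R : ℝ}
    (hR : ∀ t : ℝ≥0,
      ∫ z, reTr d (P.gamma f f z * P.act t (fun z => cfc (truncExp k θ) (f z)) z) ∂μ ≤ R) :
    ∫ z, reTr d (f z * cfc (truncExp k θ) (f z)) ∂μ ≤ c * θ * R := by
  have hf' := isSuitable_iff.1 hf
  have hKp := isPosTest_truncExp hA hf k hθ
  have hK := hKp.toIsBoundedMeas
  set K := fun z => cfc (truncExp k θ) (f z) with hKdef
  have hact0 : P.act 0 K = K := by
    ext1 z
    rw [MarkovSemigroup.act, P.kernel_zero, Kernel.id_apply,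
      integral_dirac' _ _ hK.stronglyMeasurable]
  let φ := fun r : ℝ => pairL2 μ hK (hf'.2.flow hA r)
  have hder : ∀ t : ℝ, 0 < t → -(θ * R * Real.exp (-(t / c)))
      ≤ pairL2 μ hK ((hf'.2.generator hA).flow hA t) := by
    intro t ht
    lift t to ℝ≥0 using ht.le
    have e1 : (hf'.2.generator hA).flow hA t = ((hf'.2.act hA t).generator hA).toL2 hA := by
      rw [IsCoordwise.flow_eq_toL2_act]
      exact IsCoordwise.toL2_congr hA _ _ (hf'.2.generator_act hA hstat t).symm
    rw [e1, pairL2_toL2]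
    have hs : 0 < Real.exp (-(t / c)) := Real.exp_pos _
    -- The weight `s = e^{-t/c}` balances the two terms, because the second one gains `e^{-2t/c}`
    -- from the gradient bound.
    have h1 := neg_integral_reTr_generator_le hA hstat hrev hf (hf.act hA t) k hθ hs
    have h2 := integral_reTr_gamma_act_le hA hstat hrev hc hBE hf hKp t
    have h3 := hR 0
    rw [hact0] at h3
    have h4 := hR t
    have e2 : (Real.exp (-((t : ℝ) / c)))⁻¹ * Real.exp (-(2 / c * t)) = Real.exp (-(t / c)) := by
      rw [← Real.exp_neg, ← Real.exp_add]
      congr 1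
      field_simp
      ring
    have h5 : (Real.exp (-((t : ℝ) / c)))⁻¹
        * ∫ z, reTr d (P.gamma (P.act t f) (P.act t f) z * K z) ∂μ
        ≤ Real.exp (-((t : ℝ) / c)) * R := by
      refine (mul_le_mul_of_nonneg_left h2 (inv_nonneg.2 hs.le)).trans ?_
      rw [← mul_assoc, e2]
      exact mul_le_mul_of_nonneg_left h4 hs.le
    have h6 := mul_le_mul_of_nonneg_left h3 hs.le
    have h7 : θ / 2 * (Real.exp (-((t : ℝ) / c)) * ∫ z, reTr d (P.gamma f f z * K z) ∂μ
        + (Real.exp (-((t : ℝ) / c)))⁻¹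
          * ∫ z, reTr d (P.gamma (P.act t f) (P.act t f) z * K z) ∂μ)
        ≤ θ / 2 * (Real.exp (-((t : ℝ) / c)) * R + Real.exp (-((t : ℝ) / c)) * R) :=
      mul_le_mul_of_nonneg_left (add_le_add h6 h5) (by positivity)
    linarith
  -- The subtracted term integrates the lower bound `hder`, so `ψ` is nondecreasing. It tends to `0`
  -- by ergodicity, whence `ψ 0 ≤ 0`. This replaces an improper integral over time.
  let ψ := fun r : ℝ => φ r - c * θ * R * Real.exp (-(r / c))
  have hψ : MonotoneOn ψ (Set.Ici 0) := by
    have hd : ∀ r, 0 < r → ∃ w, HasDerivAt ψ w r ∧ 0 ≤ w := by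
      intro r hr
      have d1 : HasDerivAt φ (pairL2 μ hK ((hf'.2.generator hA).flow hA r)) r :=
        (pairL2 μ hK).hasFDerivAt.comp_hasDerivAt r (hf'.2.hasDerivAt_flow hA hstat hr)
      have d2 : HasDerivAt (fun r : ℝ => c * θ * R * Real.exp (-(r / c)))
          (c * θ * R * (Real.exp (-(r / c)) * -(1 / c))) r :=
        (((hasDerivAt_id r).div_const c).neg.exp).const_mul _
      refine ⟨_, d1.sub d2, ?_⟩
      have h1 := hder r hr
      have e : c * θ * R * (Real.exp (-(r / c)) * -(1 / c)) = -(θ * R * Real.exp (-(r / c))) := by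
        field_simp
      rw [e]
      linarith
    have hcont : Continuous ψ :=
      ((pairL2 μ hK).continuous.comp (hf'.2.continuous_flow hA hstat)).sub (by fun_prop)
    refine monotoneOn_of_deriv_nonneg (convex_Ici 0) hcont.continuousOn ?_ ?_
    · rw [interior_Ici]
      intro r hr
      obtain ⟨w, hw, -⟩ := hd r hr
      exact hw.differentiableAt.differentiableWithinAt
    · rw [interior_Ici]
      intro r hr
      obtain ⟨w, hw, hw0⟩ := hd r hr
      rwa [hw.deriv]
  have hlim : Tendsto (fun t : ℝ≥0 => ψ t) atTop (𝓝 0) := by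
    have h1 : Tendsto (fun t : ℝ≥0 => φ t) atTop (𝓝 0) := by
      have := ((pairL2 μ hK).continuous.tendsto _).comp (hf'.2.tendsto_flow_atTop hA herg h0)
      rw [map_zero] at this
      refine this.congr fun t => ?_
      simp only [Function.comp_apply, φ, IsCoordwise.flow_eq_toL2_act]
    have h2 : Tendsto (fun t : ℝ≥0 => c * θ * R * Real.exp (-((t : ℝ) / c))) atTop
        (𝓝 (c * θ * R * 0)) := by
      refine Tendsto.const_mul _ ?_
      have h3 : Tendsto (fun t : ℝ≥0 => (t : ℝ) / c) atTop atTop :=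
        NNReal.tendsto_coe_atTop.2 tendsto_id |>.atTop_div_const hc
      exact Real.tendsto_exp_neg_atTop_nhds_zero.comp h3
    simpa using h1.sub h2
  have hle : ψ 0 ≤ 0 := ge_of_tendsto' hlim fun t =>
    hψ (Set.mem_Ici.2 le_rfl) (Set.mem_Ici.2 t.2) t.2
  have hφ0 : φ 0 = ∫ z, reTr d (f z * K z) ∂μ := by
    simp only [φ, IsCoordwise.flow_zero, pairL2_toL2]
  simp only [ψ, hφ0, zero_div, neg_zero, Real.exp_zero, mul_one] at hle
  linarith

end CovarianceBound

/-! ### Integration of the two differential inequalities. -/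

section DifferentialInequalities

/-- Integration of `m' ≤ 2 κ θ m`. -/
theorem le_exp_of_deriv_le {m m' : ℝ → ℝ} {κ : ℝ} (hc : ContinuousOn m (Set.Ici 0))
    (hd : ∀ θ, 0 < θ → HasDerivAt m (m' θ) θ) (h : ∀ θ, 0 < θ → m' θ ≤ 2 * κ * θ * m θ)
    (h0 : m 0 = 1) {θ : ℝ} (hθ : 0 ≤ θ) : m θ ≤ Real.exp (κ * θ ^ 2) := by
  have hda : ∀ x, 0 < x → ∃ w, HasDerivAt (fun x => m x * Real.exp (-(κ * x ^ 2))) w x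
      ∧ w ≤ 0 := by
    intro x hx
    have h1 : HasDerivAt (fun x : ℝ => Real.exp (-(κ * x ^ 2)))
        (Real.exp (-(κ * x ^ 2)) * -(κ * (2 * x))) x := by
      have := (((hasDerivAt_pow 2 x).const_mul κ).neg).exp
      simpa using this
    refine ⟨_, (hd x hx).mul h1, ?_⟩
    have := mul_le_mul_of_nonneg_right (h x hx) (Real.exp_pos (-(κ * x ^ 2))).le
    linarith
  have hanti : AntitoneOn (fun x => m x * Real.exp (-(κ * x ^ 2))) (Set.Ici 0) := by
    refine antitoneOn_of_deriv_nonpos (convex_Ici 0)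
      (hc.mul (by fun_prop : Continuous fun x : ℝ => Real.exp (-(κ * x ^ 2))).continuousOn) ?_ ?_
    · rw [interior_Ici]
      intro r hr
      obtain ⟨w, hw, -⟩ := hda r hr
      exact hw.differentiableAt.differentiableWithinAt
    · rw [interior_Ici]
      intro r hr
      obtain ⟨w, hw, hw0⟩ := hda r hr
      rwa [hw.deriv]
  have h1 := hanti (Set.mem_Ici.2 le_rfl) (Set.mem_Ici.2 hθ) hθ
  simp only [h0, one_mul] at h1
  rw [zero_pow two_ne_zero, mul_zero, neg_zero, Real.exp_zero, Real.exp_neg,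
    ← div_eq_mul_inv, div_le_one (Real.exp_pos _)] at h1
  exact h1

/-- Integration of `L' ≤ κ θ (θ L' - L + a)`. -/
theorem le_mul_one_sub_sqrt_of_deriv_le {L L' : ℝ → ℝ} {κ a : ℝ}
    (hκ : 0 ≤ κ) (hc : ContinuousOn L (Set.Ici 0))
    (hd : ∀ θ, 0 < θ → HasDerivAt L (L' θ) θ)
    (h : ∀ θ, 0 < θ → L' θ ≤ κ * θ * (θ * L' θ - L θ + a)) (h0 : L 0 = 0) {θ : ℝ} (hθ : 0 ≤ θ)
    (hθ1 : κ * θ ^ 2 < 1) : L θ ≤ a * (1 - √(1 - κ * θ ^ 2)) := by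
  have hlt : ∀ x ∈ Set.Icc 0 θ, 0 < 1 - κ * x ^ 2 := fun x hx => by
    have : x ^ 2 ≤ θ ^ 2 := pow_le_pow_left₀ hx.1 hx.2 2
    nlinarith
  -- Collecting `L'`, the hypothesis reads `(1 - κθ²) L' + κθ (L - a) ≤ 0`, for which `1/√(1 - κθ²)`
  -- is the integrating factor.
  have hda : ∀ x ∈ Set.Ioo 0 θ, ∃ w, HasDerivAt (fun x => (L x - a) / √(1 - κ * x ^ 2)) w x
      ∧ w ≤ 0 := by
    intro x hx
    have hp := hlt x ⟨hx.1.le, hx.2.le⟩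
    have h1 : HasDerivAt (fun x : ℝ => 1 - κ * x ^ 2) (-(κ * (2 * x))) x := by
      have := ((hasDerivAt_pow 2 x).const_mul κ).const_sub 1
      simpa using this
    have h2 := h1.sqrt hp.ne'
    refine ⟨_, ((hd x hx.1).sub_const a).div h2 (Real.sqrt_pos.2 hp).ne', ?_⟩
    refine div_nonpos_of_nonpos_of_nonneg ?_ (sq_nonneg _)
    set S := √(1 - κ * x ^ 2) with hS
    have hSp : 0 < S := Real.sqrt_pos.2 hp
    have hS2 : S * S = 1 - κ * x ^ 2 := Real.mul_self_sqrt hp.le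
    have h3 := h x hx.1
    have e : L' x * S - (L x - a) * (-(κ * (2 * x)) / (2 * S))
        = (L' x * (S * S) + κ * x * (L x - a)) / S := by
      field_simp
      ring
    rw [e, hS2]
    refine div_nonpos_of_nonpos_of_nonneg ?_ hSp.le
    linarith
  have hanti : AntitoneOn (fun x => (L x - a) / √(1 - κ * x ^ 2)) (Set.Icc 0 θ) := by
    refine antitoneOn_of_deriv_nonpos (convex_Icc 0 θ) ?_ ?_ ?_
    · refine ContinuousOn.div ((hc.mono Set.Icc_subset_Ici_self).sub continuousOn_const)
        (by fun_prop) fun x hx => (Real.sqrt_pos.2 (hlt x hx)).ne'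
    · rw [interior_Icc]
      intro r hr
      obtain ⟨w, hw, -⟩ := hda r hr
      exact hw.differentiableAt.differentiableWithinAt
    · rw [interior_Icc]
      intro r hr
      obtain ⟨w, hw, hw0⟩ := hda r hr
      rwa [hw.deriv]
  have h1 := hanti (Set.left_mem_Icc.2 hθ) (Set.right_mem_Icc.2 hθ) hθ
  have hp := hlt θ (Set.right_mem_Icc.2 hθ)
  simp only [h0] at h1
  rw [zero_pow two_ne_zero, mul_zero, sub_zero, Real.sqrt_one, div_one, zero_sub,
    div_le_iff₀ (Real.sqrt_pos.2 hp)] at h1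
  linarith

/-- With `S = √(1 - s²)` one has `s² = (1 - S)(1 + S)` and `1 + S ≥ 2(1 - s)`. The result has the
denominator of Bernstein's inequality. -/
theorem one_sub_sqrt_le {a s : ℝ} (hs : 0 ≤ s) (hs1 : s < 1) (ha : 0 ≤ a) :
    a * (1 - √(1 - s ^ 2)) ≤ a * s ^ 2 / (2 * (1 - s)) := by
  rw [le_div_iff₀ (by linarith), mul_assoc]
  refine mul_le_mul_of_nonneg_left ?_ ha
  have hp : 0 ≤ 1 - s ^ 2 := by nlinarith
  set S := √(1 - s ^ 2)
  have hS2 : S * S = 1 - s ^ 2 := Real.mul_self_sqrt hp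
  have hS : 1 - s ≤ S := Real.le_sqrt_of_sq_le (by nlinarith)
  have hS1 : S ≤ 1 := Real.sqrt_le_one.2 (by nlinarith [sq_nonneg s])
  nlinarith

end DifferentialInequalities

/-! ### The truncated trace moment generating function and its bounds. -/

section Laplace

variable {Ω : Type*} [MeasurableSpace Ω] {μ : Measure Ω} [IsProbabilityMeasure μ]
  {P : MarkovSemigroup Ω} {A : Subalgebra ℝ (Ω → ℝ)} {d : ℕ}
  (hA : P.IsSuitableAlgebra μ A)

/-- The normalized trace moment generating function of the truncation of `f` at level `k`. -/
noncomputable def truncMGF (μ : Measure Ω) (f : Ω → Matrix (Fin d) (Fin d) ℂ) (k θ : ℝ) : ℝ :=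
  ∫ z, (d : ℝ)⁻¹ * reTr d (cfc (truncExp k θ) (f z)) ∂μ

/-- The derivative of `truncMGF`. -/
noncomputable def truncMGF' (μ : Measure Ω) (f : Ω → Matrix (Fin d) (Fin d) ℂ) (k θ : ℝ) : ℝ :=
  ∫ z, (d : ℝ)⁻¹ * reTr d (cfc (fun x => min x k * truncExp k θ x) (f z)) ∂μ

theorem abs_min_le (x k : ℝ) : |min x k| ≤ |x| + |k| := by
  rcases min_choice x k with h | h <;> rw [h]
  · linarith [abs_nonneg k]
  · linarith [abs_nonneg x]

theorem abs_reTr_cfc_le (hd : 0 < d) {B : Matrix (Fin d) (Fin d) ℂ} (hB : B.IsHermitian)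
    {φ : ℝ → ℝ} {C : ℝ}
    (h : ∀ i, |φ (hB.eigenvalues i)| ≤ C) : |(d : ℝ)⁻¹ * reTr d (cfc φ B)| ≤ C := by
  have hd' : (0 : ℝ) < d := by exact_mod_cast hd
  rw [reTr_cfc hB, abs_mul, abs_of_pos (inv_pos.2 hd'), inv_mul_le_iff₀ hd']
  refine (Finset.abs_sum_le_sum_abs _ _).trans ((Finset.sum_le_sum fun i _ => h i).trans_eq ?_)
  simp

include hA in
theorem integrable_reTr_cfc {f : Ω → Matrix (Fin d) (Fin d) ℂ} (hf : IsSuitable A f)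
    {φ : ℝ → ℝ} (hφ : Continuous φ) {C D : ℝ} (hC : ∀ x, |φ x| ≤ C * |x| + D) (hC0 : 0 ≤ C)
    (hd : 0 < d) :
    Integrable (fun z => (d : ℝ)⁻¹ * reTr d (cfc φ (f z))) μ := by
  have hf' := isSuitable_iff.1 hf
  refine Integrable.mono' (g := fun z => C * ‖f z‖ + D)
    (((hf'.2.integrable hA).norm.const_mul C).add (integrable_const D)) ?_
    (Eventually.of_forall fun z => ?_)
  · exact (((reTr d).continuous.comp_stronglyMeasurable
      (stronglyMeasurable_cfc (hf'.2.stronglyMeasurable hA) hf'.1 hφ)).const_mul _).aestronglyMeasurable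
  · rw [Real.norm_eq_abs]
    refine abs_reTr_cfc_le hd (hf'.1 z) fun i => (hC _).trans ?_
    gcongr
    exact abs_eigenvalues_le _ _

theorem abs_min_mul_truncExp_le {k θ : ℝ} (hθ : 0 ≤ θ) (x : ℝ) :
    |min x k * truncExp k θ x| ≤ Real.exp (θ * k) * |x| + Real.exp (θ * k) * |k| := by
  rw [abs_mul, abs_of_pos (truncExp_pos k θ x), ← mul_add, mul_comm]
  exact mul_le_mul (truncExp_le k hθ x) (abs_min_le x k) (abs_nonneg _) (Real.exp_pos _).le

theorem continuous_min_mul_truncExp (k θ : ℝ) :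
    Continuous fun x => min x k * truncExp k θ x :=
  (by fun_prop : Continuous fun x : ℝ => min x k).mul (continuous_truncExp k θ)

include hA in
theorem integrable_truncMGF {f : Ω → Matrix (Fin d) (Fin d) ℂ} (hf : IsSuitable A f)
    (hd : 0 < d) (k : ℝ) {θ : ℝ} (hθ : 0 ≤ θ) :
    Integrable (fun z => (d : ℝ)⁻¹ * reTr d (cfc (truncExp k θ) (f z))) μ :=
  integrable_reTr_cfc hA hf (continuous_truncExp k θ) (C := 0) (D := Real.exp (θ * k))
    (fun x => by
      rw [zero_mul, zero_add, abs_of_pos (truncExp_pos k θ x)]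
      exact truncExp_le k hθ x) le_rfl hd

include hA in
theorem integrable_truncMGF' {f : Ω → Matrix (Fin d) (Fin d) ℂ} (hf : IsSuitable A f)
    (hd : 0 < d) (k : ℝ) {θ : ℝ} (hθ : 0 ≤ θ) :
    Integrable (fun z => (d : ℝ)⁻¹ * reTr d (cfc (fun x => min x k * truncExp k θ x) (f z))) μ :=
  integrable_reTr_cfc hA hf (continuous_min_mul_truncExp k θ)
    (abs_min_mul_truncExp_le hθ) (Real.exp_pos _).le hd

include hA in
-- For `θ` in a bounded positive range the truncated exponential is bounded, so the derivative is
-- dominated by an affine function of `‖f‖`, which is integrable.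
theorem hasDerivAt_truncMGF {f : Ω → Matrix (Fin d) (Fin d) ℂ} (hf : IsSuitable A f)
    (hd : 0 < d) (k : ℝ) {θ : ℝ} (hθ : 0 < θ) :
    HasDerivAt (truncMGF μ f k) (truncMGF' μ f k θ) θ := by
  have hf' := isSuitable_iff.1 hf
  have hs : Set.Ioo 0 (θ + 1) ∈ 𝓝 θ := Ioo_mem_nhds hθ (by linarith)
  set C := Real.exp ((θ + 1) * |k|)
  have hC : ∀ u ∈ Set.Ioo 0 (θ + 1), Real.exp (u * k) ≤ C := fun u hu =>
    Real.exp_le_exp.2 ((mul_le_mul_of_nonneg_left (le_abs_self k) hu.1.le).trans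
      (mul_le_mul_of_nonneg_right hu.2.le (abs_nonneg k)))
  refine (hasDerivAt_integral_of_dominated_loc_of_deriv_le (𝕜 := ℝ) (μ := μ)
    (F := fun θ z => (d : ℝ)⁻¹ * reTr d (cfc (truncExp k θ) (f z)))
    (F' := fun θ z => (d : ℝ)⁻¹ * reTr d (cfc (fun x => min x k * truncExp k θ x) (f z)))
    (bound := fun z => C * ‖f z‖ + C * |k|) hs ?_ (integrable_truncMGF hA hf hd k hθ.le)
    (integrable_truncMGF' hA hf hd k hθ.le).aestronglyMeasurable ?_ ?_ ?_).2
  · filter_upwards [hs] with u hu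
    exact (integrable_truncMGF hA hf hd k hu.1.le).aestronglyMeasurable
  · refine Eventually.of_forall fun z u hu => ?_
    rw [Real.norm_eq_abs]
    refine abs_reTr_cfc_le hd (hf'.1 z) fun i => (abs_min_mul_truncExp_le hu.1.le _).trans ?_
    have h1 := abs_eigenvalues_le (hf'.1 z) i
    have h2 := hC u hu
    gcongr
  · exact ((hf'.2.integrable hA).norm.const_mul C).add (integrable_const _)
  · refine Eventually.of_forall fun z u _ => ?_
    simp only [reTr_cfc (hf'.1 z)]
    refine HasDerivAt.const_mul _ (HasDerivAt.fun_sum fun i _ => ?_)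
    have := ((hasDerivAt_id u).mul_const (min ((hf'.1 z).eigenvalues i) k)).exp
    simp only [id, one_mul] at this
    rw [mul_comm] at this
    exact this

include hA in
-- Continuity at `0` is one-sided: for negative `θ` the truncated exponential is unbounded.
theorem continuousOn_truncMGF {f : Ω → Matrix (Fin d) (Fin d) ℂ} (hf : IsSuitable A f)
    (hd : 0 < d) (k : ℝ) : ContinuousOn (truncMGF μ f k) (Set.Ici 0) := by
  have hf' := isSuitable_iff.1 hf
  intro θ hθ
  rcases (Set.mem_Ici.1 hθ).eq_or_lt with h0 | h0
  · subst h0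
    refine continuousWithinAt_of_dominated (bound := fun _ => Real.exp |k|) ?_ ?_
      (integrable_const _) ?_
    · filter_upwards [self_mem_nhdsWithin] with u hu
      exact (integrable_truncMGF hA hf hd k hu).aestronglyMeasurable
    · have h1 : ∀ᶠ u in 𝓝[Set.Ici 0] (0 : ℝ), u < 1 :=
        nhdsWithin_le_nhds (gt_mem_nhds one_pos)
      filter_upwards [self_mem_nhdsWithin, h1] with u hu hu1
      refine Eventually.of_forall fun z => ?_
      rw [Real.norm_eq_abs]
      refine abs_reTr_cfc_le hd (hf'.1 z) fun i => ?_
      rw [abs_of_pos (truncExp_pos _ _ _)]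
      refine (truncExp_le k hu _).trans (Real.exp_le_exp.2 ?_)
      calc u * k ≤ u * |k| := mul_le_mul_of_nonneg_left (le_abs_self k) hu
        _ ≤ 1 * |k| := mul_le_mul_of_nonneg_right hu1.le (abs_nonneg k)
        _ = |k| := one_mul _
    · refine Eventually.of_forall fun z => ?_
      simp only [reTr_cfc (hf'.1 z)]
      unfold truncExp
      exact (continuous_const.mul
        (continuous_finsetSum _ fun i _ => by fun_prop)).continuousWithinAt
  · exact (hasDerivAt_truncMGF hA hf hd k h0).continuousAt.continuousWithinAt

theorem truncMGF_zero {f : Ω → Matrix (Fin d) (Fin d) ℂ} (hf : ∀ z, (f z).IsHermitian)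
    (hd : 0 < d) (k : ℝ) : truncMGF μ f k 0 = 1 := by
  have hd' : (d : ℝ) ≠ 0 := by exact_mod_cast hd.ne'
  have : ∀ z, (d : ℝ)⁻¹ * reTr d (cfc (truncExp k 0) (f z)) = 1 := fun z => by
    rw [reTr_cfc (hf z)]
    simp [truncExp, hd']
  simp [truncMGF, this]

include hA in
theorem truncMGF_pos {f : Ω → Matrix (Fin d) (Fin d) ℂ} (hf : IsSuitable A f)
    (hd : 0 < d) (k : ℝ) {θ : ℝ} (hθ : 0 ≤ θ) : 0 < truncMGF μ f k θ := by
  have hf' := isSuitable_iff.1 hf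
  have hpos : ∀ z, 0 < (d : ℝ)⁻¹ * reTr d (cfc (truncExp k θ) (f z)) := fun z => by
    rw [reTr_cfc (hf'.1 z)]
    have : Nonempty (Fin d) := ⟨⟨0, hd⟩⟩
    have hd' : (0 : ℝ) < d := by exact_mod_cast hd
    exact mul_pos (inv_pos.2 hd')
      (Finset.sum_pos (fun i _ => truncExp_pos _ _ _) Finset.univ_nonempty)
  rw [truncMGF, integral_pos_iff_support_of_nonneg (fun z => (hpos z).le)
    (integrable_truncMGF hA hf hd k hθ)]
  have : Function.support (fun z => (d : ℝ)⁻¹ * reTr d (cfc (truncExp k θ) (f z))) = Set.univ :=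
    Set.eq_univ_of_forall fun z => (hpos z).ne'
  rw [this]
  simp

include hA in
-- Since `min x k ≤ x` and the exponential is positive, the derivative is at most the covariance,
-- which involves `f` itself and not its truncation.
theorem truncMGF'_le {f : Ω → Matrix (Fin d) (Fin d) ℂ} (hf : IsSuitable A f)
    (hd : 0 < d) (k : ℝ) {θ : ℝ} (hθ : 0 ≤ θ) :
    truncMGF' μ f k θ ≤ (d : ℝ)⁻¹ * ∫ z, reTr d (f z * cfc (truncExp k θ) (f z)) ∂μ := by
  have hf' := isSuitable_iff.1 hf
  have hK := (isPosTest_truncExp hA hf k hθ).toIsBoundedMeas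
  rw [truncMGF', ← integral_const_mul]
  refine integral_mono (integrable_truncMGF' hA hf hd k hθ)
    ((hK.integrable_reTr_mul (hf'.2.integrable hA)).const_mul _) fun z => ?_
  refine mul_le_mul_of_nonneg_left ?_ (by positivity)
  have e : f z * cfc (truncExp k θ) (f z) = cfc (fun x => x * truncExp k θ x) (f z) := by
    rw [cfc_mul (fun x => x) (truncExp k θ) (f z) continuousOn_id
      (continuous_truncExp k θ).continuousOn]
    congr 1
    exact (cfc_id' ℝ (f z) (hf'.1 z).isSelfAdjoint).symm
  rw [e]
  exact reTr_cfc_mono (hf'.1 z) fun x =>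
    mul_le_mul_of_nonneg_right (min_le_left x k) (truncExp_pos k θ x).le

variable (hstat : P.IsStationary μ) (hrev : P.IsReversible μ) (herg : P.IsErgodic μ)

include hA hstat hrev herg in
theorem truncMGF'_le_of_forall {c : ℝ} (hc : 0 < c) (hBE : BakryEmery P μ A d c)
    {f : Ω → Matrix (Fin d) (Fin d) ℂ} (hf : IsSuitable A f) (hd : 0 < d)
    (h0 : ∫ z, f z ∂μ = 0) (k : ℝ) {θ : ℝ} (hθ : 0 ≤ θ) {R : ℝ}
    (hR : ∀ t : ℝ≥0, ∫ p, (d : ℝ)⁻¹ * reTr d (P.gamma f f p.1 * cfc (truncExp k θ) (f p.2))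
      ∂(jointLaw P μ t) ≤ R) :
    truncMGF' μ f k θ ≤ c * θ * R := by
  have hf' := isSuitable_iff.1 hf
  have hd' : (0 : ℝ) < d := by exact_mod_cast hd
  have hK := (isPosTest_truncExp hA hf k hθ).toIsBoundedMeas
  have h1 := integral_reTr_mul_truncExp_le hA hstat hrev herg hc hBE hf h0 k hθ (R := d * R)
    fun t => by
      have := hR t
      rwa [integral_const_mul, inv_mul_le_iff₀ hd',
        ← integral_reTr_mul_act t ((hf'.2.gamma hA hf'.2).integrable hA) hK] at this
  refine (truncMGF'_le hA hf hd k hθ).trans ?_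
  rw [inv_mul_le_iff₀ hd']
  linarith

include hA in
theorem isHermitian_gamma {f : Ω → Matrix (Fin d) (Fin d) ℂ} (hf : IsSuitable A f) (z : Ω) :
    (P.gamma f f z).IsHermitian := by
  have hf' := isSuitable_iff.1 hf
  have hcl : IsClosed {X : Matrix (Fin d) (Fin d) ℂ | X.IsHermitian} :=
    isClosed_eq continuous_star continuous_id
  refine hcl.mem_of_tendsto (hf'.2.tendsto_gamma hA z) (Eventually.of_forall fun t => ?_)
  have h1 := (starL' ℝ : Matrix (Fin d) (Fin d) ℂ ≃L[ℝ] _).integral_comp_comm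
    (μ := P.kernel t z) fun y => (f y - f z) * (f y - f z)
  have h2 : IsSelfAdjoint (∫ y, (f y - f z) * (f y - f z) ∂(P.kernel t z)) := by
    refine Eq.trans h1.symm (integral_congr_ae (Eventually.of_forall fun y => ?_))
    have hs : (f y - f z)ᴴ = f y - f z := ((hf'.1 y).sub (hf'.1 z)).eq
    change ((f y - f z) * (f y - f z))ᴴ = _
    rw [Matrix.conjTranspose_mul, hs]
  exact ((IsSelfAdjoint.all (1 / 2 : ℝ)).smul ((IsSelfAdjoint.all ((t : ℝ)⁻¹)).smul h2))

include hA in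
theorem reTr_gamma_nonneg {f : Ω → Matrix (Fin d) (Fin d) ℂ} (hf : IsSuitable A f) (z : Ω) :
    0 ≤ reTr d (P.gamma f f z) := by
  have hf' := isSuitable_iff.1 hf
  refine ge_of_tendsto' (((reTr d).continuous.tendsto _).comp (hf'.2.tendsto_gamma hA z))
    fun t => ?_
  have i1 := hf'.2.integrable_kernel hA t z
  have i2 := (hf'.2.mul hf'.2).integrable_kernel hA t z
  have hi : Integrable (fun y => (f y - f z) * (f y - f z)) (P.kernel t z) := by
    have : (fun y => (f y - f z) * (f y - f z))
        = fun y => (f * f) y - f y * f z - (f z * f y - f z * f z) := by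
      ext1 y
      simp only [Pi.mul_apply]
      noncomm_ring
    rw [this]
    exact (i2.sub (i1.mul_const _)).sub ((i1.const_mul _).sub (integrable_const _))
  rw [Function.comp_apply, map_smul, map_smul, ← (reTr d).integral_comp_comm hi]
  refine smul_nonneg (by norm_num) (smul_nonneg (by positivity) (integral_nonneg fun y => ?_))
  have h1 := reTr_mul_self_mul_cfc_left (hf'.1 z) (hf'.1 z) ((hf'.1 y).sub (hf'.1 z)) fun _ => 1
  rw [cfc_const_one_eq _ (hf'.1 z), mul_one] at h1
  change 0 ≤ reTr d ((f y - f z) * (f y - f z))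
  rw [h1]
  positivity

include hA in
theorem integrable_snd_truncMGF {f : Ω → Matrix (Fin d) (Fin d) ℂ} (hstat : P.IsStationary μ)
    {φ : ℝ → ℝ} (h : Integrable (fun z => (d : ℝ)⁻¹ * reTr d (cfc φ (f z))) μ) (t : ℝ≥0) :
    Integrable (fun p : Ω × Ω => (d : ℝ)⁻¹ * reTr d (cfc φ (f p.2))) (jointLaw P μ t) :=
  (measurePreserving_snd_jointLaw hstat t).integrable_comp_of_integrable h

theorem integral_snd_jointLaw (hstat : P.IsStationary μ) (t : ℝ≥0) {g : Ω → ℝ}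
    (hg : AEStronglyMeasurable g μ) : ∫ p, g p.2 ∂(jointLaw P μ t) = ∫ z, g z ∂μ := by
  have := measurePreserving_snd_jointLaw hstat t
  conv_rhs => rw [← this.map_eq]
  rw [integral_map this.measurable.aemeasurable (by rwa [this.map_eq])]

theorem integral_fst_jointLaw (t : ℝ≥0) {g : Ω → ℝ}
    (hg : AEStronglyMeasurable g μ) : ∫ p, g p.1 ∂(jointLaw P μ t) = ∫ z, g z ∂μ := by
  have := measurePreserving_fst_jointLaw (P := P) (μ := μ) t
  conv_rhs => rw [← this.map_eq]
  rw [integral_map this.measurable.aemeasurable (by rwa [this.map_eq])]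

include hA hstat hrev herg in
-- The almost sure bound on `Γ(f)` at `Z_0` gives `R = v m(θ)`, independently of the time lag,
-- because `Z_t` has law `μ`.
theorem truncMGF_le_of_varProxy {c : ℝ} (hc : 0 < c) (hBE : BakryEmery P μ A d c)
    {f : Ω → Matrix (Fin d) (Fin d) ℂ} (hf : IsSuitable A f) (hd : 0 < d)
    (h0 : ∫ z, f z ∂μ = 0) (k : ℝ) {θ : ℝ} (hθ : 0 ≤ θ) {v : ℝ}
    (hv : ∀ᵐ z ∂μ, ‖P.gamma f f z‖ ≤ v) :
    truncMGF μ f k θ ≤ Real.exp (c * v / 2 * θ ^ 2) := by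
  have hf' := isSuitable_iff.1 hf
  refine le_exp_of_deriv_le (continuousOn_truncMGF hA hf hd k)
    (fun θ hθ => hasDerivAt_truncMGF hA hf hd k hθ) (fun θ hθ => ?_)
    (truncMGF_zero hf'.1 hd k) hθ
  have hK := (isPosTest_truncExp hA hf k hθ.le).toIsBoundedMeas
  refine (truncMGF'_le_of_forall hA hstat hrev herg hc hBE hf hd h0 k hθ.le
    (R := v * truncMGF μ f k θ) fun t => ?_).trans_eq (by ring)
  have hm := integrable_truncMGF hA hf hd k hθ.le
  rw [truncMGF, ← integral_snd_jointLaw hstat t hm.aestronglyMeasurable, ← integral_const_mul]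
  refine integral_mono_ae ?_ ((integrable_snd_truncMGF hA hstat hm t).const_mul v) ?_
  · exact ((hK.comp measurable_snd).integrable_reTr_mul
      ((measurePreserving_fst_jointLaw t).integrable_comp_of_integrable
        ((hf'.2.gamma hA hf'.2).integrable hA))).const_mul _
  · filter_upwards [(measurePreserving_fst_jointLaw (P := P) (μ := μ)
      t).quasiMeasurePreserving.ae hv] with p hp
    have h1 := reTr_mul_cfc_le (isHermitian_gamma (P := P) hA hf p.1) (hf'.1 p.2)
      (φ := truncExp k θ) fun x => (truncExp_pos k θ x).le
    have h2 : 0 ≤ reTr d (cfc (truncExp k θ) (f p.2)) := by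
      rw [reTr_cfc (hf'.1 p.2)]
      exact Finset.sum_nonneg fun i _ => (truncExp_pos _ _ _).le
    have h3 := h1.trans (mul_le_mul_of_nonneg_right hp h2)
    calc (d : ℝ)⁻¹ * reTr d (P.gamma f f p.1 * cfc (truncExp k θ) (f p.2))
        ≤ (d : ℝ)⁻¹ * (v * reTr d (cfc (truncExp k θ) (f p.2))) :=
          mul_le_mul_of_nonneg_left h3 (by positivity)
      _ = _ := by ring

include hA hstat hrev herg in
-- The Gibbs variational inequality splits `tr[β Γ(f)(Z_0) φ(f)(Z_t)]` into a term in `Z_0` and a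
-- term in `Z_t`. Only the marginals then matter, so the bound does not depend on the time lag. For
-- `L = log m` it reads `L' ≤ (c/β) θ (θ L' - L + log Q)`.
theorem log_truncMGF_le_of_expMean {c : ℝ} (hc : 0 < c) (hBE : BakryEmery P μ A d c)
    {f : Ω → Matrix (Fin d) (Fin d) ℂ} (hf : IsSuitable A f) (hd : 0 < d)
    (h0 : ∫ z, f z ∂μ = 0) (k : ℝ) {θ : ℝ} (hθ : 0 ≤ θ) {β Q : ℝ} (hβ : 0 < β) (hQ : 1 ≤ Q)
    (hQi : Integrable (fun z => (d : ℝ)⁻¹ * reTr d (NormedSpace.exp (β • P.gamma f f z))) μ)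
    (hQe : ∫ z, (d : ℝ)⁻¹ * reTr d (NormedSpace.exp (β • P.gamma f f z)) ∂μ = Q)
    (hθ1 : √(c / β) * θ < 1) :
    Real.log (truncMGF μ f k θ) ≤ Real.log Q * (√(c / β) * θ) ^ 2 / (2 * (1 - √(c / β) * θ)) := by
  have hf' := isSuitable_iff.1 hf
  have hκ : 0 ≤ c / β := (div_pos hc hβ).le
  have hsq : c / β * θ ^ 2 = (√(c / β) * θ) ^ 2 := by rw [mul_pow, Real.sq_sqrt hκ]
  have hs0 : 0 ≤ √(c / β) * θ := mul_nonneg (Real.sqrt_nonneg _) hθ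
  refine le_trans ?_ (one_sub_sqrt_le hs0 hθ1 (Real.log_nonneg hQ))
  rw [← hsq]
  have hpos : ∀ θ, 0 ≤ θ → 0 < truncMGF μ f k θ := fun θ hθ => truncMGF_pos hA hf hd k hθ
  refine le_mul_one_sub_sqrt_of_deriv_le (L := fun θ => Real.log (truncMGF μ f k θ))
    (L' := fun θ => truncMGF' μ f k θ / truncMGF μ f k θ) hκ
    ((continuousOn_truncMGF hA hf hd k).log fun x hx => (hpos x hx).ne')
    (fun θ hθ => (hasDerivAt_truncMGF hA hf hd k hθ).log (hpos θ hθ.le).ne') (fun θ hθ => ?_)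
    (by rw [truncMGF_zero hf'.1 hd k, Real.log_one]) hθ ?_
  swap
  · rw [hsq]
    nlinarith
  set m := truncMGF μ f k θ with hm
  have hm0 : 0 < m := hpos θ hθ.le
  have hQ0 : 0 < Q := one_pos.trans_le hQ
  -- The shift that minimizes `-(b + 1) m + e^b Q`, the part of the integrated bound that depends on
  -- `b`.
  set b := Real.log m - Real.log Q with hb
  have heb : Real.exp b * Q = m := by
    rw [hb, Real.exp_sub, Real.exp_log hm0, Real.exp_log hQ0, div_mul_cancel₀ _ hQ0.ne']
  have hK := (isPosTest_truncExp hA hf k hθ.le).toIsBoundedMeas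
  have key := truncMGF'_le_of_forall hA hstat hrev herg hc hBE hf hd h0 k hθ.le
    (R := β⁻¹ * (θ * truncMGF' μ f k θ - m * Real.log m + m * Real.log Q)) fun t => ?_
  · rw [div_le_iff₀ hm0]
    refine key.trans_eq ?_
    field_simp
  have im := integrable_truncMGF hA hf hd k hθ.le
  have im' := integrable_truncMGF' hA hf hd k hθ.le
  have i1 := integrable_snd_truncMGF hA hstat im t
  have i2 := integrable_snd_truncMGF hA hstat im' t
  have i3 : Integrable (fun p : Ω × Ω => (d : ℝ)⁻¹ * reTr d (NormedSpace.exp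
      (β • P.gamma f f p.1))) (jointLaw P μ t) :=
    (measurePreserving_fst_jointLaw t).integrable_comp_of_integrable hQi
  have hle : ∫ p, (d : ℝ)⁻¹ * reTr d (P.gamma f f p.1 * cfc (truncExp k θ) (f p.2))
      ∂(jointLaw P μ t) ≤ ∫ p, β⁻¹ * (θ * ((d : ℝ)⁻¹ * reTr d
        (cfc (fun x => min x k * truncExp k θ x) (f p.2)))
        - (b + 1) * ((d : ℝ)⁻¹ * reTr d (cfc (truncExp k θ) (f p.2)))
        + Real.exp b * ((d : ℝ)⁻¹ * reTr d (NormedSpace.exp (β • P.gamma f f p.1))))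
        ∂(jointLaw P μ t) := by
    refine integral_mono ?_ ?_ fun p => ?_
    · exact ((hK.comp measurable_snd).integrable_reTr_mul
        ((measurePreserving_fst_jointLaw t).integrable_comp_of_integrable
          ((hf'.2.gamma hA hf'.2).integrable hA))).const_mul _
    · exact (((i2.const_mul θ).sub (i1.const_mul _)).add (i3.const_mul _)).const_mul _
    · have hG : (β • P.gamma f f p.1).IsHermitian :=
        (IsSelfAdjoint.all β).smul (isHermitian_gamma (P := P) hA hf p.1)
      have hB := hf'.1 p.2
      have h1 := reTr_mul_cfc_exp_le hG hB fun x => θ * min x k - b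
      have e1 : cfc (fun x => Real.exp (θ * min x k - b)) (f p.2)
          = Real.exp (-b) • cfc (truncExp k θ) (f p.2) := by
        rw [← cfc_const_mul _ _ _ (continuous_truncExp k θ).continuousOn]
        congr 1
        ext x
        rw [truncExp, ← Real.exp_add]
        ring_nf
      have e2 : reTr d (cfc (fun x => (θ * min x k - b) * Real.exp (θ * min x k - b)
          - Real.exp (θ * min x k - b)) (f p.2))
          = Real.exp (-b) * (θ * reTr d (cfc (fun x => min x k * truncExp k θ x) (f p.2))
            - (b + 1) * reTr d (cfc (truncExp k θ) (f p.2))) := by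
        rw [reTr_cfc hB, reTr_cfc hB, reTr_cfc hB, Finset.mul_sum, Finset.mul_sum,
          ← Finset.sum_sub_distrib, Finset.mul_sum]
        refine Finset.sum_congr rfl fun i _ => ?_
        rw [truncExp, sub_eq_add_neg (θ * _) b, Real.exp_add]
        ring
      rw [e1, e2, CFC.real_exp_eq_normedSpace_exp hG.isSelfAdjoint, mul_smul_comm, map_smul,
        smul_mul_assoc, map_smul, smul_eq_mul, smul_eq_mul] at h1
      have h2 := mul_le_mul_of_nonneg_left h1
        (mul_nonneg (mul_nonneg (inv_nonneg.2 hβ.le) (inv_nonneg.2 (Nat.cast_nonneg (α := ℝ) d)))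
          (Real.exp_pos b).le)
      have e3 : Real.exp b * Real.exp (-b) = 1 := by rw [← Real.exp_add]; simp
      calc _ = β⁻¹ * (d : ℝ)⁻¹ * Real.exp b * (Real.exp (-b)
            * (β * reTr d (P.gamma f f p.1 * cfc (truncExp k θ) (f p.2)))) := by
            rw [show β⁻¹ * (d : ℝ)⁻¹ * Real.exp b * (Real.exp (-b)
              * (β * reTr d (P.gamma f f p.1 * cfc (truncExp k θ) (f p.2))))
              = (β⁻¹ * β) * (Real.exp b * Real.exp (-b)) * ((d : ℝ)⁻¹
                * reTr d (P.gamma f f p.1 * cfc (truncExp k θ) (f p.2))) by ring, e3,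
              inv_mul_cancel₀ hβ.ne']
            ring
        _ ≤ _ := h2
        _ = β⁻¹ * (d : ℝ)⁻¹ * ((Real.exp b * Real.exp (-b))
            * (θ * reTr d (cfc (fun x => min x k * truncExp k θ x) (f p.2))
            - (b + 1) * reTr d (cfc (truncExp k θ) (f p.2)))
            + Real.exp b * reTr d (NormedSpace.exp (β • P.gamma f f p.1))) := by ring
        _ = _ := by rw [e3]; ring
  refine hle.trans_eq ?_
  have j1 : Integrable (fun p : Ω × Ω => θ * ((d : ℝ)⁻¹ * reTr d
      (cfc (fun x => min x k * truncExp k θ x) (f p.2)))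
      - (b + 1) * ((d : ℝ)⁻¹ * reTr d (cfc (truncExp k θ) (f p.2)))) (jointLaw P μ t) :=
    (i2.const_mul θ).sub (i1.const_mul _)
  rw [integral_const_mul, integral_add j1 (i3.const_mul _),
    integral_sub (i2.const_mul θ) (i1.const_mul _), integral_const_mul θ,
    integral_const_mul (b + 1),
    integral_const_mul (Real.exp b),
    integral_snd_jointLaw hstat t (g := fun z => (d : ℝ)⁻¹ * reTr d
      (cfc (fun x => min x k * truncExp k θ x) (f z))) im'.aestronglyMeasurable,
    integral_snd_jointLaw hstat t (g := fun z => (d : ℝ)⁻¹ * reTr d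
      (cfc (truncExp k θ) (f z))) im.aestronglyMeasurable,
    integral_fst_jointLaw t (g := fun z => (d : ℝ)⁻¹ * reTr d (NormedSpace.exp
      (β • P.gamma f f z))) hQi.aestronglyMeasurable, hQe, heb]
  change β⁻¹ * (θ * truncMGF' μ f k θ - (b + 1) * m + m) = _
  rw [hb]
  ring

end Laplace

/-! ### Choice of the Laplace parameter. -/

section OptimalParameters

/-- The choice of the parameter in the Laplace transform argument for Bernstein tails. -/
theorem exists_bernstein_parameter {a s t : ℝ} (ha : 0 ≤ a) (hs : 0 < s) (ht : 0 < t) :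
    ∃ θ, 0 ≤ θ ∧ s * θ < 1 ∧
      -(θ * t) + a * θ ^ 2 / (2 * (1 - s * θ)) ≤ -t ^ 2 / (2 * a + 2 * t * s) := by
  rcases ha.eq_or_lt with rfl | ha
  · refine ⟨1 / (2 * s), by positivity, ?_, ?_⟩
    · field_simp
      norm_num
    · apply le_of_eq
      field_simp
      ring
  · have hD : 0 < a + s * t := by positivity
    have h1 : 1 - s * (t / (a + s * t)) = a / (a + s * t) := by
      field_simp
      ring
    refine ⟨t / (a + s * t), by positivity, ?_, ?_⟩
    · have : 0 < a / (a + s * t) := by positivity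
      linarith
    · rw [h1]
      have h2 : 2 * a + 2 * t * s = 2 * (a + s * t) := by ring
      rw [h2]
      apply le_of_eq
      field_simp
      ring

theorem le_sqrt_of_forall_le {x L v : ℝ} (hL : 0 ≤ L) (hv : 0 ≤ v)
    (h : ∀ θ, 0 < θ → x ≤ (L + v / 2 * θ ^ 2) / θ) : x ≤ √(2 * v * L) := by
  rcases le_or_gt x 0 with hx | hx
  · exact hx.trans (Real.sqrt_nonneg _)
  refine Real.le_sqrt_of_sq_le ?_
  rcases hv.eq_or_lt with rfl | hv
  · exfalso
    -- For `v = 0` the hypothesis is `x θ ≤ L`, which this `θ` violates.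
    have h1 := h ((L + 1) / x) (by positivity)
    rw [zero_div, zero_mul, add_zero, div_div_eq_mul_div, le_div_iff₀ (by positivity)] at h1
    nlinarith
  · have h1 := h (x / v) (by positivity)
    rw [le_div_iff₀ (by positivity)] at h1
    have h2 : v / 2 * (x / v) ^ 2 = x ^ 2 / (2 * v) := by field_simp
    have h3 : x * (x / v) = 2 * (x ^ 2 / (2 * v)) := by field_simp
    have h4 : x ^ 2 / (2 * v) ≤ L := by linarith
    rw [div_le_iff₀ (by positivity)] at h4
    linarith

end OptimalParameters

/-! ### Tail bounds and the expectation bound for a centered function. -/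

section Tails

variable {Ω : Type*} [MeasurableSpace Ω] {μ : Measure Ω} [IsProbabilityMeasure μ]
  {P : MarkovSemigroup Ω} {A : Subalgebra ℝ (Ω → ℝ)} {d : ℕ} (hA : P.IsSuitableAlgebra μ A)

include hA in
/-- The Laplace transform method for the largest eigenvalue. -/
theorem measure_le_lambdaMax_le {f : Ω → Matrix (Fin d) (Fin d) ℂ} (hf : IsSuitable A f)
    (hd : 0 < d) (t : ℝ) {θ : ℝ} (hθ : 0 ≤ θ) :
    μ {z | t ≤ lambdaMax (f z)}
      ≤ d * ENNReal.ofReal (Real.exp (-(θ * t)) * truncMGF μ f t θ) := by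
  have hd' : (0 : ℝ) < d := by exact_mod_cast hd
  have hm := integrable_truncMGF hA hf hd t hθ
  have hnn : ∀ z, 0 ≤ (d : ℝ)⁻¹ * reTr d (cfc (truncExp t θ) (f z)) := fun z => by
    rw [reTr_cfc (hf.isHermitian z)]
    exact mul_nonneg (inv_nonneg.2 hd'.le) (Finset.sum_nonneg fun i _ => (truncExp_pos _ _ _).le)
  have h1 := mul_meas_ge_le_integral_of_nonneg (Eventually.of_forall hnn) hm
    ((d : ℝ)⁻¹ * Real.exp (θ * t))
  have hsub : {z | t ≤ lambdaMax (f z)} ⊆ {z | (d : ℝ)⁻¹ * Real.exp (θ * t)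
      ≤ (d : ℝ)⁻¹ * reTr d (cfc (truncExp t θ) (f z))} := fun z hz => by
    refine mul_le_mul_of_nonneg_left ?_ (inv_nonneg.2 hd'.le)
    refine le_trans (le_of_eq ?_) (apply_lambdaMax_le_reTr_cfc hd (hf.isHermitian z)
      fun x => (truncExp_pos t θ x).le)
    -- The truncation level equals the tail level, so nothing is lost on this event.
    rw [truncExp, min_eq_right hz]
  have h2 : μ.real {z | t ≤ lambdaMax (f z)} ≤ d * (Real.exp (-(θ * t)) * truncMGF μ f t θ) := by
    have h3 := (mul_le_mul_of_nonneg_left (measureReal_mono (μ := μ) hsub)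
      (by positivity : 0 ≤ (d : ℝ)⁻¹ * Real.exp (θ * t))).trans h1
    rw [Real.exp_neg]
    have h4 : (d : ℝ)⁻¹ * Real.exp (θ * t) * μ.real {z | t ≤ lambdaMax (f z)}
        ≤ truncMGF μ f t θ := h3
    have hE := Real.exp_pos (θ * t)
    rw [← sub_nonneg] at h4 ⊢
    have h5 := mul_nonneg (mul_nonneg hd'.le (inv_nonneg.2 hE.le)) h4
    have h6 : d * (Real.exp (θ * t))⁻¹ * (truncMGF μ f t θ
        - (d : ℝ)⁻¹ * Real.exp (θ * t) * μ.real {z | t ≤ lambdaMax (f z)})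
        = d * ((Real.exp (θ * t))⁻¹ * truncMGF μ f t θ) - μ.real {z | t ≤ lambdaMax (f z)} := by
      field_simp
    rwa [h6] at h5
  rw [← ofReal_measureReal]
  refine (ENNReal.ofReal_le_ofReal h2).trans_eq ?_
  rw [ENNReal.ofReal_mul hd'.le, ENNReal.ofReal_natCast]

theorem le_natCast_mul_exp_zero (hd : 0 < d) (s : Set Ω) :
    μ s ≤ d * EReal.exp 0 := by
  rw [EReal.exp_zero, mul_one]
  exact prob_le_one.trans (by exact_mod_cast hd)

/-- `tr̄ exp X ≥ 1` for Hermitian `X` with nonnegative trace. -/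
theorem one_le_reTr_exp (hd : 0 < d) {X : Matrix (Fin d) (Fin d) ℂ} (hX : X.IsHermitian)
    (h0 : 0 ≤ reTr d X) : 1 ≤ (d : ℝ)⁻¹ * reTr d (NormedSpace.exp X) := by
  have hd' : (0 : ℝ) < d := by exact_mod_cast hd
  rw [inv_mul_eq_div, one_le_div hd', ← CFC.real_exp_eq_normedSpace_exp hX.isSelfAdjoint,
    reTr_cfc hX]
  have h1 : reTr d X = ∑ i, hX.eigenvalues i := by
    conv_lhs => rw [← cfc_id ℝ X hX.isSelfAdjoint]
    rw [reTr_cfc hX]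
    rfl
  rw [h1] at h0
  calc (d : ℝ) ≤ ∑ i, (hX.eigenvalues i + 1) := by
        rw [Finset.sum_add_distrib]
        simpa using h0
    _ ≤ _ := Finset.sum_le_sum fun i _ => Real.add_one_le_exp _

include hA in
theorem stronglyMeasurable_exp_gamma {f : Ω → Matrix (Fin d) (Fin d) ℂ} (hf : IsSuitable A f)
    (β : ℝ) : StronglyMeasurable fun z =>
      (d : ℝ)⁻¹ * reTr d (NormedSpace.exp (β • P.gamma f f z)) := by
  have hf' := isSuitable_iff.1 hf
  have hG : ∀ z, (β • P.gamma f f z).IsHermitian := fun z =>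
    (IsSelfAdjoint.all β).smul (isHermitian_gamma (P := P) hA hf z)
  have h1 := stronglyMeasurable_cfc
    (((hf'.2.gamma hA hf'.2).stronglyMeasurable hA).const_smul β) hG Real.continuous_exp
  have h2 := ((reTr d).continuous.comp_stronglyMeasurable h1).const_mul (d : ℝ)⁻¹
  convert h2 using 3 with z
  exact congrArg _ (CFC.real_exp_eq_normedSpace_exp (hG z).isSelfAdjoint).symm

variable (hstat : P.IsStationary μ) (hrev : P.IsReversible μ) (herg : P.IsErgodic μ)

include hA hstat hrev herg in
theorem measure_le_expTail {c : ℝ} (hc : 0 < c) (hBE : BakryEmery P μ A d c)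
    {f : Ω → Matrix (Fin d) (Fin d) ℂ} (hf : IsSuitable A f) (hd : 0 < d)
    (h0 : ∫ z, f z ∂μ = 0) {t : ℝ} (ht : 0 ≤ t) :
    μ {z | t ≤ lambdaMax (f z)} ≤ expTail P μ f c t := by
  rw [expTail, ENNReal.mul_iInf_of_ne (by exact_mod_cast hd.ne') (ENNReal.natCast_ne_top d)]
  refine le_iInf fun β => ?_
  rw [ENNReal.mul_iInf_of_ne (by exact_mod_cast hd.ne') (ENNReal.natCast_ne_top d)]
  refine le_iInf fun hβ => ?_
  rcases ht.eq_or_lt with rfl | ht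
  · simpa using le_natCast_mul_exp_zero (μ := μ) hd {z | 0 ≤ lambdaMax (f z)}
  have hs : 0 < √(c / β) := Real.sqrt_pos.2 (div_pos hc hβ)
  have hn : ∀ z, 1 ≤ (d : ℝ)⁻¹ * reTr d (NormedSpace.exp (β • P.gamma f f z)) := fun z => by
    refine one_le_reTr_exp hd ((IsSelfAdjoint.all β).smul
      (isHermitian_gamma (P := P) hA hf z)) ?_
    rw [map_smul]
    exact mul_nonneg hβ.le (reTr_gamma_nonneg hA hf z)
  have hmeas := stronglyMeasurable_exp_gamma (P := P) hA hf β
  have hlint : ∫⁻ z, ENNReal.ofReal (normTrace (NormedSpace.exp (β • P.gamma f f z))) ∂μ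
      = ∫⁻ z, ENNReal.ofReal ((d : ℝ)⁻¹ * reTr d (NormedSpace.exp (β • P.gamma f f z))) ∂μ :=
    rfl
  rw [expMean, hlint]
  by_cases hI : Integrable
      (fun z => (d : ℝ)⁻¹ * reTr d (NormedSpace.exp (β • P.gamma f f z))) μ
  · set Q := ∫ z, (d : ℝ)⁻¹ * reTr d (NormedSpace.exp (β • P.gamma f f z)) ∂μ with hQdef
    have hQ : 1 ≤ Q := by
      simpa using integral_mono (integrable_const (μ := μ) (1 : ℝ)) hI hn
    rw [← ofReal_integral_eq_lintegral_ofReal hI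
      (Eventually.of_forall fun z => zero_le_one.trans (hn z)), ← hQdef,
      ENNReal.log_ofReal_of_pos (by linarith)]
    obtain ⟨θ, hθ, hθ1, hb⟩ := exists_bernstein_parameter
      (a := c * (β⁻¹ * Real.log Q)) (mul_nonneg hc.le (mul_nonneg (inv_nonneg.2 hβ.le)
        (Real.log_nonneg hQ))) hs ht
    have h1 := log_truncMGF_le_of_expMean hA hstat hrev herg hc hBE hf hd h0 t hθ hβ hQ hI
      hQdef.symm hθ1
    refine (measure_le_lambdaMax_le hA hf hd t hθ).trans ?_
    rw [← EReal.coe_mul, ← EReal.coe_mul, ← EReal.coe_add, ← EReal.coe_div, EReal.exp_coe]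
    gcongr
    rw [← Real.exp_log (truncMGF_pos hA hf hd t hθ), ← Real.exp_add, Real.exp_le_exp]
    refine le_trans ?_ (hb.trans_eq (by ring_nf))
    refine add_le_add_right (h1.trans_eq ?_) _
    rw [mul_pow, Real.sq_sqrt (div_pos hc hβ).le]
    ring
  -- Here `r_f(β) = +∞`; the quotient is `0` and the bound becomes the trivial `μ s ≤ d`.
  · have htop : ∫⁻ z, ENNReal.ofReal ((d : ℝ)⁻¹ * reTr d (NormedSpace.exp
        (β • P.gamma f f z))) ∂μ = ∞ := by
      by_contra hne
      exact hI ⟨hmeas.aestronglyMeasurable,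
        (hasFiniteIntegral_iff_ofReal (Eventually.of_forall fun z =>
          zero_le_one.trans (hn z))).2 (lt_top_iff_ne_top.2 hne)⟩
    rw [htop, ENNReal.log_top, EReal.coe_mul_top_of_pos (inv_pos.2 hβ),
      EReal.coe_mul_top_of_pos (by positivity), EReal.top_add_coe, EReal.div_top]
    exact le_natCast_mul_exp_zero hd _

theorem ae_norm_gamma_le {f : Ω → Matrix (Fin d) (Fin d) ℂ}
    (hv : varProxy P μ f < ∞) : ∀ᵐ z ∂μ, ‖P.gamma f f z‖ ≤ (varProxy P μ f).toReal := by
  have h := ae_le_eLpNormEssSup (f := P.gamma f f) (μ := μ)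
  filter_upwards [h] with z hz
  rw [varProxy, eLpNorm_exponent_top] at hv ⊢
  have := ENNReal.toReal_mono hv.ne hz
  simpa using this

include hA hstat hrev herg in
theorem measure_le_gaussTail {c : ℝ} (hc : 0 < c) (hBE : BakryEmery P μ A d c)
    {f : Ω → Matrix (Fin d) (Fin d) ℂ} (hf : IsSuitable A f) (hd : 0 < d)
    (h0 : ∫ z, f z ∂μ = 0) (hv : varProxy P μ f < ∞) {t : ℝ} (ht : 0 ≤ t) :
    μ {z | t ≤ lambdaMax (f z)} ≤ gaussTail P μ f c t := by
  have hae := ae_norm_gamma_le hv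
  rw [gaussTail]
  rcases ht.eq_or_lt with rfl | ht
  · simpa using le_natCast_mul_exp_zero (μ := μ) hd {z | 0 ≤ lambdaMax (f z)}
  obtain ⟨v, hveq⟩ : ∃ v : ℝ≥0, varProxy P μ f = v := ⟨_, (ENNReal.coe_toNNReal hv.ne).symm⟩
  rw [hveq] at hae ⊢
  rw [ENNReal.coe_toReal] at hae
  have key : ∀ θ, 0 ≤ θ → μ {z | t ≤ lambdaMax (f z)}
      ≤ d * ENNReal.ofReal (Real.exp (-(θ * t) + c * v / 2 * θ ^ 2)) := fun θ hθ => by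
    refine (measure_le_lambdaMax_le hA hf hd t hθ).trans ?_
    rw [Real.exp_add]
    gcongr
    exact truncMGF_le_of_varProxy hA hstat hrev herg hc hBE hf hd h0 t hθ hae
  rcases eq_or_ne v 0 with rfl | hv0
  -- With `v = 0` no finite `θ` is optimal; letting `θ → ∞` shows that the event is null.
  · have hlim : Tendsto (fun θ : ℝ => (d : ℝ≥0∞) * ENNReal.ofReal (Real.exp (-(θ * t)))) atTop
        (𝓝 (d * ENNReal.ofReal 0)) := by
      refine ENNReal.Tendsto.const_mul ?_ (Or.inr (ENNReal.natCast_ne_top d))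
      refine ENNReal.tendsto_ofReal (Real.tendsto_exp_neg_atTop_nhds_zero.comp ?_)
      exact tendsto_id.atTop_mul_const ht
    rw [ENNReal.ofReal_zero, mul_zero] at hlim
    refine le_trans (ge_of_tendsto hlim ?_) zero_le
    filter_upwards [eventually_ge_atTop 0] with θ hθ
    simpa using key θ hθ
  · have hvp : (0 : ℝ) < v := by exact_mod_cast pos_iff_ne_zero.2 hv0
    refine (key (t / (c * v)) (by positivity)).trans_eq ?_
    have h1 : ENNReal.ofReal (t ^ 2) / (ENNReal.ofReal (2 * c) * (v : ℝ≥0∞))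
        = ENNReal.ofReal (t ^ 2 / (2 * c * v)) := by
      rw [ENNReal.ofReal_div_of_pos (by positivity),
        ENNReal.ofReal_mul (p := 2 * c) (by positivity), ENNReal.ofReal_coe_nnreal]
    rw [h1, EReal.coe_ennreal_ofReal, max_eq_left (by positivity), ← EReal.coe_neg,
      EReal.exp_coe]
    congr 3
    field_simp
    ring

include hA in
theorem integrable_lambdaMax {f : Ω → Matrix (Fin d) (Fin d) ℂ} (hf : IsSuitable A f)
    (hd : 0 < d) : Integrable (fun z => lambdaMax (f z)) μ := by
  have hf' := isSuitable_iff.1 hf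
  refine ((hf'.2.integrable hA).norm).mono' (measurable_lambdaMax hd
    (hf'.2.stronglyMeasurable hA) hf'.1).aestronglyMeasurable
    (Eventually.of_forall fun z => abs_lambdaMax_le hd (hf'.1 z))

include hA in
/-- Jensen's inequality for the truncated largest eigenvalue. -/
theorem integral_min_lambdaMax_le {f : Ω → Matrix (Fin d) (Fin d) ℂ} (hf : IsSuitable A f)
    (hd : 0 < d) (k : ℝ) {θ : ℝ} (hθ : 0 < θ) :
    ∫ z, min (lambdaMax (f z)) k ∂μ ≤ (Real.log d + Real.log (truncMGF μ f k θ)) / θ := by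
  have hd' : (0 : ℝ) < d := by exact_mod_cast hd
  have hm0 := truncMGF_pos hA hf hd k hθ.le
  set y := Real.log d + Real.log (truncMGF μ f k θ) with hy
  have hey : Real.exp y = d * truncMGF μ f k θ := by
    rw [hy, Real.exp_add, Real.exp_log hd', Real.exp_log hm0]
  have hi : Integrable (fun z => min (lambdaMax (f z)) k) μ :=
    (integrable_lambdaMax hA hf hd).inf (integrable_const k)
  rw [le_div_iff₀ hθ]
  have hj : Integrable (fun z => θ * min (lambdaMax (f z)) k - y) μ :=
    (hi.const_mul θ).sub (integrable_const y)
  -- Jensen's inequality in linear form: `exp` lies above its tangent at `y = log(d m)`, and `e^y`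
  -- then cancels from both sides.
  have h1 : ∫ z, Real.exp y * (1 + (θ * min (lambdaMax (f z)) k - y)) ∂μ
      ≤ ∫ z, d * ((d : ℝ)⁻¹ * reTr d (cfc (truncExp k θ) (f z))) ∂μ := by
    refine integral_mono (((integrable_const 1).add hj).const_mul _)
      ((integrable_truncMGF hA hf hd k hθ.le).const_mul _) fun z => ?_
    change _ ≤ (d : ℝ) * ((d : ℝ)⁻¹ * reTr d (cfc (truncExp k θ) (f z)))
    rw [mul_inv_cancel_left₀ hd'.ne']
    refine le_trans ?_ (apply_lambdaMax_le_reTr_cfc hd (hf.isHermitian z)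
      fun x => (truncExp_pos k θ x).le)
    have h2 : truncExp k θ (lambdaMax (f z))
        = Real.exp y * Real.exp (θ * min (lambdaMax (f z)) k - y) := by
      rw [truncExp, ← Real.exp_add]
      ring_nf
    rw [h2]
    have := Real.add_one_le_exp (θ * min (lambdaMax (f z)) k - y)
    refine mul_le_mul_of_nonneg_left ?_ (Real.exp_pos y).le
    linarith
  rw [integral_const_mul, integral_const_mul, integral_add (integrable_const _) hj,
    integral_sub (hi.const_mul θ)
    (integrable_const y), integral_const_mul] at h1
  simp only [integral_const, probReal_univ, smul_eq_mul, one_mul] at h1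
  change _ ≤ d * truncMGF μ f k θ at h1
  rw [← hey] at h1
  have h2 := le_of_mul_le_mul_left (h1.trans_eq (mul_one _).symm) (Real.exp_pos y)
  linarith

include hA hstat hrev herg in
-- The bound for the truncated eigenvalue does not depend on `k`, so dominated convergence removes
-- the truncation before `θ` is optimized.
theorem integral_lambdaMax_le {c : ℝ} (hc : 0 < c) (hBE : BakryEmery P μ A d c)
    {f : Ω → Matrix (Fin d) (Fin d) ℂ} (hf : IsSuitable A f) (hd : 0 < d)
    (h0 : ∫ z, f z ∂μ = 0) (hv : varProxy P μ f < ∞) :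
    ∫ z, lambdaMax (f z) ∂μ ≤ √(2 * c * (varProxy P μ f).toReal * Real.log d) := by
  have hae := ae_norm_gamma_le hv
  set v := (varProxy P μ f).toReal
  rw [mul_assoc 2 c v]
  refine le_sqrt_of_forall_le (Real.log_natCast_nonneg d)
    (mul_nonneg hc.le ENNReal.toReal_nonneg) fun θ hθ => ?_
  have hi := integrable_lambdaMax hA hf hd
  have hlim : Tendsto (fun k : ℕ => ∫ z, min (lambdaMax (f z)) k ∂μ) atTop
      (𝓝 (∫ z, lambdaMax (f z) ∂μ)) := by
    refine tendsto_integral_of_dominated_convergence (fun z => |lambdaMax (f z)|)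
      (fun k => (hi.inf (integrable_const (k : ℝ))).aestronglyMeasurable) hi.abs
      (fun k => Eventually.of_forall fun z => ?_) (Eventually.of_forall fun z => ?_)
    · rw [Real.norm_eq_abs, abs_le]
      refine ⟨le_min (neg_abs_le _) ?_, (min_le_left _ _).trans (le_abs_self _)⟩
      exact (neg_nonpos.2 (abs_nonneg _)).trans (Nat.cast_nonneg k)
    · refine tendsto_const_nhds.congr' ?_
      filter_upwards [eventually_ge_atTop ⌈lambdaMax (f z)⌉₊] with k hk
      exact (min_eq_left ((Nat.le_ceil _).trans (by exact_mod_cast hk))).symm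
  refine le_of_tendsto' hlim fun k => (integral_min_lambdaMax_le hA hf hd k hθ).trans ?_
  gcongr
  rw [Real.log_le_iff_le_exp (truncMGF_pos hA hf hd k hθ.le)]
  exact truncMGF_le_of_varProxy hA hstat hrev herg hc hBE hf hd h0 k hθ.le hae

end Tails

/-! ### Reduction to centered functions and to the largest eigenvalue. -/

section Centered

variable {Ω : Type*} [MeasurableSpace Ω] {μ : Measure Ω} [IsProbabilityMeasure μ]
  {P : MarkovSemigroup Ω} {A : Subalgebra ℝ (Ω → ℝ)} {d : ℕ}

theorem IsSuitable.neg {f : Ω → Matrix (Fin d) (Fin d) ℂ}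
    (hf : IsSuitable A f) : IsSuitable A (-f) :=
  isSuitable_iff.2 ⟨fun z => (hf.isHermitian z).neg, (isSuitable_iff.1 hf).2.neg⟩

theorem lambdaMin_centered (f : Ω → Matrix (Fin d) (Fin d) ℂ) (z : Ω) :
    lambdaMin (centered μ f z) = -lambdaMax (centered μ (-f) z) := by
  rw [lambdaMin_eq_neg_lambdaMax_neg, centered, centered]
  congr 2
  simp only [Pi.neg_apply, integral_neg]
  abel

variable (hA : P.IsSuitableAlgebra μ A)

include hA in
theorem IsSuitable.centered {f : Ω → Matrix (Fin d) (Fin d) ℂ}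
    (hf : IsSuitable A f) : IsSuitable A (centered μ f) := by
  have hf' := isSuitable_iff.1 hf
  have hH : (∫ y, f y ∂μ).IsHermitian := by
    have h1 := (starL' ℝ : Matrix (Fin d) (Fin d) ℂ ≃L[ℝ] _).integral_comp_comm
      (μ := μ) f
    change star _ = _
    refine Eq.trans h1.symm (integral_congr_ae (Eventually.of_forall fun z => ?_))
    exact hf'.1 z
  exact isSuitable_iff.2 ⟨fun z => (hf'.1 z).sub hH, hf'.2.sub (IsCoordwise.const A _)⟩

include hA in
theorem integral_centered {f : Ω → Matrix (Fin d) (Fin d) ℂ} (hf : IsSuitable A f) :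
    ∫ z, centered μ f z ∂μ = 0 := by
  have hf' := isSuitable_iff.1 hf
  unfold centered
  rw [integral_sub (hf'.2.integrable hA) (integrable_const _)]
  simp

include hA in
theorem gamma_centered {f : Ω → Matrix (Fin d) (Fin d) ℂ} (hf : IsSuitable A f) :
    P.gamma (centered μ f) (centered μ f) = P.gamma f f :=
  (isSuitable_iff.1 hf).2.gamma_sub_const hA _

include hA in
theorem gamma_neg_neg {f : Ω → Matrix (Fin d) (Fin d) ℂ} (hf : IsSuitable A f) :
    P.gamma (-f) (-f) = P.gamma f f :=
  (isSuitable_iff.1 hf).2.gamma_neg hA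

theorem expTail_congr {f g : Ω → Matrix (Fin d) (Fin d) ℂ} (h : P.gamma f f = P.gamma g g)
    (c t : ℝ) : expTail P μ f c t = expTail P μ g c t := by
  simp only [expTail, expMean, h]

theorem varProxy_congr {f g : Ω → Matrix (Fin d) (Fin d) ℂ} (h : P.gamma f f = P.gamma g g) :
    varProxy P μ f = varProxy P μ g := by
  simp only [varProxy, h]

theorem gaussTail_congr {f g : Ω → Matrix (Fin d) (Fin d) ℂ} (h : P.gamma f f = P.gamma g g)
    (c t : ℝ) : gaussTail P μ f c t = gaussTail P μ g c t := by
  simp only [gaussTail, varProxy, h]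

end Centered

end MatrixMarkov

theorem theorem3p4 {Ω : Type*} [TopologicalSpace Ω] [PolishSpace Ω] [MeasurableSpace Ω]
    [BorelSpace Ω] (μ : Measure Ω) [IsProbabilityMeasure μ]
    (P : MarkovSemigroup Ω) (hstat : P.IsStationary μ) (hrev : P.IsReversible μ)
    (herg : P.IsErgodic μ)
    (A : Subalgebra ℝ (Ω → ℝ)) (hA : P.IsSuitableAlgebra μ A)
    (d : ℕ) (hd : 0 < d) (c : ℝ) (hc : 0 < c) (hBE : BakryEmery P μ A d c)
    (f : Ω → Matrix (Fin d) (Fin d) ℂ) (hf : IsSuitable A f) :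
    (∀ t : ℝ, 0 ≤ t →
      μ {z | t ≤ lambdaMax (centered μ f z)}
          ≤ expTail P μ f c t ∧
      μ {z | lambdaMin (centered μ f z) ≤ -t}
          ≤ expTail P μ f c t) ∧
    (varProxy P μ f < ∞ →
      (∀ t : ℝ, 0 ≤ t →
        μ {z | t ≤ lambdaMax (centered μ f z)}
            ≤ gaussTail P μ f c t ∧
        μ {z | lambdaMin (centered μ f z) ≤ -t}
            ≤ gaussTail P μ f c t) ∧
      Integrable (fun z => lambdaMax (centered μ f z)) μ ∧
      Integrable (fun z => lambdaMin (centered μ f z)) μ ∧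
      ∫ z, lambdaMax (centered μ f z) ∂μ
          ≤ √(2 * c * (varProxy P μ f).toReal * Real.log d) ∧
      -√(2 * c * (varProxy P μ f).toReal * Real.log d)
          ≤ ∫ z, lambdaMin (centered μ f z) ∂μ) := by
  have hp := hf.centered hA
  have hm := hf.neg.centered hA
  have ip := integral_centered hA hf
  have im := integral_centered hA hf.neg
  have gp : P.gamma (centered μ f) (centered μ f) = P.gamma f f := gamma_centered hA hf
  have gm : P.gamma (centered μ (-f)) (centered μ (-f)) = P.gamma f f :=
    (gamma_centered hA hf.neg).trans (gamma_neg_neg hA hf)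
  -- Statements on the smallest eigenvalue become statements on the largest one for `-f`. Centering
  -- and negation leave `Γ` unchanged, so the bounds are those of `f`.
  simp only [lambdaMin_centered, neg_le_neg_iff]
  refine ⟨fun t ht => ⟨?_, ?_⟩, fun hv => ⟨fun t ht => ⟨?_, ?_⟩, ?_, ?_, ?_, ?_⟩⟩
  · rw [← expTail_congr gp]
    exact measure_le_expTail hA hstat hrev herg hc hBE hp hd ip ht
  · rw [← expTail_congr gm]
    exact measure_le_expTail hA hstat hrev herg hc hBE hm hd im ht
  · rw [← varProxy_congr gp] at hv
    rw [← gaussTail_congr gp]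
    exact measure_le_gaussTail hA hstat hrev herg hc hBE hp hd ip hv ht
  · rw [← varProxy_congr gm] at hv
    rw [← gaussTail_congr gm]
    exact measure_le_gaussTail hA hstat hrev herg hc hBE hm hd im hv ht
  · exact integrable_lambdaMax hA hp hd
  · exact (integrable_lambdaMax hA hm hd).neg
  · rw [← varProxy_congr gp] at hv ⊢
    exact integral_lambdaMax_le hA hstat hrev herg hc hBE hp hd ip hv
  · rw [← varProxy_congr gm] at hv ⊢
    rw [integral_neg, neg_le_neg_iff]
    exact integral_lambdaMax_le hA hstat hrev herg hc hBE hm hd im hv
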